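/- Let $d \ge 3$ and let $V \in L^1_{\mathrm{loc}}(\mathbb{R}^d)$ be a complex-valued potential with $\Re V = 0$ almost everywhere. Assume that there is $b_1 \in [0,1)$ such that $$\int_{\mathbb{R}^d} (|\Re V| + |\Im V|)\,|\psi|^2 \le b_1 \int_{\mathbb{R}^d} |\nabla \psi|^2 \qquad \text{for all } \psi \in W^{1,2}(\mathbb{R}^d),$$ and that there is $b_2 \in [0,1/2)$ such that $$\int_{\mathbb{R}^d} |x|^2\,|\Im V|^2\,|\psi|^2 \le b_2^2 \int_{\mathbb{R}^d} |\nabla \psi|^2 \qquad \text{for all } \psi \in W^{1,2}(\mathbb{R}^d).$$ Let $H_{0,V} = -\Delta + V$ be the operator in $L^2(\mathbb{R}^d)$ (complex-valued functions) associated with the sesquilinear form $h(\phi,\psi) = \int \overline{\nabla\phi}\cdot\nabla\psi + \int V\,\overline{\phi}\,\psi$ with form domain $W^{1,2}(\mathbb{R}^d)$: a function $\psi \in W^{1,2}(\mathbb{R}^d)$ belongs to the domain of $H_{0,V}$, with $H_{0,V}\psi = \eta \in L^2(\mathbb{R}^d)$, if and only if $h(\phi,\psi) = \int \overline{\phi}\,\eta$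 for all $\phi \in W^{1,2}(\mathbb{R}^d)$. Then $H_{0,V}$ has no eigenvalues: $\sigma_{\mathrm{p}}(H_{0,V}) = \varnothing$, i.e. there are no $\lambda \in \mathbb{C}$ and $\psi \ne 0$ in the domain of $H_{0,V}$ with $H_{0,V}\psi = \lambda\psi$. -/

import Mathlib

open MeasureTheory
open scoped ContDiff ComplexConjugate ENNReal NNReal

namespace Schrodinger

/-- Euclidean space `ℝ^d`. -/
abbrev E (d : ℕ) := EuclideanSpace ℝ (Fin d)

/-- The complex Hilbert space `L²(ℝ^d)`; its inner product is linear in the second entry. -/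
noncomputable abbrev L2 (d : ℕ) := Lp ℂ 2 (volume : Measure (E d))

/-- The complex Hilbert space `L²(ℝ^d; ℂ^d)` of square-integrable vector fields. -/
noncomputable abbrev L2Vec (d : ℕ) := Lp (EuclideanSpace ℂ (Fin d)) 2 (volume : Measure (E d))

/-- `G` is the distributional gradient of `ψ`: for every real test function `g` and every
coordinate `j`, `∫ (∂_j g) ψ = - ∫ g G_j`. -/
def IsWeakGradient {d : ℕ} (ψ : L2 d) (G : L2Vec d) : Prop :=
  ∀ g : E d → ℝ, ContDiff ℝ ∞ g → HasCompactSupport g → ∀ j : Fin d,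
    ∫ x, fderiv ℝ g x (EuclideanSpace.single j 1) • ψ x = - ∫ x, g x • G x j

theorem locallyIntegrable_L2 {d : ℕ} (ψ : L2 d) :
    LocallyIntegrable (fun x => ψ x) (volume : Measure (E d)) :=
  (Lp.memLp ψ).locallyIntegrable (by norm_num)

theorem memLp_coord {d : ℕ} (G : L2Vec d) (j : Fin d) :
    MemLp (fun x => G x j) 2 (volume : Measure (E d)) :=
  (EuclideanSpace.proj (𝕜 := ℂ) j).comp_memLp' (Lp.memLp G)

theorem locallyIntegrable_coord {d : ℕ} (G : L2Vec d) (j : Fin d) :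
    LocallyIntegrable (fun x => G x j) (volume : Measure (E d)) :=
  (memLp_coord G j).locallyIntegrable (by norm_num)

theorem continuous_partial {d : ℕ} {g : E d → ℝ} (hg : ContDiff ℝ ∞ g) (v : E d) :
    Continuous (fun x => fderiv ℝ g x v) :=
  (hg.continuous_fderiv (by simp)).clm_apply continuous_const

theorem hasCompactSupport_partial {d : ℕ} {g : E d → ℝ} (hs : HasCompactSupport g) (v : E d) :
    HasCompactSupport (fun x => fderiv ℝ g x v) :=
  hs.fderiv_apply (𝕜 := ℝ) v

/-- The graph of the weak gradient, as a subspace of `L²(ℝ^d) × L²(ℝ^d; ℂ^d)`. -/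
def gradGraph (d : ℕ) : Submodule ℂ (L2 d × L2Vec d) where
  carrier := {p | IsWeakGradient p.1 p.2}
  zero_mem' := by
    intro g _ _ j
    have h1 : ∫ x, fderiv ℝ g x (EuclideanSpace.single j 1) • ((0 : L2 d) : E d → ℂ) x = 0 := by
      apply integral_eq_zero_of_ae
      exact Filter.Eventually.of_forall fun x => by simp
    have h2 : ∫ x, g x • ((0 : L2Vec d) : E d → EuclideanSpace ℂ (Fin d)) x j = 0 := by
      apply integral_eq_zero_of_ae
      exact Filter.Eventually.of_forall fun x => by simp
    exact h1.trans (by rw [← neg_zero, ← h2]; rfl)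
  add_mem' := by
    rintro ⟨ψ, G⟩ ⟨ψ', G'⟩ h h' g hg hs j
    have e1 := h g hg hs j
    have e2 := h' g hg hs j
    simp only at e1 e2 ⊢
    have h1 : ∫ x, fderiv ℝ g x (EuclideanSpace.single j 1) • (ψ + ψ' : L2 d) x
        = (∫ x, fderiv ℝ g x (EuclideanSpace.single j 1) • ψ x)
          + ∫ x, fderiv ℝ g x (EuclideanSpace.single j 1) • ψ' x := by
      rw [← integral_add]
      · apply integral_congr_ae
        filter_upwards [Lp.coeFn_add ψ ψ'] with x hx
        rw [hx, Pi.add_apply, smul_add]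
      · exact (locallyIntegrable_L2 ψ).integrable_smul_left_of_hasCompactSupport
          (continuous_partial hg _) (hasCompactSupport_partial hs _)
      · exact (locallyIntegrable_L2 ψ').integrable_smul_left_of_hasCompactSupport
          (continuous_partial hg _) (hasCompactSupport_partial hs _)
    have h2 : ∫ x, g x • (G + G' : L2Vec d) x j
        = (∫ x, g x • G x j) + ∫ x, g x • G' x j := by
      rw [← integral_add]
      · apply integral_congr_ae
        filter_upwards [Lp.coeFn_add G G'] with x hx
        rw [hx, Pi.add_apply, PiLp.add_apply, smul_add]
      · exact (locallyIntegrable_coord G j).integrable_smul_left_of_hasCompactSupport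
          hg.continuous hs
      · exact (locallyIntegrable_coord G' j).integrable_smul_left_of_hasCompactSupport
          hg.continuous hs
    refine h1.trans ?_
    rw [e1, e2, ← neg_add, ← h2]
    rfl
  smul_mem' := by
    rintro c ⟨ψ, G⟩ h g hg hs j
    have e1 := h g hg hs j
    simp only at e1 ⊢
    have h1 : ∫ x, fderiv ℝ g x (EuclideanSpace.single j 1) • (c • ψ : L2 d) x
        = c * ∫ x, fderiv ℝ g x (EuclideanSpace.single j 1) • ψ x := by
      rw [← integral_const_mul]
      apply integral_congr_ae
      filter_upwards [Lp.coeFn_smul c ψ] with x hx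
      simp only [hx, Pi.smul_apply, smul_eq_mul, Complex.real_smul]
      ring
    have h2 : ∫ x, g x • (c • G : L2Vec d) x j = c * ∫ x, g x • G x j := by
      rw [← integral_const_mul]
      apply integral_congr_ae
      filter_upwards [Lp.coeFn_smul c G] with x hx
      simp only [hx, Pi.smul_apply, PiLp.smul_apply, smul_eq_mul, Complex.real_smul]
      ring
    refine h1.trans ?_
    rw [e1, mul_neg, ← h2]
    rfl

theorem gradGraph_functional (d : ℕ) :
    ∀ p ∈ gradGraph d, p.1 = 0 → p.2 = 0 := by
  rintro ⟨ψ, G⟩ h h0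
  have h0' : ψ = 0 := h0
  subst h0'
  have key : ∀ j : Fin d, ∀ᵐ x, G x j = 0 := by
    intro j
    apply ae_eq_zero_of_integral_contDiff_smul_eq_zero (locallyIntegrable_coord G j)
    intro g hg hs
    have e : ∫ x, fderiv ℝ g x (EuclideanSpace.single j 1) • ((0 : L2 d) : E d → ℂ) x
        = - ∫ x, g x • G x j := h g hg hs j
    have h1 : ∫ x, fderiv ℝ g x (EuclideanSpace.single j 1) • ((0 : L2 d) : E d → ℂ) x = 0 := by
      apply integral_eq_zero_of_ae
      exact Filter.Eventually.of_forall fun x => by simp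
    rw [h1] at e
    exact neg_eq_zero.mp e.symm
  refine Lp.ext ?_
  filter_upwards [ae_all_iff.mpr key,
    Lp.coeFn_zero (EuclideanSpace ℂ (Fin d)) 2 (volume : Measure (E d))] with x hx h0
  rw [h0]
  ext j
  simpa using hx j

/-- The weak gradient `∇` as an unbounded operator from `L²(ℝ^d)` to `L²(ℝ^d; ℂ^d)`, defined on
all `ψ` whose distributional gradient is square-integrable. -/
noncomputable def grad (d : ℕ) : L2 d →ₗ.[ℂ] L2Vec d := (gradGraph d).toLinearPMap

/-- The Sobolev space `W^{1,2}(ℝ^d) = {ψ ∈ L² : ∇ψ ∈ L²}`. -/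
noncomputable abbrev W12 (d : ℕ) : Submodule ℂ (L2 d) := (grad d).domain

theorem mem_graph_grad_iff {d : ℕ} (ψ : L2 d) (G : L2Vec d) :
    (ψ, G) ∈ (grad d).graph ↔ IsWeakGradient ψ G := by
  rw [grad, Submodule.toLinearPMap_graph_eq _ (gradGraph_functional d)]
  rfl

theorem exists_test_mem_W12 {d : ℕ} (g : E d → ℝ) (hg : ContDiff ℝ ∞ g)
    (hs : HasCompactSupport g) :
    ∃ φ : W12 d, ∀ᵐ x, (φ : L2 d) x = (g x : ℂ) := by
  have m0 : MemLp (fun x => (g x : ℂ)) 2 (volume : Measure (E d)) :=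
    (Complex.continuous_ofReal.comp hg.continuous).memLp_of_hasCompactSupport
      (hs.comp_left (g := fun r : ℝ => (r : ℂ)) (by simp))
  have m1 : MemLp (fun x => WithLp.toLp 2 (fun j : Fin d =>
      (fderiv ℝ g x (EuclideanSpace.single j 1) : ℂ))) 2 (volume : Measure (E d)) := by
    refine Continuous.memLp_of_hasCompactSupport ?_ ?_
    · refine (PiLp.continuous_toLp 2 _).comp (continuous_pi fun j => ?_)
      exact Complex.continuous_ofReal.comp (continuous_partial hg _)
    · exact (hs.fderiv (𝕜 := ℝ)).comp_left (g := fun L : E d →L[ℝ] ℝ =>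
        WithLp.toLp 2 (fun j : Fin d => (L (EuclideanSpace.single j 1) : ℂ))) (by ext; simp)
  have hw : IsWeakGradient (m0.toLp _) (m1.toLp _) := by
    intro f hf hfs j
    have a1 : ∫ x, fderiv ℝ f x (EuclideanSpace.single j 1) • (m0.toLp _ : L2 d) x
        = ((∫ x, fderiv ℝ f x (EuclideanSpace.single j 1) * g x : ℝ) : ℂ) := by
      rw [← integral_complex_ofReal]
      apply integral_congr_ae
      filter_upwards [m0.coeFn_toLp] with x hx
      simp [hx]
    have a2 : ∫ x, f x • (m1.toLp _ : L2Vec d) x j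
        = ((∫ x, f x * fderiv ℝ g x (EuclideanSpace.single j 1) : ℝ) : ℂ) := by
      rw [← integral_complex_ofReal]
      apply integral_congr_ae
      filter_upwards [m1.coeFn_toLp] with x hx
      simp [hx]
    rw [a1, a2, integral_mul_fderiv_eq_neg_fderiv_mul_of_integrable]
    · simp
    · exact ((continuous_partial hf _).mul hg.continuous).integrable_of_hasCompactSupport
        ((hasCompactSupport_partial hfs _).mul_right)
    · exact (hf.continuous.mul (continuous_partial hg _)).integrable_of_hasCompactSupport
        (hfs.mul_right)
    · exact (hf.continuous.mul hg.continuous).integrable_of_hasCompactSupport hfs.mul_right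
    · exact fun x _ => (hf.differentiable (by simp)) x
    · exact fun x _ => (hg.differentiable (by simp)) x
  have hmem : m0.toLp _ ∈ (grad d).domain :=
    LinearPMap.mem_domain_of_mem_graph ((mem_graph_grad_iff _ _).mpr hw)
  exact ⟨⟨_, hmem⟩, m0.coeFn_toLp⟩

/-- The graph of the operator associated with the sesquilinear form
`h(φ, ψ) = ∫ conj(∇φ) · ∇ψ + ∫ V conj(φ) ψ` with form domain `W^{1,2}(ℝ^d)`: the pairs `(ψ, η)`
with `ψ ∈ W^{1,2}` and `h(φ, ψ) = (φ, η)` for all `φ ∈ W^{1,2}`. The integrability clause says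
that `h(φ, ψ)` is meaningful; `integrable_of_isFormSubordinate` below shows that it is automatic
for the potentials considered. -/
noncomputable def schrodingerGraph {d : ℕ} (V : E d → ℂ) : Submodule ℂ (L2 d × L2 d) where
  carrier := {p | ∃ ψ : W12 d, (ψ : L2 d) = p.1 ∧ ∀ φ : W12 d,
    Integrable (fun x => conj ((φ : L2 d) x) * (V x * (ψ : L2 d) x)) ∧
    inner ℂ (grad d φ) (grad d ψ) + ∫ x, conj ((φ : L2 d) x) * (V x * (ψ : L2 d) x)
      = inner ℂ (φ : L2 d) p.2}
  zero_mem' := by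
    refine ⟨0, rfl, fun φ => ?_⟩
    have h : (fun x => conj ((φ : L2 d) x) * (V x * ((0 : W12 d) : L2 d) x))
        =ᵐ[volume] fun _ => (0 : ℂ) := by
      exact Filter.Eventually.of_forall fun x => by simp
    refine ⟨(integrable_zero _ _ _).congr h.symm, ?_⟩
    rw [integral_congr_ae h]
    simp
  add_mem' := by
    rintro ⟨_, η⟩ ⟨_, η'⟩ ⟨ψ, rfl, h⟩ ⟨ψ', rfl, h'⟩
    refine ⟨ψ + ψ', rfl, fun φ => ?_⟩
    obtain ⟨i1, e1⟩ := h φ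
    obtain ⟨i2, e2⟩ := h' φ
    have hc : (fun x => conj ((φ : L2 d) x) * (V x * ((ψ + ψ' : W12 d) : L2 d) x)) =ᵐ[volume]
        (fun x => conj ((φ : L2 d) x) * (V x * (ψ : L2 d) x)
          + conj ((φ : L2 d) x) * (V x * (ψ' : L2 d) x)) := by
      filter_upwards [Lp.coeFn_add (ψ : L2 d) (ψ' : L2 d)] with x hx
      simp only [Submodule.coe_add, hx, Pi.add_apply]
      ring
    refine ⟨(i1.add i2).congr hc.symm, ?_⟩
    rw [integral_congr_ae hc, integral_add i1 i2, LinearPMap.map_add, inner_add_right]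
    simp only [Prod.mk_add_mk, inner_add_right]
    rw [← e1, ← e2]
    ring
  smul_mem' := by
    rintro c ⟨_, η⟩ ⟨ψ, rfl, h⟩
    refine ⟨c • ψ, rfl, fun φ => ?_⟩
    obtain ⟨i1, e1⟩ := h φ
    have hc : (fun x => conj ((φ : L2 d) x) * (V x * ((c • ψ : W12 d) : L2 d) x)) =ᵐ[volume]
        (fun x => c * (conj ((φ : L2 d) x) * (V x * (ψ : L2 d) x))) := by
      filter_upwards [Lp.coeFn_smul c (ψ : L2 d)] with x hx
      simp only [Submodule.coe_smul, hx, Pi.smul_apply, smul_eq_mul]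
      ring
    refine ⟨(i1.const_mul c).congr hc.symm, ?_⟩
    rw [integral_congr_ae hc, integral_const_mul, LinearPMap.map_smul, inner_smul_right]
    simp only [Prod.smul_mk, inner_smul_right]
    rw [← e1]
    ring

theorem schrodingerGraph_functional {d : ℕ} (V : E d → ℂ) :
    ∀ p ∈ schrodingerGraph V, p.1 = 0 → p.2 = 0 := by
  rintro ⟨_, η⟩ ⟨ψ, rfl, h⟩ h0
  have h0' : ψ = 0 := Subtype.ext h0
  subst h0'
  have key : ∀ᵐ x, η x = 0 := by
    apply ae_eq_zero_of_integral_contDiff_smul_eq_zero (locallyIntegrable_L2 η)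
    intro g hg hs
    obtain ⟨φ, hφ⟩ := exists_test_mem_W12 g hg hs
    obtain ⟨-, e⟩ := h φ
    have hz : ∫ x, conj ((φ : L2 d) x) * (V x * ((0 : W12 d) : L2 d) x) = 0 := by
      apply integral_eq_zero_of_ae
      exact Filter.Eventually.of_forall fun x => by simp
    rw [hz, LinearPMap.map_zero, inner_zero_right, zero_add] at e
    rw [MeasureTheory.L2.inner_def] at e
    rw [e]
    apply integral_congr_ae
    filter_upwards [hφ] with x hx
    simp [hx, mul_comm]
  refine Lp.ext ?_
  filter_upwards [key, Lp.coeFn_zero ℂ 2 (volume : Measure (E d))] with x hx h0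
  rw [h0, hx]
  rfl

/-- The Schrödinger operator `H_{0,V} = -Δ + V` in `L²(ℝ^d)`, realised through its sesquilinear
form. -/
noncomputable def schrodinger {d : ℕ} (V : E d → ℂ) : L2 d →ₗ.[ℂ] L2 d :=
  (schrodingerGraph V).toLinearPMap

theorem graph_schrodinger {d : ℕ} (V : E d → ℂ) :
    (schrodinger V).graph = schrodingerGraph V :=
  Submodule.toLinearPMap_graph_eq _ (schrodingerGraph_functional V)

/-- The point spectrum of an unbounded operator: the set of its eigenvalues. -/
def pointSpectrum {H : Type*} [AddCommGroup H] [Module ℂ H] (T : H →ₗ.[ℂ] H) : Set ℂ :=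
  {μ | ∃ ψ : T.domain, ψ ≠ 0 ∧ T ψ = μ • (ψ : H)}

/-- Subordination: there is `b < 1` such that
`∫ (|Re V| + |Im V|) |ψ|² ≤ b ∫ |∇ψ|²` for all `ψ ∈ W^{1,2}(ℝ^d)`. -/
def IsFormSubordinate {d : ℕ} (V : E d → ℂ) : Prop :=
  ∃ b : ℝ≥0, b < 1 ∧ ∀ ψ : W12 d,
    ∫⁻ x, (‖(V x).re‖ₑ + ‖(V x).im‖ₑ) * ‖(ψ : L2 d) x‖ₑ ^ 2
      ≤ (b : ℝ≥0∞) * ∫⁻ x, ‖grad d ψ x‖ₑ ^ 2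

/-- Smallness: there is `b < 1/2` such that
`∫ |x|² |Im V|² |ψ|² ≤ b² ∫ |∇ψ|²` for all `ψ ∈ W^{1,2}(ℝ^d)`. -/
def IsSmallImaginary {d : ℕ} (V : E d → ℂ) : Prop :=
  ∃ b : ℝ≥0, b < 1 / 2 ∧ ∀ ψ : W12 d,
    ∫⁻ x, ‖x‖ₑ ^ 2 * ‖(V x).im‖ₑ ^ 2 * ‖(ψ : L2 d) x‖ₑ ^ 2
      ≤ (b : ℝ≥0∞) ^ 2 * ∫⁻ x, ‖grad d ψ x‖ₑ ^ 2

theorem integrable_of_isFormSubordinate {d : ℕ} {V : E d → ℂ}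
    (hV : AEStronglyMeasurable V volume) (hsub : IsFormSubordinate V) (φ ψ : W12 d) :
    Integrable (fun x => conj ((φ : L2 d) x) * (V x * (ψ : L2 d) x)) := by
  obtain ⟨b, -, hb⟩ := hsub
  have hfin : ∀ χ : W12 d,
      ∫⁻ x, (‖(V x).re‖ₑ + ‖(V x).im‖ₑ) * ‖(χ : L2 d) x‖ₑ ^ 2 < ⊤ := by
    intro χ
    refine (hb χ).trans_lt (ENNReal.mul_lt_top ENNReal.coe_lt_top ?_)
    have h := (Lp.memLp (grad d χ)).2
    rw [eLpNorm_lt_top_iff_lintegral_rpow_enorm_lt_top (by norm_num) (by norm_num)] at h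
    simpa using h
  have mφ := (Lp.memLp (φ : L2 d)).1
  have mψ := (Lp.memLp (ψ : L2 d)).1
  have hm : AEStronglyMeasurable (fun x => conj ((φ : L2 d) x) * (V x * (ψ : L2 d) x))
      (volume : Measure (E d)) :=
    (Complex.continuous_conj.comp_aestronglyMeasurable mφ).mul (hV.mul mψ)
  refine ⟨hm, ?_⟩
  have hle : ∀ x, ‖conj ((φ : L2 d) x) * (V x * (ψ : L2 d) x)‖ₑ
      ≤ (‖(V x).re‖ₑ + ‖(V x).im‖ₑ) * ‖(φ : L2 d) x‖ₑ ^ 2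
        + (‖(V x).re‖ₑ + ‖(V x).im‖ₑ) * ‖(ψ : L2 d) x‖ₑ ^ 2 := by
    intro x
    have h1 : ‖V x‖ ≤ ‖(V x).re‖ + ‖(V x).im‖ := by
      simpa using Complex.norm_le_abs_re_add_abs_im (V x)
    have h2 : ‖(φ : L2 d) x‖ * ‖(ψ : L2 d) x‖ ≤ ‖(φ : L2 d) x‖ ^ 2 + ‖(ψ : L2 d) x‖ ^ 2 := by
      nlinarith [sq_nonneg (‖(φ : L2 d) x‖ - ‖(ψ : L2 d) x‖), sq_nonneg ‖(φ : L2 d) x‖,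
        sq_nonneg ‖(ψ : L2 d) x‖]
    have h3 : ‖conj ((φ : L2 d) x) * (V x * (ψ : L2 d) x)‖
        ≤ (‖(V x).re‖ + ‖(V x).im‖) * ‖(φ : L2 d) x‖ ^ 2
          + (‖(V x).re‖ + ‖(V x).im‖) * ‖(ψ : L2 d) x‖ ^ 2 := by
      rw [norm_mul, norm_mul, RCLike.norm_conj]
      calc _ = ‖V x‖ * (‖(φ : L2 d) x‖ * ‖(ψ : L2 d) x‖) := by ring
        _ ≤ (‖(V x).re‖ + ‖(V x).im‖) * (‖(φ : L2 d) x‖ ^ 2 + ‖(ψ : L2 d) x‖ ^ 2) := by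
            gcongr
        _ = _ := by ring
    have h4 : ∀ z : ℂ, ∀ a b : ℝ, ENNReal.ofReal ((‖a‖ + ‖b‖) * ‖z‖ ^ 2)
        = (‖a‖ₑ + ‖b‖ₑ) * ‖z‖ₑ ^ 2 := by
      intro z a b
      rw [ENNReal.ofReal_mul (by positivity), ENNReal.ofReal_add (by positivity) (by positivity),
        ENNReal.ofReal_pow (by positivity), ofReal_norm, ofReal_norm,
        ofReal_norm]
    rw [← ofReal_norm, ← h4, ← h4, ← ENNReal.ofReal_add (by positivity) (by positivity)]
    exact ENNReal.ofReal_le_ofReal h3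
  refine (lintegral_mono hle).trans_lt ?_
  rw [lintegral_add_left']
  · exact ENNReal.add_lt_top.mpr ⟨hfin φ, hfin ψ⟩
  · exact ((Complex.measurable_re.comp_aemeasurable hV.aemeasurable).enorm.add
      (Complex.measurable_im.comp_aemeasurable hV.aemeasurable).enorm).mul
      (mφ.aemeasurable.enorm.pow_const 2)

end Schrodinger

namespace Schrodinger
open Filter Topology
open scoped Convolution

/-! The proof is the method of multipliers, applied after a radial gauge change.

Write `V = iW` almost everywhere and let `ψ` solve `-Δψ + iWψ = μψ`. Testing with `ψ` itself and
taking real parts removes the potential and leaves `‖∇ψ‖² = Re μ ‖ψ‖²` (`norm_grad_sq_eq`). So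
either `∇ψ = 0`, and then `ψ = 0` by Hardy's inequality, or `Re μ > 0`. In the second case write `μ
= κ² + icκ` with `κ` real and `c ≥ 0`, the sign of `κ` being that of `Im μ`. For `v = e^{-iκ|x|}ψ`
the term `κ²` disappears from the equation, which becomes `Δv = iWv - iκ(2∂_r v + ((d-1)/|x|)v +
cv)` (`hasLocalLaplacian_rot`).

Multiply by the conjugate of `2 x·∇v + (d-1+c|x|)v`, integrate, and take real parts. This multiplier
is `|x|` times the bracket in the equation, so the whole `κ`-term is purely imaginary and drops out.
The zeroth-order part of the potential term drops out in the same way. On the other side, the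
Rellich–Pohozaev identity produces `∫|∇v|²` plus `c` times an integral that is nonnegative when `d ≥
3` (`exists_multiplier_bound`). With `v = v₁ + iv₂` the result is `∫|∇v|² + 2∫W(v₁ x·∇v₂ - v₂ x·∇v₁)
≤ 0` (`virial_inequality`). The smallness hypothesis applied to `v` bounds the second integral in
modulus by `2b∫|∇v|²`, and `2b < 1` forces `∇v = 0`. Hardy's inequality gives `v = 0`, hence `ψ =
0`.

The rest is justification for `ψ` merely in `W^{1,2}`. Quadratic identities are proved for smooth
functions with compactly supported weights and extended by mollification. The weights are cut off
both at infinity and at the origin, where `1/|x|` is singular and only `|x|Wv`, not `Wv`, is known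
to be square integrable. The derivatives of the cutoffs are `O(1/|x|)` uniformly. Since `v/|x|` lies
in `L²` by Hardy, every error term is a bounded factor tending to zero times a fixed integrable
function, so no decay of `ψ` is needed. -/

/-- The partial derivative `∂_j g`. -/
noncomputable def pd {d : ℕ} (j : Fin d) (g : E d → ℝ) (x : E d) : ℝ :=
  fderiv ℝ g x (EuclideanSpace.single j 1)

/-! ### Mollification in `L²` -/

/-- Continuity at `0` of the translation action on `L²`. This is the only source of smallness in the
convergence of mollifiers. -/
theorem exists_eLpNorm_translate_sub_le {d : ℕ} {h : E d → ℝ} (hh : MemLp h 2 volume)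
    {ε : ℝ≥0∞} (hε : 0 < ε) :
    ∃ δ > 0, ∀ y : E d, ‖y‖ < δ → eLpNorm (fun x => h (x - y) - h x) 2 volume ≤ ε := by
  have : Fact ((2 : ℝ≥0∞) ≠ ⊤) := ⟨by norm_num⟩
  have hc : Continuous (fun y : E d => DomAddAct.mk (-y) +ᵥ hh.toLp h) := by
    have h1 : Continuous (fun y : E d => DomAddAct.mk (-y)) :=
      DomAddAct.continuous_mk.comp continuous_neg
    exact h1.vadd continuous_const
  have ht := hc.tendsto 0
  rw [EMetric.tendsto_nhds] at ht
  have h2 := ht ε hε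
  rw [Metric.eventually_nhds_iff] at h2
  obtain ⟨δ, hδ, h3⟩ := h2
  refine ⟨δ, hδ, fun y hy => ?_⟩
  have h4 := h3 (y := y) (by simpa using hy)
  rw [DomAddAct.mk_vadd_toLp, DomAddAct.mk_vadd_toLp, Lp.edist_toLp_toLp] at h4
  refine le_of_eq_of_le ?_ h4.le
  congr 1
  ext x
  simp [neg_add_eq_sub]

/-- Jensen's inequality for a probability density, obtained from Cauchy–Schwarz by the splitting `f
g = √f · (√f g)`. -/
theorem enorm_lintegral_mul_sq_le {α : Type*} [MeasurableSpace α] {μ : Measure α}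
    {f g : α → ℝ≥0∞} (hf : AEMeasurable f μ) (hg : AEMeasurable g μ) (h1 : ∫⁻ x, f x ∂μ = 1) :
    (∫⁻ x, f x * g x ∂μ) ^ 2 ≤ ∫⁻ x, f x * g x ^ 2 ∂μ := by
  have hs : ∀ z : ℝ≥0∞, z ^ (1 / 2 : ℝ) * z ^ (1 / 2 : ℝ) = z := by
    intro z
    rw [← ENNReal.rpow_add_of_nonneg _ _ (by norm_num) (by norm_num)]
    norm_num
  have hs2 : ∀ z : ℝ≥0∞, (z ^ (1 / 2 : ℝ)) ^ 2 = z := by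
    intro z
    rw [sq, hs]
  have key := ENNReal.lintegral_mul_le_Lp_mul_Lq μ (p := 2) (q := 2) (by
    exact Real.HolderConjugate.two_two) (f := fun x => f x ^ (1 / 2 : ℝ))
    (g := fun x => f x ^ (1 / 2 : ℝ) * g x) (hf.pow_const _) ((hf.pow_const _).mul hg)
  have e1 : ∀ x, ((fun x => f x ^ (1 / 2 : ℝ)) * fun x => f x ^ (1 / 2 : ℝ) * g x) x
      = f x * g x := by
    intro x
    simp only [Pi.mul_apply]
    rw [← mul_assoc, hs]
  have e2 : ∀ x, (f x ^ (1 / 2 : ℝ)) ^ (2 : ℝ) = f x := by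
    intro x
    rw [ENNReal.rpow_two, hs2]
  have e3 : ∀ x, (f x ^ (1 / 2 : ℝ) * g x) ^ (2 : ℝ) = f x * g x ^ 2 := by
    intro x
    rw [ENNReal.rpow_two, mul_pow, hs2]
  simp only [e1, e2, e3, h1, ENNReal.one_rpow, one_mul] at key
  calc (∫⁻ x, f x * g x ∂μ) ^ 2 ≤ ((∫⁻ x, f x * g x ^ 2 ∂μ) ^ (1 / 2 : ℝ)) ^ 2 := by gcongr
    _ = _ := hs2 _

/-- The mollification `ρ * h`. -/
noncomputable def mollify {d : ℕ} (φ : ContDiffBump (0 : E d)) (h : E d → ℝ) : E d → ℝ :=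
  (φ.normed volume) ⋆[ContinuousLinearMap.lsmul ℝ ℝ, volume] h

theorem mollify_sub_eq {d : ℕ} (φ : ContDiffBump (0 : E d)) {h : E d → ℝ}
    (hh : LocallyIntegrable h volume) (x : E d) :
    mollify φ h x - h x = ∫ t, φ.normed volume t * (h (x - t) - h x) := by
  have hi : Integrable (fun t => φ.normed volume t * h (x - t)) volume := by
    have := (φ.hasCompactSupport_normed (μ := volume)).convolutionExists_left
      (ContinuousLinearMap.lsmul ℝ ℝ) φ.continuous_normed hh x
    exact this
  simp only [mul_sub]
  rw [integral_sub hi (φ.integrable_normed.mul_const _), integral_mul_const, φ.integral_normed,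
    one_mul]
  rfl

/-- The difference is an average of `h(· - t) - h` over `t` in the support of the bump. Jensen
followed by Tonelli bounds its `L²` norm by the worst translation in that support. -/
theorem eLpNorm_mollify_sub_le {d : ℕ} {h : E d → ℝ} (hh : MemLp h 2 volume)
    (φ : ContDiffBump (0 : E d)) {ε : ℝ≥0∞}
    (hε : ∀ y : E d, ‖y‖ < φ.rOut → eLpNorm (fun x => h (x - y) - h x) 2 volume ≤ ε) :
    eLpNorm (fun x => mollify φ h x - h x) 2 volume ≤ ε := by
  have hL : ∀ k : E d → ℝ, eLpNorm k 2 volume = (∫⁻ x, ‖k x‖ₑ ^ 2) ^ (1 / 2 : ℝ) := by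
    intro k
    rw [eLpNorm_eq_lintegral_rpow_enorm_toReal (by norm_num) (by norm_num)]
    simp
  have hsq : ∀ z w : ℝ≥0∞, z ^ (1 / 2 : ℝ) ≤ w ↔ z ≤ w ^ 2 := by
    intro z w
    rw [one_div, ENNReal.rpow_inv_le_iff (by norm_num), ENNReal.rpow_two]
  rw [hL, hsq]
  have hli := hh.locallyIntegrable (by norm_num)
  set ρ : E d → ℝ := φ.normed volume with hρ
  have mρ : Measurable (fun t => ‖ρ t‖ₑ) := φ.continuous_normed.measurable.enorm
  have m1 : AEStronglyMeasurable (fun p : E d × E d => h (p.1 - p.2) - h p.1)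
      (volume.prod volume) := by
    refine AEStronglyMeasurable.sub ?_ ?_
    · exact hh.1.comp_quasiMeasurePreserving (quasiMeasurePreserving_sub_of_right_invariant _ _)
    · exact hh.1.comp_fst
  have hmass : ∫⁻ t, ‖ρ t‖ₑ = 1 := by
    have := φ.integral_normed (μ := (volume : Measure (E d)))
    have h2 := ofReal_integral_eq_lintegral_ofReal (φ.integrable_normed (μ := volume))
      (Eventually.of_forall fun x => φ.nonneg_normed x)
    rw [this] at h2
    rw [← ENNReal.ofReal_one, h2]
    refine lintegral_congr fun t => ?_
    rw [Real.enorm_eq_ofReal (φ.nonneg_normed t)]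
  have step : ∀ᵐ x, ‖mollify φ h x - h x‖ₑ ^ 2
      ≤ ∫⁻ t, ‖ρ t‖ₑ * ‖h (x - t) - h x‖ₑ ^ 2 := by
    filter_upwards [m1.prodMk_left] with x hx
    rw [mollify_sub_eq φ hli]
    refine le_trans ?_ (enorm_lintegral_mul_sq_le mρ.aemeasurable hx.aemeasurable.enorm hmass)
    gcongr
    refine (enorm_integral_le_lintegral_enorm _).trans (le_of_eq ?_)
    refine lintegral_congr fun t => ?_
    rw [enorm_mul]
  calc ∫⁻ x, ‖mollify φ h x - h x‖ₑ ^ 2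
      ≤ ∫⁻ x, ∫⁻ t, ‖ρ t‖ₑ * ‖h (x - t) - h x‖ₑ ^ 2 := lintegral_mono_ae step
    _ = ∫⁻ t, ∫⁻ x, ‖ρ t‖ₑ * ‖h (x - t) - h x‖ₑ ^ 2 := by
        refine lintegral_lintegral_swap ?_
        exact (mρ.comp measurable_snd).aemeasurable.mul (m1.aemeasurable.enorm.pow_const 2)
    _ = ∫⁻ t, ‖ρ t‖ₑ * ∫⁻ x, ‖h (x - t) - h x‖ₑ ^ 2 := by
        refine lintegral_congr fun t => ?_
        rw [lintegral_const_mul' _ _ (by simp)]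
    _ ≤ ∫⁻ t, ‖ρ t‖ₑ * ε ^ 2 := by
        refine lintegral_mono fun t => ?_
        by_cases ht : ‖t‖ < φ.rOut
        · have := hε t ht
          rw [hL, hsq] at this
          gcongr
        · have : ρ t = 0 := by
            by_contra hne
            have : t ∈ Function.support ρ := hne
            rw [hρ, φ.support_normed_eq] at this
            exact ht (by simpa using this)
          simp [this]
    _ = ε ^ 2 := by rw [lintegral_mul_const _ mρ, hmass, one_mul]

theorem tendsto_eLpNorm_mollify_sub {d : ℕ} {h : E d → ℝ} (hh : MemLp h 2 volume)
    {φ : ℕ → ContDiffBump (0 : E d)} (hφ : Tendsto (fun n => (φ n).rOut) atTop (𝓝 0)) :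
    Tendsto (fun n => eLpNorm (fun x => mollify (φ n) h x - h x) 2 volume) atTop (𝓝 0) := by
  rw [ENNReal.tendsto_nhds_zero]
  intro ε hε
  obtain ⟨δ, hδ, hle⟩ := exists_eLpNorm_translate_sub_le hh hε
  filter_upwards [hφ.eventually (gt_mem_nhds hδ)] with n hn
  exact eLpNorm_mollify_sub_le hh _ fun y hy => hle y (hy.trans hn)

theorem contDiff_mollify {d : ℕ} (φ : ContDiffBump (0 : E d)) {h : E d → ℝ}
    (hh : LocallyIntegrable h volume) : ContDiff ℝ ∞ (mollify φ h) :=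
  φ.hasCompactSupport_normed.contDiff_convolution_left _ φ.contDiff_normed hh

theorem pd_mollify {d : ℕ} (φ : ContDiffBump (0 : E d)) {h : E d → ℝ}
    (hh : LocallyIntegrable h volume) (j : Fin d) (x : E d) :
    pd j (mollify φ h) x = ∫ t, pd j (φ.normed volume) (x - t) * h t := by
  have h1 := φ.hasCompactSupport_normed (μ := volume) |>.hasFDerivAt_convolution_left
    (ContinuousLinearMap.lsmul ℝ ℝ) (φ.contDiff_normed (n := 1)) hh x
  have h2 : pd j (mollify φ h) x = ((fderiv ℝ (φ.normed volume)
      ⋆[(ContinuousLinearMap.lsmul ℝ ℝ).precompL (E d), volume] h) x)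
        (EuclideanSpace.single j 1) := by
    unfold pd mollify
    rw [h1.fderiv]
  rw [h2, convolution_eq_swap, ContinuousLinearMap.integral_apply]
  · rfl
  · have := ((φ.hasCompactSupport_normed (μ := volume)).fderiv (𝕜 := ℝ)).convolutionExists_left
      ((ContinuousLinearMap.lsmul ℝ ℝ : ℝ →L[ℝ] ℝ →L[ℝ] ℝ).precompL (E d))
      ((φ.contDiff_normed (n := 1)).continuous_fderiv one_ne_zero) hh x
    exact this.integrable_swap

/-! ### Weak gradients and divergences of real functions -/

/-- `p` is the weak gradient of the real function `w`. -/
def HasWeakGrad {d : ℕ} (w : E d → ℝ) (p : Fin d → E d → ℝ) : Prop :=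
  ∀ g : E d → ℝ, ContDiff ℝ ∞ g → HasCompactSupport g → ∀ j : Fin d,
    ∫ x, pd j g x * w x = - ∫ x, g x * p j x

/-- `f` is the weak divergence of the vector field `p`. -/
def HasWeakDiv {d : ℕ} (p : Fin d → E d → ℝ) (f : E d → ℝ) : Prop :=
  ∀ g : E d → ℝ, ContDiff ℝ ∞ g → HasCompactSupport g →
    ∑ j, ∫ x, pd j g x * p j x = - ∫ x, g x * f x

theorem contDiff_bump_sub {d : ℕ} (φ : ContDiffBump (0 : E d)) (x : E d) :
    ContDiff ℝ ∞ (fun t => φ.normed volume (x - t)) :=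
  φ.contDiff_normed.comp (contDiff_const.sub contDiff_id)

theorem hasCompactSupport_bump_sub {d : ℕ} (φ : ContDiffBump (0 : E d)) (x : E d) :
    HasCompactSupport (fun t => φ.normed volume (x - t)) :=
  (φ.hasCompactSupport_normed (μ := volume)).comp_homeomorph (Homeomorph.subLeft x)

theorem pd_bump_sub {d : ℕ} (φ : ContDiffBump (0 : E d)) (x t : E d) (j : Fin d) :
    pd j (fun t => φ.normed volume (x - t)) t = - pd j (φ.normed volume) (x - t) := by
  unfold pd
  have h1 : HasFDerivAt (fun t : E d => x - t) (-(ContinuousLinearMap.id ℝ (E d))) t :=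
    (hasFDerivAt_id t).const_sub x
  have h2 := ((φ.contDiff_normed (n := 1) (μ := volume)).differentiable one_ne_zero
    (x - t)).hasFDerivAt.comp t h1
  have h3 := h2.fderiv
  simp only [Function.comp_def] at h3
  rw [h3]
  simp

/-- The reflected kernel `t ↦ ρ(x - t)` is itself a test function. Differentiating it in `t` instead
of `x` costs a sign, which cancels the one in the definition of the weak gradient. -/
theorem HasWeakGrad.pd_mollify {d : ℕ} {w : E d → ℝ} {p : Fin d → E d → ℝ}
    (h : HasWeakGrad w p) (hw : LocallyIntegrable w volume)
    (φ : ContDiffBump (0 : E d)) (j : Fin d) :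
    pd j (mollify φ w) = mollify φ (p j) := by
  ext x
  rw [Schrodinger.pd_mollify φ hw]
  have h1 := h _ (contDiff_bump_sub φ x) (hasCompactSupport_bump_sub φ x) j
  simp only [pd_bump_sub, neg_mul, integral_neg, neg_inj] at h1
  rw [h1, mollify, convolution_eq_swap]
  rfl

theorem HasWeakDiv.sum_pd_mollify {d : ℕ} {p : Fin d → E d → ℝ} {f : E d → ℝ}
    (h : HasWeakDiv p f) (hp : ∀ j, LocallyIntegrable (p j) volume)
    (φ : ContDiffBump (0 : E d)) (x : E d) :
    ∑ j, pd j (mollify φ (p j)) x = mollify φ f x := by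
  have h1 := h _ (contDiff_bump_sub φ x) (hasCompactSupport_bump_sub φ x)
  simp only [pd_bump_sub, neg_mul, integral_neg, Finset.sum_neg_distrib, neg_inj] at h1
  simp only [fun j => Schrodinger.pd_mollify φ (hp j) j x]
  rw [h1, mollify, convolution_eq_swap]
  rfl

/-! ### Divergence identities for smooth functions -/

section PartialDerivatives

variable {d : ℕ}

theorem pd_mul {j : Fin d} {f g : E d → ℝ} {x : E d} (hf : DifferentiableAt ℝ f x)
    (hg : DifferentiableAt ℝ g x) :
    pd j (fun x => f x * g x) x = f x * pd j g x + pd j f x * g x := by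
  unfold pd
  rw [fderiv_fun_mul hf hg]
  simp [mul_comm]

theorem pd_add {j : Fin d} {f g : E d → ℝ} {x : E d} (hf : DifferentiableAt ℝ f x)
    (hg : DifferentiableAt ℝ g x) :
    pd j (fun x => f x + g x) x = pd j f x + pd j g x := by
  unfold pd
  rw [fderiv_fun_add hf hg]
  simp

theorem pd_sub {j : Fin d} {f g : E d → ℝ} {x : E d} (hf : DifferentiableAt ℝ f x)
    (hg : DifferentiableAt ℝ g x) :
    pd j (fun x => f x - g x) x = pd j f x - pd j g x := by
  unfold pd
  rw [fderiv_fun_sub hf hg]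
  simp

theorem pd_const_mul {j : Fin d} {g : E d → ℝ} {x : E d} (c : ℝ)
    (hg : DifferentiableAt ℝ g x) :
    pd j (fun x => c * g x) x = c * pd j g x := by
  unfold pd
  rw [fderiv_const_mul hg]
  simp

theorem pd_sum {ι : Type*} {s : Finset ι} {j : Fin d} {f : ι → E d → ℝ} {x : E d}
    (hf : ∀ i ∈ s, DifferentiableAt ℝ (f i) x) :
    pd j (fun x => ∑ i ∈ s, f i x) x = ∑ i ∈ s, pd j (f i) x := by
  unfold pd
  rw [fderiv_fun_sum hf]
  simp

theorem pd_coord (j k : Fin d) (x : E d) :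
    pd j (fun x : E d => x k) x = if k = j then 1 else 0 := by
  unfold pd
  have h : HasFDerivAt (fun x : E d => x k) (EuclideanSpace.proj (𝕜 := ℝ) k) x :=
    (EuclideanSpace.proj (𝕜 := ℝ) k).hasFDerivAt
  rw [h.fderiv]
  simp

theorem contDiff_coord (k : Fin d) : ContDiff ℝ ∞ (fun x : E d => x k) :=
  (EuclideanSpace.proj (𝕜 := ℝ) k).contDiff

theorem contDiff_pd {j : Fin d} {g : E d → ℝ} (hg : ContDiff ℝ ∞ g) : ContDiff ℝ ∞ (pd j g) :=
  (hg.fderiv_right (m := ∞) (by simp)).clm_apply contDiff_const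

theorem pd_comm {g : E d → ℝ} (hg : ContDiff ℝ ∞ g) (j k : Fin d) (x : E d) :
    pd j (pd k g) x = pd k (pd j g) x := by
  have hs : IsSymmSndFDerivAt ℝ g x :=
    hg.contDiffAt.isSymmSndFDerivAt (by
      simpa using WithTop.coe_le_coe.2 (le_top : (2 : ℕ∞) ≤ ⊤))
  have hd : DifferentiableAt ℝ (fderiv ℝ g) x :=
    ((hg.fderiv_right (m := ∞) (by simp)).differentiable (by simp)) x
  have e : ∀ v : E d, ∀ i : Fin d, pd i (fun y => fderiv ℝ g y v) x
      = fderiv ℝ (fderiv ℝ g) x (EuclideanSpace.single i 1) v := by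
    intro v i
    unfold pd
    rw [fderiv_clm_apply hd (differentiableAt_const v)]
    simp
  calc pd j (pd k g) x = _ := e _ j
    _ = _ := hs.eq _ _
    _ = _ := (e _ k).symm

theorem integral_pd_eq_zero {g : E d → ℝ} (hg : ContDiff ℝ ∞ g) (hs : HasCompactSupport g)
    (j : Fin d) : ∫ x, pd j g x = 0 := by
  have h := integral_mul_fderiv_eq_neg_fderiv_mul_of_integrable (μ := (volume : Measure (E d)))
    (f := fun _ : E d => (1 : ℝ)) (g := g) (v := EuclideanSpace.single j 1)
    (by simp) (by
      simpa using (continuous_partial hg _).integrable_of_hasCompactSupport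
        (hasCompactSupport_partial hs _))
    (by simpa using hg.continuous.integrable_of_hasCompactSupport hs)
    (fun x _ => by fun_prop) (fun x _ => (hg.differentiable (by simp)) x)
  simpa [pd] using h

/-- The Euler field `x · p`. -/
def euler (p : Fin d → E d → ℝ) (x : E d) : ℝ := ∑ k, x k * p k x

theorem integral_div_eq_zero {F : Fin d → E d → ℝ} (hF : ∀ j, ContDiff ℝ ∞ (F j))
    (hs : ∀ j, HasCompactSupport (F j)) : ∫ x, ∑ j, pd j (F j) x = 0 := by
  rw [integral_finsetSum]
  · exact Finset.sum_eq_zero fun j _ => integral_pd_eq_zero (hF j) (hs j) j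
  · intro j _
    exact (continuous_partial (hF j) _).integrable_of_hasCompactSupport
      (hasCompactSupport_partial (hs j) _)

/-- The integrand is the divergence of the compactly supported field `w² Y`. -/
theorem integral_radial_smooth {Y : Fin d → E d → ℝ} (hY : ∀ j, ContDiff ℝ ∞ (Y j))
    (hs : ∀ j, HasCompactSupport (Y j)) {w : E d → ℝ} (hw : ContDiff ℝ ∞ w) :
    ∫ x, ((∑ j, 2 * Y j x * (w x * pd j w x)) + ∑ j, pd j (Y j) x * (w x * w x)) = 0 := by
  rw [← integral_div_eq_zero (F := fun j x => Y j x * (w x * w x))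
    (fun j => (hY j).mul (hw.mul hw)) (fun j => (hs j).mul_right)]
  congr 1
  ext x
  rw [← Finset.sum_add_distrib]
  refine Finset.sum_congr rfl fun j _ => ?_
  have dw : DifferentiableAt ℝ w x := (hw.differentiable (by simp)) x
  rw [pd_mul (g := fun x => w x * w x) ((hY j).differentiable (by simp) x) (dw.mul dw),
    pd_mul dw dw]
  ring

/-- The integrand is the divergence of `a(2(x·∇w)∇w - |∇w|²x) + m w∇w`. The first field is the
Rellich–Pohozaev field of dilations, designed so that second derivatives of `w` survive only through
the Laplacian, which is what the equation controls. -/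
theorem integral_rellich_smooth {a m : E d → ℝ} (ha : ContDiff ℝ ∞ a) (hm : ContDiff ℝ ∞ m)
    (hsa : HasCompactSupport a) (hsm : HasCompactSupport m) {w : E d → ℝ} (hw : ContDiff ℝ ∞ w) :
    ∫ x, ((∑ k, 2 * a x * x k * ((∑ j, pd j (pd j w) x) * pd k w x))
      + m x * ((∑ j, pd j (pd j w) x) * w x)
      + (∑ j, (2 * a x + m x - (d * a x + euler (fun i => pd i a) x)) * (pd j w x * pd j w x))
      + (∑ j, ∑ k, 2 * pd j a x * x k * (pd j w x * pd k w x))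
      + ∑ j, pd j m x * (w x * pd j w x)) = 0 := by
  have hp : ∀ j, ContDiff ℝ ∞ (pd j w) := fun j => contDiff_pd hw
  have hR : ContDiff ℝ ∞ (euler fun i => pd i w) :=
    ContDiff.sum fun k _ => (contDiff_coord k).mul (hp k)
  have hN : ContDiff ℝ ∞ (fun x => ∑ k, pd k w x * pd k w x) :=
    ContDiff.sum fun k _ => (hp k).mul (hp k)
  have c1 : ∀ j, ContDiff ℝ ∞ (fun x => a x * (2 * (pd j w x * euler (fun i => pd i w) x)
      - x j * ∑ k, pd k w x * pd k w x)) := fun j =>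
    ha.mul ((contDiff_const.mul ((hp j).mul hR)).sub ((contDiff_coord j).mul hN))
  have c2 : ∀ j, ContDiff ℝ ∞ (fun x => m x * (w x * pd j w x)) := fun j => hm.mul (hw.mul (hp j))
  rw [← integral_div_eq_zero (F := fun j x =>
      a x * (2 * (pd j w x * euler (fun i => pd i w) x) - x j * ∑ k, pd k w x * pd k w x)
        + m x * (w x * pd j w x))
    (fun j => (c1 j).add (c2 j)) (fun j => (hsa.mul_right).add hsm.mul_right)]
  congr 1
  ext x
  have D : ∀ {f : E d → ℝ}, ContDiff ℝ ∞ f → DifferentiableAt ℝ f x :=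
    fun hf => hf.differentiable (by simp) x
  have eR : ∀ j, pd j (euler fun i => pd i w) x = pd j w x + ∑ k, x k * pd k (pd j w) x := by
    intro j
    have : pd j (euler fun i => pd i w) x = ∑ k, pd j (fun x => x k * pd k w x) x :=
      pd_sum fun k _ => D ((contDiff_coord k).mul (hp k))
    rw [this]
    simp only [fun k => pd_mul (j := j) (D (contDiff_coord k)) (D (hp k)), pd_coord,
      Finset.sum_add_distrib, fun k => pd_comm hw j k x]
    simp [add_comm]
  have eN : ∀ j, pd j (fun x => ∑ k, pd k w x * pd k w x) x
      = ∑ k, 2 * (pd k w x * pd j (pd k w) x) := by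
    intro j
    rw [pd_sum fun k _ => D ((hp k).mul (hp k))]
    refine Finset.sum_congr rfl fun k _ => ?_
    rw [pd_mul (D (hp k)) (D (hp k))]
    ring
  have eF : ∀ j, pd j (fun x =>
      a x * (2 * (pd j w x * euler (fun i => pd i w) x) - x j * ∑ k, pd k w x * pd k w x)
        + m x * (w x * pd j w x)) x
      = 2 * a x * pd j (pd j w) x * euler (fun i => pd i w) x
        + 2 * a x * (pd j w x * pd j w x)
        + 2 * a x * (∑ k, pd j w x * (x k * pd k (pd j w) x))
        - a x * (∑ k, pd k w x * pd k w x)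
        - 2 * a x * (∑ k, x j * (pd k w x * pd j (pd k w) x))
        + pd j a x * (2 * (pd j w x * euler (fun i => pd i w) x))
        - x j * pd j a x * (∑ k, pd k w x * pd k w x)
        + m x * (pd j w x * pd j w x) + m x * w x * pd j (pd j w) x
        + pd j m x * (w x * pd j w x) := by
    intro j
    rw [pd_add (D (c1 j)) (D (c2 j)), pd_mul (D ha)
      (D ((contDiff_const.mul ((hp j).mul hR)).sub ((contDiff_coord j).mul hN))),
      pd_sub (D (contDiff_const.mul ((hp j).mul hR))) (D ((contDiff_coord j).mul hN)),
      pd_const_mul _ (D ((hp j).mul hR)), pd_mul (D (hp j)) (D hR),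
      pd_mul (D (contDiff_coord j)) (D hN), eR, eN, pd_coord, pd_mul (D hm) (D (hw.mul (hp j))),
      pd_mul (D hw) (D (hp j))]
    simp only [← Finset.mul_sum]
    simp only [if_true]
    ring
  simp only [eF, Finset.sum_add_distrib, Finset.sum_sub_distrib]
  -- The Hessian terms from `∇(x·∇w)` and from `∇|∇w|²` coincide after exchanging the two indices,
  -- so they cancel.
  have sw : ∑ j, 2 * a x * (∑ k, pd j w x * (x k * pd k (pd j w) x))
      = ∑ j, 2 * a x * (∑ k, x j * (pd k w x * pd j (pd k w) x)) := by
    rw [← Finset.mul_sum, ← Finset.mul_sum, Finset.sum_comm]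
    congr 1
    refine Finset.sum_congr rfl fun j _ => Finset.sum_congr rfl fun k _ => ?_
    ring
  have e1 : ∑ j : Fin d, a x * (∑ k, pd k w x * pd k w x)
      = d * a x * (∑ k, pd k w x * pd k w x) := by
    simp [mul_assoc]
  have e2 : ∑ j, x j * pd j a x * (∑ k, pd k w x * pd k w x)
      = euler (fun i => pd i a) x * (∑ k, pd k w x * pd k w x) := by
    rw [← Finset.sum_mul]; rfl
  have e3 : ∑ j, ∑ k, 2 * pd j a x * x k * (pd j w x * pd k w x)
      = ∑ j, pd j a x * (2 * (pd j w x * euler (fun i => pd i w) x)) := by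
    refine Finset.sum_congr rfl fun j _ => ?_
    simp only [euler, Finset.mul_sum]
    refine Finset.sum_congr rfl fun k _ => ?_
    ring
  have e4 : ∑ k, 2 * a x * x k * ((∑ j, pd j (pd j w) x) * pd k w x)
      = ∑ j, 2 * a x * pd j (pd j w) x * euler (fun i => pd i w) x := by
    rw [← Finset.sum_mul, ← Finset.mul_sum]
    generalize ∑ j, pd j (pd j w) x = S
    simp only [euler, Finset.mul_sum]
    refine Finset.sum_congr rfl fun k _ => ?_
    ring
  have e5 : ∑ j, m x * w x * pd j (pd j w) x = m x * ((∑ j, pd j (pd j w) x) * w x) := by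
    rw [← Finset.mul_sum]; ring
  rw [sw, e1, e2, e3, e4, e5]
  simp only [← Finset.mul_sum]
  ring

end PartialDerivatives

/-! ### Passage to the limit in quadratic integrals -/

/-- The integrals of the functions `F n` converge to the integral of `F₀`. -/
structure IntLim {d : ℕ} (F : ℕ → E d → ℝ) (F₀ : E d → ℝ) : Prop where
  integrable : ∀ n, Integrable (F n) volume
  integrable_lim : Integrable F₀ volume
  tendsto : Tendsto (fun n => ∫ x, F n x) atTop (𝓝 (∫ x, F₀ x))

namespace IntLim

variable {d : ℕ} {F G : ℕ → E d → ℝ} {F₀ G₀ : E d → ℝ}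

theorem add (hF : IntLim F F₀) (hG : IntLim G G₀) :
    IntLim (fun n x => F n x + G n x) (fun x => F₀ x + G₀ x) where
  integrable n := (hF.integrable n).add (hG.integrable n)
  integrable_lim := hF.integrable_lim.add hG.integrable_lim
  tendsto := by
    rw [integral_add hF.integrable_lim hG.integrable_lim]
    refine (hF.tendsto.add hG.tendsto).congr fun n => ?_
    rw [integral_add (hF.integrable n) (hG.integrable n)]

theorem const_mul (hF : IntLim F F₀) (c : ℝ) :
    IntLim (fun n x => c * F n x) (fun x => c * F₀ x) where
  integrable n := (hF.integrable n).const_mul c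
  integrable_lim := hF.integrable_lim.const_mul c
  tendsto := by
    simp only [integral_const_mul]
    exact hF.tendsto.const_mul c

theorem sum {ι : Type*} {s : Finset ι} {F : ι → ℕ → E d → ℝ} {F₀ : ι → E d → ℝ}
    (h : ∀ i ∈ s, IntLim (F i) (F₀ i)) :
    IntLim (fun n x => ∑ i ∈ s, F i n x) (fun x => ∑ i ∈ s, F₀ i x) where
  integrable n := integrable_finsetSum _ fun i hi => (h i hi).integrable n
  integrable_lim := integrable_finsetSum _ fun i hi => (h i hi).integrable_lim
  tendsto := by
    rw [integral_finsetSum _ fun i hi => (h i hi).integrable_lim]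
    refine (tendsto_finsetSum _ fun i hi => (h i hi).tendsto).congr fun n => ?_
    rw [integral_finsetSum _ fun i hi => (h i hi).integrable n]

end IntLim

/-- Convergence in `L²` of a sequence of square-integrable functions. -/
structure TendstoL2 {d : ℕ} (u : ℕ → E d → ℝ) (u₀ : E d → ℝ) : Prop where
  memLp : ∀ n, MemLp (u n) 2 volume
  memLp_lim : MemLp u₀ 2 volume
  tendsto : Tendsto (fun n => eLpNorm (fun x => u n x - u₀ x) 2 volume) atTop (𝓝 0)

theorem TendstoL2.tendsto_toLp {d : ℕ} {u : ℕ → E d → ℝ} {u₀ : E d → ℝ} (h : TendstoL2 u u₀) :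
    Tendsto (fun n => (h.memLp n).toLp (u n)) atTop (𝓝 (h.memLp_lim.toLp u₀)) := by
  rw [tendsto_iff_edist_tendsto_0]
  simp only [Lp.edist_toLp_toLp]
  exact h.tendsto

theorem integral_mul_eq_inner {d : ℕ} {u v : E d → ℝ} (hu : MemLp u 2 volume)
    (hv : MemLp v 2 volume) : ∫ x, u x * v x = inner ℝ (hu.toLp u) (hv.toLp v) := by
  rw [MeasureTheory.L2.inner_def]
  refine integral_congr_ae ?_
  filter_upwards [hu.coeFn_toLp, hv.coeFn_toLp] with x h1 h2
  simp [h1, h2, mul_comm]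

theorem integrable_mul_of_memLp {d : ℕ} {u v : E d → ℝ} (hu : MemLp u 2 volume)
    (hv : MemLp v 2 volume) : Integrable (fun x => u x * v x) volume :=
  hu.integrable_mul hv

/-- The integral of a product is the `L²` inner product, which is jointly continuous. -/
theorem TendstoL2.intLim {d : ℕ} {u v : ℕ → E d → ℝ} {u₀ v₀ : E d → ℝ} (hu : TendstoL2 u u₀)
    (hv : TendstoL2 v v₀) : IntLim (fun n x => u n x * v n x) (fun x => u₀ x * v₀ x) where
  integrable n := integrable_mul_of_memLp (hu.memLp n) (hv.memLp n)
  integrable_lim := integrable_mul_of_memLp hu.memLp_lim hv.memLp_lim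
  tendsto := by
    simp only [fun n => integral_mul_eq_inner (hu.memLp n) (hv.memLp n),
      integral_mul_eq_inner hu.memLp_lim hv.memLp_lim]
    exact hu.tendsto_toLp.inner hv.tendsto_toLp

theorem memLp_bounded_mul {d : ℕ} {u β : E d → ℝ} (hu : MemLp u 2 volume)
    (hβ : AEStronglyMeasurable β volume) {C : ℝ} (hC : ∀ x, |β x| ≤ C) :
    MemLp (fun x => β x * u x) 2 volume := by
  refine (hu.const_mul C).mono (hβ.mul hu.1) (Eventually.of_forall fun x => ?_)
  rw [norm_mul, norm_mul, Real.norm_eq_abs]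
  gcongr
  exact (hC x).trans (le_abs_self C)

theorem TendstoL2.bounded_mul {d : ℕ} {u : ℕ → E d → ℝ} {u₀ β : E d → ℝ} (hu : TendstoL2 u u₀)
    (hβ : Continuous β) (hs : HasCompactSupport β) :
    TendstoL2 (fun n x => β x * u n x) (fun x => β x * u₀ x) := by
  obtain ⟨C, hC⟩ := hs.exists_bound_of_continuous hβ
  refine ⟨fun n => memLp_bounded_mul (hu.memLp n) hβ.aestronglyMeasurable hC,
    memLp_bounded_mul hu.memLp_lim hβ.aestronglyMeasurable hC, ?_⟩
  have h0 : Tendsto (fun n => ENNReal.ofReal C * eLpNorm (fun x => u n x - u₀ x) 2 volume) atTop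
      (𝓝 0) := by
    simpa using ENNReal.Tendsto.const_mul (a := ENNReal.ofReal C) hu.tendsto (by simp)
  refine tendsto_of_tendsto_of_tendsto_of_le_of_le tendsto_const_nhds h0 (fun _ => zero_le)
    fun n => ?_
  refine eLpNorm_le_mul_eLpNorm_of_ae_le_mul (Eventually.of_forall fun x => ?_) 2
  rw [← mul_sub, norm_mul]
  gcongr
  exact hC x

/-- By translation invariance the crude value `2‖h‖` is admissible in `eLpNorm_mollify_sub_le`, for
any bump. Thus the mollification differs from `h` by an `L²` function. -/
theorem memLp_mollify {d : ℕ} {h : E d → ℝ} (hh : MemLp h 2 volume)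
    (φ : ContDiffBump (0 : E d)) : MemLp (mollify φ h) 2 volume := by
  have hli := hh.locallyIntegrable (by norm_num)
  have hfin : eLpNorm (fun x => mollify φ h x - h x) 2 volume
      ≤ eLpNorm h 2 volume + eLpNorm h 2 volume := by
    refine eLpNorm_mollify_sub_le hh φ fun y _ => ?_
    have hmp : MeasurePreserving (fun x : E d => x - y) volume volume :=
      measurePreserving_sub_right volume y
    have h1 : eLpNorm (fun x => h (x - y)) 2 volume = eLpNorm h 2 volume :=
      eLpNorm_comp_measurePreserving hh.1 hmp
    calc _ ≤ eLpNorm (fun x => h (x - y)) 2 volume + eLpNorm h 2 volume :=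
          eLpNorm_sub_le (hh.1.comp_measurePreserving hmp) hh.1 (by norm_num)
      _ = _ := by rw [h1]
  have hm : MemLp (fun x => mollify φ h x - h x) 2 volume :=
    ⟨((contDiff_mollify φ hli).continuous.aestronglyMeasurable).sub hh.1,
      hfin.trans_lt (ENNReal.add_lt_top.mpr ⟨hh.2, hh.2⟩)⟩
  have e : (fun x => mollify φ h x - h x) + h = mollify φ h := by
    ext x
    simp
  exact e ▸ hm.add hh

theorem exists_bump_sequence (d : ℕ) : ∃ φ : ℕ → ContDiffBump (0 : E d),
    Tendsto (fun n => (φ n).rOut) atTop (𝓝 0) := by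
  refine ⟨fun n => ⟨1 / (2 * (n + 1)), 1 / (n + 1), by positivity, ?_⟩, ?_⟩
  · have : (0 : ℝ) < n + 1 := by positivity
    gcongr
    linarith
  · exact tendsto_one_div_add_atTop_nhds_zero_nat

theorem tendstoL2_mollify {d : ℕ} {h : E d → ℝ} (hh : MemLp h 2 volume)
    {φ : ℕ → ContDiffBump (0 : E d)} (hφ : Tendsto (fun n => (φ n).rOut) atTop (𝓝 0)) :
    TendstoL2 (fun n => mollify (φ n) h) h :=
  ⟨fun n => memLp_mollify hh (φ n), hh, tendsto_eLpNorm_mollify_sub hh hφ⟩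

theorem TendstoL2.intLim_mul {d : ℕ} {u v : ℕ → E d → ℝ} {u₀ v₀ β : E d → ℝ}
    (hu : TendstoL2 u u₀) (hv : TendstoL2 v v₀) (hβ : Continuous β) (hs : HasCompactSupport β) :
    IntLim (fun n x => β x * (u n x * v n x)) (fun x => β x * (u₀ x * v₀ x)) := by
  simpa only [mul_assoc] using (hu.bounded_mul hβ hs).intLim hv

/-! ### The divergence identities in Sobolev regularity -/

section Identities

variable {d : ℕ}

theorem continuous_pd {j : Fin d} {g : E d → ℝ} (hg : ContDiff ℝ ∞ g) : Continuous (pd j g) :=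
  continuous_partial hg _

theorem hasCompactSupport_pd {j : Fin d} {g : E d → ℝ} (hs : HasCompactSupport g) :
    HasCompactSupport (pd j g) :=
  hasCompactSupport_partial hs _

theorem integral_radial {Y : Fin d → E d → ℝ} (hY : ∀ j, ContDiff ℝ ∞ (Y j))
    (hs : ∀ j, HasCompactSupport (Y j)) {w : E d → ℝ} {p : Fin d → E d → ℝ}
    (hw : MemLp w 2 volume) (hp : ∀ j, MemLp (p j) 2 volume) (hwp : HasWeakGrad w p) :
    Integrable (fun x => (∑ j, 2 * Y j x * (w x * p j x)) + ∑ j, pd j (Y j) x * (w x * w x))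
      volume ∧
    ∫ x, ((∑ j, 2 * Y j x * (w x * p j x)) + ∑ j, pd j (Y j) x * (w x * w x)) = 0 := by
  obtain ⟨φ, hφ⟩ := exists_bump_sequence d
  have hwl := hw.locallyIntegrable (by norm_num)
  have Lw := tendstoL2_mollify hw hφ
  have Lp := fun j => tendstoL2_mollify (hp j) hφ
  have key := (IntLim.sum (s := Finset.univ) fun j _ => Lw.intLim_mul (Lp j)
    (β := fun x => 2 * Y j x) (continuous_const.mul (hY j).continuous) ((hs j).mul_left)).add
    (IntLim.sum (s := Finset.univ) fun j _ => Lw.intLim_mul Lw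
    (continuous_pd (j := j) (hY j)) (hasCompactSupport_pd (hs j)))
  refine ⟨key.integrable_lim, tendsto_nhds_unique key.tendsto ?_⟩
  refine tendsto_const_nhds.congr fun n => ?_
  have := integral_radial_smooth hY hs (contDiff_mollify (φ n) hwl)
  simp only [hwp.pd_mollify hwl] at this
  exact this.symm

/-- Mollifying `w` mollifies its gradient and Laplacian. Each term is a fixed, continuous, compactly
supported weight times a product of two functions converging in `L²`, so the smooth identity passes
to the limit. This is why the Laplacian is required to be square integrable. -/
theorem integral_rellich {a m : E d → ℝ} (ha : ContDiff ℝ ∞ a) (hm : ContDiff ℝ ∞ m)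
    (hsa : HasCompactSupport a) (hsm : HasCompactSupport m)
    {w f : E d → ℝ} {p : Fin d → E d → ℝ}
    (hw : MemLp w 2 volume) (hp : ∀ j, MemLp (p j) 2 volume) (hf : MemLp f 2 volume)
    (hwp : HasWeakGrad w p) (hpf : HasWeakDiv p f) :
    Integrable (fun x => (∑ k, 2 * a x * x k * (f x * p k x)) + m x * (f x * w x)
      + (∑ j, (2 * a x + m x - (d * a x + euler (fun i => pd i a) x)) * (p j x * p j x))
      + (∑ j, ∑ k, 2 * pd j a x * x k * (p j x * p k x))
      + ∑ j, pd j m x * (w x * p j x)) volume ∧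
    ∫ x, ((∑ k, 2 * a x * x k * (f x * p k x)) + m x * (f x * w x)
      + (∑ j, (2 * a x + m x - (d * a x + euler (fun i => pd i a) x)) * (p j x * p j x))
      + (∑ j, ∑ k, 2 * pd j a x * x k * (p j x * p k x))
      + ∑ j, pd j m x * (w x * p j x)) = 0 := by
  obtain ⟨φ, hφ⟩ := exists_bump_sequence d
  have hwl := hw.locallyIntegrable (by norm_num)
  have hpl := fun j => (hp j).locallyIntegrable (μ := volume) (by norm_num)
  have Lw := tendstoL2_mollify hw hφ
  have Lf := tendstoL2_mollify hf hφ
  have Lp := fun j => tendstoL2_mollify (hp j) hφ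
  have cc : ∀ k, Continuous fun x : E d => x k := fun k => (contDiff_coord k).continuous
  have cE : Continuous (euler fun i => pd i a) :=
    continuous_finsetSum _ fun k _ => (cc k).mul (continuous_pd ha)
  have sE : HasCompactSupport (euler fun i => pd i a) := by
    -- As a derivative of `a` applied to the vector `x`, this visibly vanishes wherever `fderiv ℝ a`
    -- does.
    have : (euler fun i => pd i a) = fun x => fderiv ℝ a x (∑ k, x k • EuclideanSpace.single k 1) := by
      ext x
      simp [euler, pd]
    rw [this]
    exact (hsa.fderiv (𝕜 := ℝ)).mono fun x hx => by
      contrapose! hx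
      simp [Function.notMem_support.mp hx]
  have b : Continuous (fun x => 2 * a x + m x - (d * a x + euler (fun i => pd i a) x)) :=
    ((continuous_const.mul ha.continuous).add hm.continuous).sub
      ((continuous_const.mul ha.continuous).add cE)
  have sb : HasCompactSupport (fun x => 2 * a x + m x - (d * a x + euler (fun i => pd i a) x)) :=
    ((hsa.mul_left).add hsm).sub ((hsa.mul_left).add sE)
  have key := ((((IntLim.sum (s := Finset.univ) fun k _ => Lf.intLim_mul (Lp k)
      (β := fun x => 2 * a x * x k) ((continuous_const.mul ha.continuous).mul (cc k))
      ((hsa.mul_left).mul_right)).add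
    (Lf.intLim_mul Lw hm.continuous hsm)).add
    (IntLim.sum (s := Finset.univ) fun j _ => (Lp j).intLim_mul (Lp j) b sb)).add
    (IntLim.sum (s := Finset.univ) fun j _ => IntLim.sum (s := Finset.univ) fun k _ =>
      (Lp j).intLim_mul (Lp k) (β := fun x => 2 * pd j a x * x k)
      ((continuous_const.mul (continuous_pd ha)).mul (cc k))
      (((hasCompactSupport_pd hsa).mul_left).mul_right))).add
    (IntLim.sum (s := Finset.univ) fun j _ => Lw.intLim_mul (Lp j)
      (continuous_pd (j := j) hm) (hasCompactSupport_pd hsm))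
  refine ⟨key.integrable_lim, tendsto_nhds_unique key.tendsto ?_⟩
  refine tendsto_const_nhds.congr fun n => ?_
  have := integral_rellich_smooth ha hm hsa hsm (contDiff_mollify (φ n) hwl)
  simp only [hwp.pd_mollify hwl, hpf.sum_pd_mollify hpl] at this
  exact this.symm

end Identities

/-- Dominated convergence with a fixed integrable factor. Pointwise convergence away from the origin
suffices because the origin is a null set once `0 < d`. -/
theorem IntLim.of_bounded {d : ℕ} {β : ℕ → E d → ℝ} {β₀ h : E d → ℝ} (hh : Integrable h volume)
    (hβ : ∀ n, AEStronglyMeasurable (β n) volume) {C : ℝ} (hC : ∀ n x, |β n x| ≤ C)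
    (hlim : ∀ x, x ≠ 0 → Tendsto (fun n => β n x) atTop (𝓝 (β₀ x))) (hd : 0 < d) :
    IntLim (fun n x => β n x * h x) (fun x => β₀ x * h x) := by
  have : Nonempty (Fin d) := ⟨⟨0, hd⟩⟩
  have hne : ∀ᵐ x : E d, x ≠ 0 := by
    simp [ae_iff]
  have hi : ∀ n, Integrable (fun x => β n x * h x) volume := fun n =>
    hh.bdd_mul (hβ n) (Eventually.of_forall fun x => hC n x)
  have hl : ∀ᵐ x, Tendsto (fun n => β n x * h x) atTop (𝓝 (β₀ x * h x)) := by
    filter_upwards [hne] with x hx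
    exact (hlim x hx).mul_const _
  have hb : ∀ n, ∀ᵐ x, ‖β n x * h x‖ ≤ C * ‖h x‖ := fun n => by
    refine Eventually.of_forall fun x => ?_
    rw [norm_mul]
    gcongr
    exact hC n x
  refine ⟨hi, ?_, ?_⟩
  · refine (hh.norm.const_mul C).mono (aestronglyMeasurable_of_tendsto_ae atTop
      (fun n => (hi n).1) hl) ?_
    filter_upwards [hl] with x hx
    refine (le_of_tendsto hx.norm (Eventually.of_forall fun n => ?_)).trans
      (le_abs_self _)
    rw [norm_mul]
    gcongr
    exact hC n x
  · exact tendsto_integral_of_dominated_convergence (fun x => C * ‖h x‖) (fun n => (hi n).1)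
      (hh.norm.const_mul C) hb hl

/-! ### Cutoffs away from the origin and infinity -/

section Cutoff

variable {d : ℕ}

/-- A smooth bump equal to `1` on the unit ball and supported in the ball of radius `2`. -/
def unitBump (d : ℕ) : ContDiffBump (0 : E d) := ⟨1, 2, by norm_num, by norm_num⟩

theorem contDiff_unitBump_smul (s : ℝ) : ContDiff ℝ ∞ (fun x : E d => unitBump d (s • x)) :=
  (unitBump d).contDiff.comp (contDiff_const_smul s)

theorem pd_comp_smul {g : E d → ℝ} (hg : ContDiff ℝ ∞ g) (s : ℝ) (j : Fin d) (x : E d) :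
    pd j (fun x => g (s • x)) x = s * pd j g (s • x) := by
  unfold pd
  have h1 : HasFDerivAt (fun x : E d => s • x) (s • ContinuousLinearMap.id ℝ (E d)) x :=
    (hasFDerivAt_id x).const_smul s
  have h2 := ((hg.differentiable (by simp)) (s • x)).hasFDerivAt.comp x h1
  have h3 := h2.fderiv
  simp only [Function.comp_def] at h3
  rw [h3]
  simp

/-- The quantity `|x| |∂_j(χ(sx))|` equals `|y| |∂_jχ(y)|` at `y = sx`. Hence the bound is the
maximum of one compactly supported function and does not depend on the scale. -/
theorem exists_bound_pd_unitBump_smul (d : ℕ) :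
    ∃ C : ℝ, 0 ≤ C ∧ ∀ s : ℝ, 0 < s → ∀ (j : Fin d) (x : E d),
      ‖x‖ * |pd j (fun x : E d => unitBump d (s • x)) x| ≤ C := by
  have hb : ContDiff ℝ ∞ (unitBump d : E d → ℝ) := (unitBump d).contDiff
  have h : ∀ j : Fin d, ∃ C : ℝ, ∀ y : E d, ‖‖y‖ * pd j (unitBump d) y‖ ≤ C := fun j =>
    HasCompactSupport.exists_bound_of_continuous
      ((hasCompactSupport_pd (unitBump d).hasCompactSupport).mul_left)
      (continuous_norm.mul (continuous_pd hb))
  choose C hC using h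
  refine ⟨∑ j, |C j|, Finset.sum_nonneg fun j _ => abs_nonneg _, fun s hs j x => ?_⟩
  rw [pd_comp_smul hb, abs_mul, abs_of_pos hs]
  calc ‖x‖ * (s * |pd j (unitBump d) (s • x)|) = ‖‖s • x‖ * pd j (unitBump d) (s • x)‖ := by
        rw [norm_mul, norm_norm, norm_smul, Real.norm_eq_abs, abs_of_pos hs, Real.norm_eq_abs]
        ring
    _ ≤ C j := hC j _
    _ ≤ |C j| := le_abs_self _
    _ ≤ _ := Finset.single_le_sum (f := fun j => |C j|) (fun i _ => abs_nonneg _) (Finset.mem_univ j)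

theorem unitBump_smul_eventuallyEq_one {s : ℝ} {x : E d} (h : ‖s • x‖ < 1) :
    (fun x : E d => unitBump d (s • x)) =ᶠ[𝓝 x] fun _ => 1 := by
  have : ∀ᶠ y : E d in 𝓝 x, ‖s • y‖ < 1 :=
    (continuous_norm.comp (continuous_const_smul s)).continuousAt.eventually_lt_const h
  filter_upwards [this] with y hy
  exact (unitBump d).one_of_mem_closedBall (by simpa using! hy.le)

theorem unitBump_smul_eventuallyEq_zero {s : ℝ} {x : E d} (h : 2 < ‖s • x‖) :
    (fun x : E d => unitBump d (s • x)) =ᶠ[𝓝 x] fun _ => 0 := by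
  have : ∀ᶠ y : E d in 𝓝 x, 2 < ‖s • y‖ :=
    (continuous_norm.comp (continuous_const_smul s)).continuousAt.eventually_const_lt h
  filter_upwards [this] with y hy
  exact (unitBump d).zero_of_le_dist (by simpa using! hy.le)

theorem pd_congr {j : Fin d} {f g : E d → ℝ} {x : E d} (h : f =ᶠ[𝓝 x] g) :
    pd j f x = pd j g x := by
  unfold pd
  rw [h.fderiv_eq]

theorem pd_const (j : Fin d) (c : ℝ) (x : E d) : pd j (fun _ => c) x = 0 := by
  simp [pd]

/-- A cutoff equal to `1` on `2/(n+1) ≤ |x| ≤ n+1` and vanishing outside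
`1/(n+1) ≤ |x| ≤ 2(n+1)`. -/
noncomputable def cutoff (d n : ℕ) (x : E d) : ℝ :=
  unitBump d ((n + 1 : ℝ)⁻¹ • x) * (1 - unitBump d ((n + 1 : ℝ) • x))

theorem contDiff_cutoff (n : ℕ) : ContDiff ℝ ∞ (cutoff d n) :=
  (contDiff_unitBump_smul _).mul (contDiff_const.sub (contDiff_unitBump_smul _))

theorem hasCompactSupport_unitBump_smul {s : ℝ} (hs : s ≠ 0) :
    HasCompactSupport (fun x : E d => unitBump d (s • x)) :=
  (unitBump d).hasCompactSupport.comp_smul hs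

theorem hasCompactSupport_cutoff (n : ℕ) : HasCompactSupport (cutoff d n) :=
  (hasCompactSupport_unitBump_smul (by positivity)).mul_right

theorem cutoff_nonneg (n : ℕ) (x : E d) : 0 ≤ cutoff d n x :=
  mul_nonneg (unitBump d).nonneg (sub_nonneg.mpr (unitBump d).le_one)

theorem cutoff_le_one (n : ℕ) (x : E d) : cutoff d n x ≤ 1 :=
  mul_le_one₀ (unitBump d).le_one (sub_nonneg.mpr (unitBump d).le_one)
    (by linarith [(unitBump d).nonneg (x := ((n + 1 : ℝ) • x))])

theorem abs_cutoff_le_one (n : ℕ) (x : E d) : |cutoff d n x| ≤ 1 := by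
  rw [abs_of_nonneg (cutoff_nonneg n x)]
  exact cutoff_le_one n x

theorem norm_nat_smul (n : ℕ) (x : E d) : ‖(n + 1 : ℝ) • x‖ = (n + 1) * ‖x‖ := by
  rw [norm_smul, Real.norm_of_nonneg (by positivity)]

theorem norm_nat_inv_smul (n : ℕ) (x : E d) : ‖(n + 1 : ℝ)⁻¹ • x‖ = ‖x‖ / (n + 1) := by
  rw [norm_smul, Real.norm_of_nonneg (by positivity), inv_mul_eq_div]

theorem cutoff_eventuallyEq_one {n : ℕ} {x : E d} (h1 : 2 < (n + 1) * ‖x‖) (h2 : ‖x‖ < n + 1) :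
    cutoff d n =ᶠ[𝓝 x] fun _ => 1 := by
  have e1 := unitBump_smul_eventuallyEq_one (s := (n + 1 : ℝ)⁻¹) (x := x) (by
    rw [norm_nat_inv_smul, div_lt_one (by positivity)]; exact h2)
  have e2 := unitBump_smul_eventuallyEq_zero (s := (n + 1 : ℝ)) (x := x) (by
    rw [norm_nat_smul]; exact h1)
  filter_upwards [e1, e2] with y h1 h2
  simp [cutoff, h1, h2]

theorem cutoff_eventuallyEq_zero_of_lt {n : ℕ} {x : E d} (h : (n + 1) * ‖x‖ < 1) :
    cutoff d n =ᶠ[𝓝 x] fun _ => 0 := by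
  have e := unitBump_smul_eventuallyEq_one (s := (n + 1 : ℝ)) (x := x) (by
    rw [norm_nat_smul]; exact h)
  filter_upwards [e] with y h1
  simp [cutoff, h1]

theorem cutoff_eventuallyEq_zero_of_gt {n : ℕ} {x : E d} (h : 2 * (n + 1) < ‖x‖) :
    cutoff d n =ᶠ[𝓝 x] fun _ => 0 := by
  have e := unitBump_smul_eventuallyEq_zero (s := (n + 1 : ℝ)⁻¹) (x := x) (by
    rw [norm_nat_inv_smul, lt_div_iff₀ (by positivity)]; exact h)
  filter_upwards [e] with y h1
  simp [cutoff, h1]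

theorem eventually_cutoff_eq_one {x : E d} (hx : x ≠ 0) :
    ∀ᶠ n in atTop, cutoff d n =ᶠ[𝓝 x] fun _ => 1 := by
  have hx' : 0 < ‖x‖ := norm_pos_iff.mpr hx
  filter_upwards [eventually_gt_atTop ⌈2 / ‖x‖⌉₊, eventually_gt_atTop ⌈‖x‖⌉₊] with n h1 h2
  refine cutoff_eventuallyEq_one ?_ ?_
  · have : 2 / ‖x‖ < n + 1 := by
      have := (Nat.le_ceil (2 / ‖x‖)).trans_lt (Nat.cast_lt.mpr h1)
      linarith
    rwa [div_lt_iff₀ hx'] at this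
  · have := (Nat.le_ceil ‖x‖).trans_lt (Nat.cast_lt.mpr h2)
    linarith

theorem tendsto_cutoff {x : E d} (hx : x ≠ 0) :
    Tendsto (fun n => cutoff d n x) atTop (𝓝 1) := by
  refine tendsto_const_nhds.congr' ?_
  filter_upwards [eventually_cutoff_eq_one hx] with n hn
  exact hn.eq_of_nhds.symm

theorem tendsto_pd_cutoff {x : E d} (hx : x ≠ 0) (j : Fin d) (c : ℝ) :
    Tendsto (fun n => c * pd j (cutoff d n) x) atTop (𝓝 0) := by
  refine tendsto_const_nhds.congr' ?_
  filter_upwards [eventually_cutoff_eq_one hx] with n hn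
  rw [pd_congr hn, pd_const, mul_zero]

/-- Scale invariance handles the inner and the outer transition regions alike, each contributing one
copy of the constant. The bound lets derivatives of the cutoff be absorbed at the price of one
factor `|x|`. -/
theorem exists_bound_pd_cutoff (d : ℕ) :
    ∃ C : ℝ, 0 ≤ C ∧ ∀ (n : ℕ) (j : Fin d) (x : E d), ‖x‖ * |pd j (cutoff d n) x| ≤ C := by
  obtain ⟨C, hC0, hC⟩ := exists_bound_pd_unitBump_smul d
  refine ⟨C + C, by positivity, fun n j x => ?_⟩
  have D : ∀ s : ℝ, DifferentiableAt ℝ (fun x : E d => unitBump d (s • x)) x := fun s =>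
    (contDiff_unitBump_smul s).differentiable (by simp) x
  have e : pd j (cutoff d n) x =
      unitBump d ((n + 1 : ℝ)⁻¹ • x) * (-pd j (fun x : E d => unitBump d ((n + 1 : ℝ) • x)) x)
      + pd j (fun x : E d => unitBump d ((n + 1 : ℝ)⁻¹ • x)) x
        * (1 - unitBump d ((n + 1 : ℝ) • x)) := by
    unfold cutoff
    rw [pd_mul (g := fun x => 1 - unitBump d ((n + 1 : ℝ) • x)) (D _)
      ((differentiableAt_const _).sub (D _)),
      pd_sub (differentiableAt_const _) (D _), pd_const, zero_sub]
  have b1 : |unitBump d ((n + 1 : ℝ)⁻¹ • x)| ≤ 1 := by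
    rw [abs_of_nonneg (unitBump d).nonneg]; exact (unitBump d).le_one
  have b2 : |1 - unitBump d ((n + 1 : ℝ) • x)| ≤ 1 := by
    rw [abs_of_nonneg (sub_nonneg.mpr (unitBump d).le_one)]
    linarith [(unitBump d).nonneg (x := ((n + 1 : ℝ) • x))]
  rw [e]
  refine (mul_le_mul_of_nonneg_left (abs_add_le _ _) (norm_nonneg x)).trans ?_
  rw [abs_mul, abs_mul, abs_neg, mul_add]
  have h1 := hC (n + 1 : ℝ) (by positivity) j x
  have h2 := hC (n + 1 : ℝ)⁻¹ (by positivity) j x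
  refine add_le_add ?_ ?_
  · calc _ = |unitBump d ((n + 1 : ℝ)⁻¹ • x)|
        * (‖x‖ * |pd j (fun x : E d => unitBump d ((n + 1 : ℝ) • x)) x|) := by ring
      _ ≤ 1 * C := by gcongr
      _ = C := one_mul C
  · calc _ = (‖x‖ * |pd j (fun x : E d => unitBump d ((n + 1 : ℝ)⁻¹ • x)) x|)
        * |1 - unitBump d ((n + 1 : ℝ) • x)| := by ring
      _ ≤ C * 1 := by gcongr
      _ = C := mul_one C

/-- The cutoff vanishes identically near the origin, so a singularity of `F` there is harmless. It
makes `|x|`, `x_j/|x|` and functions of `|x|` available as smooth weights. -/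
theorem contDiff_cutoff_mul (n : ℕ) {F : E d → ℝ} (hF : ∀ x, x ≠ 0 → ContDiffAt ℝ ∞ F x) :
    ContDiff ℝ ∞ (fun x => cutoff d n x * F x) := by
  rw [contDiff_iff_contDiffAt]
  intro x
  by_cases hx : x = 0
  · have h := cutoff_eventuallyEq_zero_of_lt (n := n) (x := x) (by simp [hx])
    refine contDiffAt_const (c := (0 : ℝ)) |>.congr_of_eventuallyEq ?_
    filter_upwards [h] with y hy
    rw [hy, zero_mul]
  · exact (contDiff_cutoff n).contDiffAt.mul (hF x hx)

end Cutoff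

/-! ### Hardy's inequality -/

section Hardy

variable {d : ℕ}

theorem norm_sq_eq_sum (x : E d) : ‖x‖ ^ 2 = ∑ j, x j * x j := by
  rw [EuclideanSpace.real_norm_sq_eq]
  simp [sq]

theorem abs_coord_le (x : E d) (j : Fin d) : |x j| ≤ ‖x‖ := by
  simpa using PiLp.norm_apply_le x j

theorem pd_norm_sq (j : Fin d) (x : E d) : pd j (fun x : E d => ‖x‖ ^ 2) x = 2 * x j := by
  unfold pd
  rw [(hasStrictFDerivAt_norm_sq x).hasFDerivAt.fderiv]
  simp [EuclideanSpace.inner_single_right]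

/-- The classical proof: integrate the divergence of `w² x/(|x|²+ε)` and complete a square. The
regularisation by `ε` makes the field smooth at the origin, so only a cutoff at infinity is needed.
The constant `4` is the sharp one for `d = 3` and is enough for all larger `d`. -/
theorem hardy_regularized (hd : 3 ≤ d) {w : E d → ℝ} {p : Fin d → E d → ℝ}
    (hw : MemLp w 2 volume) (hp : ∀ j, MemLp (p j) 2 volume) (hwp : HasWeakGrad w p)
    {ε : ℝ} (hε : 0 < ε) :
    Integrable (fun x => (‖x‖ ^ 2 + ε)⁻¹ * (w x * w x)) volume ∧
    ∫ x, (‖x‖ ^ 2 + ε)⁻¹ * (w x * w x) ≤ 4 * ∫ x, ∑ j, p j x * p j x := by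
  have hd0 : 0 < d := by omega
  set q : E d → ℝ := fun x => (‖x‖ ^ 2 + ε)⁻¹ with hq
  have hpos : ∀ x : E d, 0 < ‖x‖ ^ 2 + ε := fun x => by positivity
  have cN : ContDiff ℝ ∞ (fun x : E d => ‖x‖ ^ 2 + ε) := (contDiff_norm_sq ℝ).add contDiff_const
  have cq : ContDiff ℝ ∞ q := cN.inv fun x => (hpos x).ne'
  have q0 : ∀ x, 0 < q x := fun x => inv_pos.mpr (hpos x)
  have qle : ∀ x, q x ≤ ε⁻¹ := fun x => by
    simp only [hq]
    gcongr
    nlinarith [sq_nonneg ‖x‖]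
  have q1 : ∀ x, ‖x‖ ^ 2 * q x ≤ 1 := fun x => by
    simp only [hq]
    rw [← div_eq_mul_inv, div_le_one (hpos x)]
    linarith
  have pdq : ∀ j x, pd j q x = -(2 * x j * q x ^ 2) := by
    intro j x
    have h := (hasDerivAt_inv (hpos x).ne').comp_hasFDerivAt x
      ((cN.differentiable (by simp)) x).hasFDerivAt
    have h2 : pd j q x = (-((‖x‖ ^ 2 + ε) ^ 2)⁻¹) * pd j (fun x : E d => ‖x‖ ^ 2 + ε) x := by
      have h3 := h.fderiv
      simp only [Function.comp_def] at h3
      unfold pd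
      rw [hq, h3]
      simp
    rw [h2, pd_add (((contDiff_norm_sq ℝ (n := ∞)).differentiable (by simp)) x)
      (differentiableAt_const _), pd_norm_sq, pd_const]
    simp only [hq, inv_pow]
    ring
  have xq : ∀ (x : E d) j, |x j * q x| ≤ 1 + ε⁻¹ := fun x j => by
    rw [abs_mul, abs_of_pos (q0 x)]
    have h1 : |x j| ≤ 1 + ‖x‖ ^ 2 := by
      nlinarith [abs_coord_le x j, sq_nonneg (‖x‖ - 1), norm_nonneg x]
    calc |x j| * q x ≤ (1 + ‖x‖ ^ 2) * q x := by gcongr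
      _ ≤ _ := by nlinarith [q1 x, qle x]
  set χ : ℕ → E d → ℝ := fun n x => unitBump d ((n + 1 : ℝ)⁻¹ • x) with hχ
  have cχ : ∀ n, ContDiff ℝ ∞ (χ n) := fun n => contDiff_unitBump_smul _
  have bχ : ∀ n x, |χ n x| ≤ 1 := fun n x => by
    rw [abs_of_nonneg (unitBump d).nonneg]; exact (unitBump d).le_one
  have eχ : ∀ x : E d, ∀ᶠ n in atTop, χ n =ᶠ[𝓝 x] fun _ => 1 := fun x => by
    filter_upwards [eventually_gt_atTop ⌈‖x‖⌉₊] with n hn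
    refine unitBump_smul_eventuallyEq_one ?_
    rw [norm_nat_inv_smul, div_lt_one (by positivity)]
    have := (Nat.le_ceil ‖x‖).trans_lt (Nat.cast_lt.mpr hn)
    linarith
  have tχ : ∀ x : E d, Tendsto (fun n => χ n x) atTop (𝓝 1) := fun x => by
    refine tendsto_const_nhds.congr' ?_
    filter_upwards [eχ x] with n hn
    exact hn.eq_of_nhds.symm
  obtain ⟨C, hC0, hC⟩ := exists_bound_pd_unitBump_smul d
  have bpχ : ∀ n j x, |pd j (χ n) x * (x j * q x)| ≤ C * ε⁻¹ := fun n j x => by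
    rw [abs_mul, abs_mul, abs_of_pos (q0 x)]
    calc |pd j (χ n) x| * (|x j| * q x) ≤ |pd j (χ n) x| * (‖x‖ * ε⁻¹) := by
          gcongr
          · exact abs_coord_le x j
          · exact qle x
      _ = (‖x‖ * |pd j (χ n) x|) * ε⁻¹ := by ring
      _ ≤ _ := by
          gcongr
          exact hC _ (by positivity) j x
  have tpχ : ∀ (x : E d) j (c : ℝ), Tendsto (fun n => pd j (χ n) x * c) atTop (𝓝 0) := by
    intro x j c
    refine tendsto_const_nhds.congr' ?_
    filter_upwards [eχ x] with n hn
    rw [pd_congr hn, pd_const, zero_mul]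
  set Y : ℕ → Fin d → E d → ℝ := fun n j x => χ n x * (x j * q x) with hY
  have cY : ∀ n j, ContDiff ℝ ∞ (Y n j) := fun n j => (cχ n).mul ((contDiff_coord j).mul cq)
  have sY : ∀ n j, HasCompactSupport (Y n j) := fun n j =>
    (hasCompactSupport_unitBump_smul (by positivity)).mul_right
  have pdY : ∀ n j x, pd j (Y n j) x
      = χ n x * (q x - 2 * (x j * x j) * q x ^ 2) + pd j (χ n) x * (x j * q x) := by
    intro n j x
    have D : ∀ {f : E d → ℝ}, ContDiff ℝ ∞ f → DifferentiableAt ℝ f x :=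
      fun hf => hf.differentiable (by simp) x
    rw [hY, pd_mul (D (cχ n)) (D ((contDiff_coord j).mul cq)), pd_mul (D (contDiff_coord j)) (D cq),
      pd_coord, pdq]
    simp only [if_true]
    ring
  have iww := integrable_mul_of_memLp hw hw
  have iwp := fun j => integrable_mul_of_memLp hw (hp j)
  have L1 : ∀ j, IntLim (fun n x => 2 * Y n j x * (w x * p j x))
      (fun x => 2 * (x j * q x) * (w x * p j x)) := fun j => by
    refine IntLim.of_bounded (C := 2 * (1 + ε⁻¹)) (iwp j)
      (fun n => (continuous_const.mul (cY n j).continuous).aestronglyMeasurable) (fun n x => ?_)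
      (fun x _ => ?_) hd0
    · rw [abs_mul, abs_two, hY, abs_mul]
      gcongr
      calc |χ n x| * |x j * q x| ≤ 1 * (1 + ε⁻¹) := by
            gcongr
            · exact bχ n x
            · exact xq x j
        _ = _ := one_mul _
    · simpa [hY] using ((tχ x).mul_const (x j * q x)).const_mul 2
  have L2 : ∀ j, IntLim (fun n x => pd j (Y n j) x * (w x * w x))
      (fun x => (q x - 2 * (x j * x j) * q x ^ 2) * (w x * w x)) := fun j => by
    refine IntLim.of_bounded (C := 3 * ε⁻¹ + C * ε⁻¹) iww
      (fun n => (continuous_pd (cY n j)).aestronglyMeasurable) (fun n x => ?_)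
      (fun x _ => ?_) hd0
    · rw [pdY]
      refine (abs_add_le _ _).trans (add_le_add ?_ (bpχ n j x))
      rw [abs_mul]
      have h1 : |q x - 2 * (x j * x j) * q x ^ 2| ≤ 3 * ε⁻¹ := by
        have hx : x j * x j ≤ ‖x‖ ^ 2 := by
          rw [← abs_mul_abs_self (x j), sq]
          gcongr <;> exact abs_coord_le x j
        have h2 : (x j * x j) * q x ^ 2 ≤ ε⁻¹ := by
          calc (x j * x j) * q x ^ 2 ≤ ‖x‖ ^ 2 * q x ^ 2 := by gcongr
            _ = (‖x‖ ^ 2 * q x) * q x := by ring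
            _ ≤ 1 * ε⁻¹ := by
                gcongr
                · exact q1 x
                · exact qle x
            _ = _ := one_mul _
        have h3 : 0 ≤ (x j * x j) * q x ^ 2 := mul_nonneg (mul_self_nonneg _) (sq_nonneg _)
        rw [abs_le]
        constructor <;> nlinarith [qle x, q0 x, inv_pos.mpr hε]
      calc _ ≤ 1 * (3 * ε⁻¹) := by
            gcongr
            exact bχ n x
        _ = _ := one_mul _
    · simp only [pdY]
      simpa using ((tχ x).mul_const (q x - 2 * (x j * x j) * q x ^ 2)).add (tpχ x j (x j * q x))
  have key := (IntLim.sum (s := Finset.univ) fun j _ => L1 j).add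
    (IntLim.sum (s := Finset.univ) fun j _ => L2 j)
  have key0 := tendsto_nhds_unique key.tendsto (tendsto_const_nhds.congr fun n =>
    (integral_radial (cY n) (sY n) hw hp hwp).2.symm)
  have ip : Integrable (fun x => ∑ j, p j x * p j x) volume :=
    integrable_finsetSum _ fun j _ => integrable_mul_of_memLp (hp j) (hp j)
  have iq : Integrable (fun x => q x * (w x * w x)) volume :=
    iww.bdd_mul cq.continuous.aestronglyMeasurable (c := ε⁻¹) (Eventually.of_forall fun x => by
      rw [Real.norm_of_nonneg (q0 x).le]; exact qle x)
  refine ⟨iq, ?_⟩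
  -- With `q = (|x|²+ε)⁻¹`, the square `|2p + q w x|² ≥ 0` and twice the integrand of the divergence
  -- identity leave at least `(2d - 5|x|²q) q w²`. Since `|x|²q ≤ 1`, this is at least `q w²` when
  -- `d ≥ 3`.
  have hle : ∫ x, q x * (w x * w x) ≤ ∫ x, (4 * (∑ j, p j x * p j x)
      + 2 * ((∑ j, 2 * (x j * q x) * (w x * p j x))
        + ∑ j, (q x - 2 * (x j * x j) * q x ^ 2) * (w x * w x))) := by
    refine integral_mono iq ((ip.const_mul 4).add (key.integrable_lim.const_mul 2)) fun x => ?_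
    have s1 : 0 ≤ ∑ j, (2 * p j x + x j * q x * w x) * (2 * p j x + x j * q x * w x) :=
      Finset.sum_nonneg fun j _ => mul_self_nonneg _
    have s2 : ∑ j, (2 * p j x + x j * q x * w x) * (2 * p j x + x j * q x * w x)
        = 4 * (∑ j, p j x * p j x) + 2 * (∑ j, 2 * (x j * q x) * (w x * p j x))
          + ‖x‖ ^ 2 * (q x * w x) ^ 2 := by
      rw [norm_sq_eq_sum, Finset.mul_sum, Finset.mul_sum, Finset.sum_mul,
        ← Finset.sum_add_distrib, ← Finset.sum_add_distrib]
      refine Finset.sum_congr rfl fun j _ => ?_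
      ring
    have s3 : ∑ j, (q x - 2 * (x j * x j) * q x ^ 2) * (w x * w x)
        = (d * q x - 2 * ‖x‖ ^ 2 * q x ^ 2) * (w x * w x) := by
      rw [← Finset.sum_mul, Finset.sum_sub_distrib, norm_sq_eq_sum, ← Finset.sum_mul,
        ← Finset.mul_sum]
      simp
    have hd3 : (3 : ℝ) ≤ d := by exact_mod_cast hd
    simp only
    rw [s3]
    have t0 : 0 ≤ q x * (w x * w x) := mul_nonneg (q0 x).le (mul_self_nonneg _)
    have t1 : ‖x‖ ^ 2 * q x * (q x * (w x * w x)) ≤ 1 * (q x * (w x * w x)) := by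
      gcongr
      exact q1 x
    have t2 : 3 * (q x * (w x * w x)) ≤ d * (q x * (w x * w x)) := by gcongr
    rw [s2] at s1
    nlinarith [s1, t0, t1, t2]
  refine hle.trans (le_of_eq ?_)
  rw [integral_add (ip.const_mul 4) (key.integrable_lim.const_mul 2), integral_const_mul,
    integral_const_mul, key0]
  ring

/-- Fatou's lemma along `ε = 1/(n+1)`, as the regularised bound is uniform in `ε`. -/
theorem hardy (hd : 3 ≤ d) {w : E d → ℝ} {p : Fin d → E d → ℝ}
    (hw : MemLp w 2 volume) (hp : ∀ j, MemLp (p j) 2 volume) (hwp : HasWeakGrad w p) :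
    ∫⁻ x, ENNReal.ofReal ((w x / ‖x‖) ^ 2) ≤ ENNReal.ofReal (4 * ∫ x, ∑ j, p j x * p j x) := by
  have : Nonempty (Fin d) := ⟨⟨0, by omega⟩⟩
  have hne : ∀ᵐ x : E d, x ≠ 0 := by
    simp [ae_iff]
  set e : ℕ → ℝ := fun n => 1 / ((n : ℝ) + 1) with he
  have e0 : ∀ n, 0 < e n := fun n => by positivity
  have H := fun n => hardy_regularized hd hw hp hwp (e0 n)
  have hle : ∀ n, ∫⁻ x, ENNReal.ofReal ((‖x‖ ^ 2 + e n)⁻¹ * (w x * w x))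
      ≤ ENNReal.ofReal (4 * ∫ x, ∑ j, p j x * p j x) := by
    intro n
    rw [← ofReal_integral_eq_lintegral_ofReal (H n).1 (Eventually.of_forall fun x =>
      mul_nonneg (by have := e0 n; positivity) (mul_self_nonneg _))]
    exact ENNReal.ofReal_le_ofReal (H n).2
  have hlim : ∀ᵐ x, ENNReal.ofReal ((w x / ‖x‖) ^ 2)
      = liminf (fun n => ENNReal.ofReal ((‖x‖ ^ 2 + e n)⁻¹ * (w x * w x))) atTop := by
    filter_upwards [hne] with x hx
    have h1 : Tendsto (fun n => (‖x‖ ^ 2 + e n)⁻¹ * (w x * w x)) atTop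
        (𝓝 ((‖x‖ ^ 2 + 0)⁻¹ * (w x * w x))) := by
      refine ((tendsto_const_nhds.add tendsto_one_div_add_atTop_nhds_zero_nat).inv₀ ?_).mul_const _
      simpa using hx
    have h2 := (ENNReal.tendsto_ofReal h1).liminf_eq
    rw [h2]
    congr 1
    rw [add_zero, div_pow, div_eq_inv_mul, sq (w x)]
  rw [lintegral_congr_ae hlim]
  refine (lintegral_liminf_le' fun n => ?_).trans ?_
  · exact ((H n).1.1.aemeasurable).ennreal_ofReal
  · refine (liminf_le_liminf (Eventually.of_forall hle)).trans ?_
    simp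

theorem memLp_div_norm (hd : 3 ≤ d) {w : E d → ℝ} {p : Fin d → E d → ℝ}
    (hw : MemLp w 2 volume) (hp : ∀ j, MemLp (p j) 2 volume) (hwp : HasWeakGrad w p) :
    MemLp (fun x => w x / ‖x‖) 2 volume := by
  have hm : AEStronglyMeasurable (fun x : E d => w x / ‖x‖) volume :=
    (hw.1.aemeasurable.div measurable_norm.aemeasurable).aestronglyMeasurable
  rw [memLp_two_iff_integrable_sq hm]
  refine ⟨hm.pow 2, ?_⟩
  rw [hasFiniteIntegral_iff_ofReal (Eventually.of_forall fun x => sq_nonneg _)]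
  exact (hardy hd hw hp hwp).trans_lt ENNReal.ofReal_lt_top

/-- Hardy's inequality makes `w/|x|` vanish, which replaces the argument that a function with zero
gradient is constant and hence not in `L²`. -/
theorem ae_eq_zero_of_grad_eq_zero (hd : 3 ≤ d) {w : E d → ℝ} {p : Fin d → E d → ℝ}
    (hw : MemLp w 2 volume) (hp : ∀ j, MemLp (p j) 2 volume) (hwp : HasWeakGrad w p)
    (h0 : ∫ x, ∑ j, p j x * p j x ≤ 0) : ∀ᵐ x, w x = 0 := by
  have : Nonempty (Fin d) := ⟨⟨0, by omega⟩⟩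
  have hne : ∀ᵐ x : E d, x ≠ 0 := by
    simp [ae_iff]
  have h1 := hardy hd hw hp hwp
  rw [ENNReal.ofReal_of_nonpos (by linarith), nonpos_iff_eq_zero,
    lintegral_eq_zero_iff' ((memLp_div_norm hd hw hp hwp).1.aemeasurable.pow_const 2).ennreal_ofReal]
    at h1
  filter_upwards [h1, hne] with x hx hx0
  have : (w x / ‖x‖) ^ 2 ≤ 0 := by simpa using hx
  have h2 := pow_eq_zero_iff (two_ne_zero) |>.mp (le_antisymm this (sq_nonneg _))
  rcases div_eq_zero_iff.mp h2 with h | h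
  · exact h
  · exact absurd (norm_eq_zero.mp h) hx0

end Hardy

/-! ### Product rules for weak derivatives -/

section ProductRule

variable {d : ℕ}

theorem integrable_test_mul {g w : E d → ℝ} (hw : LocallyIntegrable w volume)
    (hg : Continuous g) (hs : HasCompactSupport g) : Integrable (fun x => g x * w x) volume :=
  hw.integrable_smul_left_of_hasCompactSupport hg hs

theorem HasWeakGrad.add {w w' : E d → ℝ} {p p' : Fin d → E d → ℝ} (h : HasWeakGrad w p)
    (h' : HasWeakGrad w' p') (hw : LocallyIntegrable w volume) (hw' : LocallyIntegrable w' volume)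
    (hp : ∀ j, LocallyIntegrable (p j) volume) (hp' : ∀ j, LocallyIntegrable (p' j) volume) :
    HasWeakGrad (fun x => w x + w' x) (fun j x => p j x + p' j x) := by
  intro g hg hs j
  have c := continuous_pd (j := j) hg
  have s := hasCompactSupport_pd (j := j) hs
  simp only [mul_add]
  rw [integral_add (integrable_test_mul hw c s) (integrable_test_mul hw' c s),
    integral_add (integrable_test_mul (hp j) hg.continuous hs)
      (integrable_test_mul (hp' j) hg.continuous hs), h g hg hs, h' g hg hs]
  ring

theorem HasWeakGrad.neg {w : E d → ℝ} {p : Fin d → E d → ℝ} (h : HasWeakGrad w p) :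
    HasWeakGrad (fun x => -w x) (fun j x => -p j x) := by
  intro g hg hs j
  simp only [mul_neg, integral_neg, h g hg hs]

theorem HasWeakDiv.add {f f' : E d → ℝ} {p p' : Fin d → E d → ℝ} (h : HasWeakDiv p f)
    (h' : HasWeakDiv p' f') (hp : ∀ j, LocallyIntegrable (p j) volume)
    (hp' : ∀ j, LocallyIntegrable (p' j) volume)
    (hf : ∀ g : E d → ℝ, ContDiff ℝ ∞ g → HasCompactSupport g → Integrable (fun x => g x * f x))
    (hf' : ∀ g : E d → ℝ, ContDiff ℝ ∞ g → HasCompactSupport g →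
      Integrable (fun x => g x * f' x)) :
    HasWeakDiv (fun j x => p j x + p' j x) (fun x => f x + f' x) := by
  intro g hg hs
  simp only [mul_add]
  rw [integral_add (hf g hg hs) (hf' g hg hs)]
  simp only [fun j => integral_add
    (integrable_test_mul (hp j) (continuous_pd (j := j) hg) (hasCompactSupport_pd hs))
    (integrable_test_mul (hp' j) (continuous_pd (j := j) hg) (hasCompactSupport_pd hs)),
    Finset.sum_add_distrib]
  rw [h g hg hs, h' g hg hs]
  ring

theorem HasWeakDiv.neg {f : E d → ℝ} {p : Fin d → E d → ℝ} (h : HasWeakDiv p f) :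
    HasWeakDiv (fun j x => -p j x) (fun x => -f x) := by
  intro g hg hs
  simp only [mul_neg, integral_neg, Finset.sum_neg_distrib, h g hg hs]

/-- If `g` is a test function then so is `g b`. Testing with it and expanding its derivative gives
the rule. -/
theorem HasWeakGrad.smooth_mul {w b : E d → ℝ} {p : Fin d → E d → ℝ} (h : HasWeakGrad w p)
    (hb : ContDiff ℝ ∞ b) (hw : LocallyIntegrable w volume)
    (hp : ∀ j, LocallyIntegrable (p j) volume) :
    HasWeakGrad (fun x => b x * w x) (fun j x => b x * p j x + pd j b x * w x) := by
  intro g hg hs j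
  have e : ∀ x, pd j g x * (b x * w x)
      = pd j (fun x => g x * b x) x * w x - g x * pd j b x * w x := by
    intro x
    rw [pd_mul (hg.differentiable (by simp) x) (hb.differentiable (by simp) x)]
    ring
  have i1 : Integrable (fun x => pd j (fun x => g x * b x) x * w x) volume :=
    integrable_test_mul hw (continuous_pd (hg.mul hb)) (hasCompactSupport_pd hs.mul_right)
  have i2 : Integrable (fun x => g x * pd j b x * w x) volume :=
    integrable_test_mul hw (hg.continuous.mul (continuous_pd hb)) hs.mul_right
  have i3 : Integrable (fun x => g x * b x * p j x) volume :=
    integrable_test_mul (hp j) (hg.continuous.mul hb.continuous) hs.mul_right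
  simp only [e]
  rw [integral_sub i1 i2, h _ (hg.mul hb) hs.mul_right]
  simp only [mul_add, ← mul_assoc]
  rw [integral_add i3 i2]
  ring

/-- One copy of `∇b·p` comes from testing the divergence of `p` with `g b`, the other from testing
the gradient of `w` with `g ∂_j b`. The density `f` is only assumed integrable against test
functions, because it will contain the potential term. -/
theorem HasWeakDiv.smooth_mul {w b f : E d → ℝ} {p : Fin d → E d → ℝ} (hd : HasWeakDiv p f)
    (h : HasWeakGrad w p)
    (hb : ContDiff ℝ ∞ b) (hw : LocallyIntegrable w volume)
    (hp : ∀ j, LocallyIntegrable (p j) volume)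
    (hf : ∀ g : E d → ℝ, ContDiff ℝ ∞ g → HasCompactSupport g → Integrable (fun x => g x * f x)) :
    HasWeakDiv (fun j x => b x * p j x + pd j b x * w x)
      (fun x => b x * f x + ∑ j, (2 * pd j b x * p j x + pd j (pd j b) x * w x)) := by
  intro g hg hs
  have i1 : ∀ j, Integrable (fun x => pd j (fun x => g x * b x) x * p j x) volume := fun j =>
    integrable_test_mul (hp j) (continuous_pd (hg.mul hb)) (hasCompactSupport_pd hs.mul_right)
  have i2 : ∀ j, Integrable (fun x => g x * pd j b x * p j x) volume := fun j =>
    integrable_test_mul (hp j) (hg.continuous.mul (continuous_pd hb)) hs.mul_right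
  have i3 : ∀ j, Integrable (fun x => pd j (fun x => g x * pd j b x) x * w x) volume := fun j =>
    integrable_test_mul hw (continuous_pd (hg.mul (contDiff_pd hb)))
      (hasCompactSupport_pd hs.mul_right)
  have i4 : ∀ j, Integrable (fun x => g x * pd j (pd j b) x * w x) volume := fun j =>
    integrable_test_mul hw (hg.continuous.mul (continuous_pd (contDiff_pd hb))) hs.mul_right
  have e : ∀ j x, pd j g x * (b x * p j x + pd j b x * w x)
      = (pd j (fun x => g x * b x) x * p j x - g x * pd j b x * p j x)
        + (pd j (fun x => g x * pd j b x) x * w x - g x * pd j (pd j b) x * w x) := by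
    intro j x
    rw [pd_mul (hg.differentiable (by simp) x) (hb.differentiable (by simp) x),
      pd_mul (hg.differentiable (by simp) x) ((contDiff_pd hb).differentiable (by simp) x)]
    ring
  have e2 : ∀ j, ∫ x, pd j g x * (b x * p j x + pd j b x * w x)
      = (∫ x, pd j (fun x => g x * b x) x * p j x) - 2 * (∫ x, g x * pd j b x * p j x)
        - ∫ x, g x * pd j (pd j b) x * w x := by
    intro j
    have j1 : Integrable (fun x => pd j (fun x => g x * b x) x * p j x
      - g x * pd j b x * p j x) volume := (i1 j).sub (i2 j)
    have j2 : Integrable (fun x => pd j (fun x => g x * pd j b x) x * w x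
      - g x * pd j (pd j b) x * w x) volume := (i3 j).sub (i4 j)
    simp only [e]
    rw [integral_add j1 j2, integral_sub (i1 j) (i2 j),
      integral_sub (i3 j) (i4 j), h _ (hg.mul (contDiff_pd hb)) hs.mul_right]
    ring
  have e3 : ∀ x, g x * (b x * f x + ∑ j, (2 * pd j b x * p j x + pd j (pd j b) x * w x))
      = g x * b x * f x + ∑ j, (2 * (g x * pd j b x * p j x) + g x * pd j (pd j b) x * w x) := by
    intro x
    rw [mul_add, Finset.mul_sum, mul_assoc]
    congr 1
    refine Finset.sum_congr rfl fun j _ => ?_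
    ring
  have i5 : ∀ j, Integrable (fun x => 2 * (g x * pd j b x * p j x)
      + g x * pd j (pd j b) x * w x) volume := fun j => ((i2 j).const_mul 2).add (i4 j)
  simp only [e2, e3]
  rw [integral_add (hf _ (hg.mul hb) hs.mul_right) (integrable_finsetSum _ fun j _ => i5 j),
    integral_finsetSum _ fun j _ => i5 j]
  simp only [fun j => integral_add ((i2 j).const_mul 2) (i4 j), integral_const_mul,
    Finset.sum_sub_distrib, Finset.sum_add_distrib]
  rw [hd _ (hg.mul hb) hs.mul_right]
  ring

/-- The product rule for a bounded factor with bounded derivative that may be singular at `0`. -/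
theorem HasWeakGrad.singular_mul (hd : 3 ≤ d) {w θ : E d → ℝ} {p : Fin d → E d → ℝ}
    {θ' : Fin d → E d → ℝ}
    (h : HasWeakGrad w p) (hw : MemLp w 2 volume) (hp : ∀ j, MemLp (p j) 2 volume)
    (hθ : ∀ x, x ≠ 0 → ContDiffAt ℝ ∞ θ x) (hθm : Measurable θ) (hθ1 : ∀ x, |θ x| ≤ 1)
    (hθ' : ∀ j x, x ≠ 0 → pd j θ x = θ' j x) (hθm' : ∀ j, Measurable (θ' j)) {C : ℝ}
    (hC : ∀ j x, |θ' j x| ≤ C) :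
    HasWeakGrad (fun x => θ x * w x) (fun j x => θ x * p j x + θ' j x * w x) := by
  have hd0 : 0 < d := by omega
  have : Nonempty (Fin d) := ⟨⟨0, hd0⟩⟩
  have hne : ∀ᵐ x : E d, x ≠ 0 := by
    simp [ae_iff]
  obtain ⟨K, hK0, hK⟩ := exists_bound_pd_cutoff d
  have hwl := hw.locallyIntegrable (μ := volume) (by norm_num)
  have hpl := fun j => (hp j).locallyIntegrable (μ := volume) (by norm_num)
  have hwr := (memLp_div_norm hd hw hp h).locallyIntegrable (by norm_num)
  have mc : ∀ n, Measurable (cutoff d n) := fun n => (contDiff_cutoff n).continuous.measurable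
  have mpc : ∀ n j, Measurable (pd j (cutoff d n)) := fun n j =>
    (continuous_pd (contDiff_cutoff n)).measurable
  intro g hg hs j
  have cg := continuous_pd (j := j) hg
  have sg := hasCompactSupport_pd (j := j) hs
  have bθ : ∀ n x, |cutoff d n x * θ x| ≤ 1 := fun n x => by
    rw [abs_mul]
    exact mul_le_one₀ (abs_cutoff_le_one n x) (abs_nonneg _) (hθ1 x)
  have tθ : ∀ x : E d, x ≠ 0 → Tendsto (fun n => cutoff d n x * θ x) atTop (𝓝 (θ x)) :=
    fun x hx => by simpa using (tendsto_cutoff hx).mul_const (θ x)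
  have A := IntLim.of_bounded (integrable_test_mul hwl cg sg)
    (fun n => ((mc n).mul hθm).aestronglyMeasurable) bθ tθ hd0
  have B := IntLim.of_bounded (integrable_test_mul (hpl j) hg.continuous hs)
    (fun n => ((mc n).mul hθm).aestronglyMeasurable) bθ tθ hd0
  have D := IntLim.of_bounded (β := fun n x => cutoff d n x * θ' j x) (β₀ := θ' j) (C := 1 * C)
    (integrable_test_mul hwl hg.continuous hs)
    (fun n => ((mc n).mul (hθm' j)).aestronglyMeasurable) (fun n x => by
      rw [abs_mul]
      exact mul_le_mul (abs_cutoff_le_one n x) (hC j x) (abs_nonneg _) zero_le_one)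
    (fun x hx => by simpa using (tendsto_cutoff hx).mul_const (θ' j x)) hd0
  -- The error `θ w ∂_jχ_n` is written as `(θ|x|∂_jχ_n)·(w/|x|)`. The first factor is bounded and
  -- tends to zero pointwise, and Hardy makes the second square integrable.
  have F := IntLim.of_bounded (β := fun n x => θ x * ‖x‖ * pd j (cutoff d n) x)
    (β₀ := fun _ => 0) (C := K) (integrable_test_mul hwr hg.continuous hs)
    (fun n => ((hθm.mul measurable_norm).mul (mpc n j)).aestronglyMeasurable) (fun n x => by
      rw [abs_mul, abs_mul, abs_norm, mul_assoc]
      calc |θ x| * (‖x‖ * |pd j (cutoff d n) x|) ≤ 1 * K := by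
            gcongr
            · exact hθ1 x
            · exact hK n j x
        _ = K := one_mul K)
    (fun x hx => tendsto_pd_cutoff hx j _) hd0
  have R := (B.add D).add F
  have step : ∀ n, ∫ x, cutoff d n x * θ x * (pd j g x * w x)
      = -∫ x, (cutoff d n x * θ x * (g x * p j x) + cutoff d n x * θ' j x * (g x * w x)
        + θ x * ‖x‖ * pd j (cutoff d n) x * (g x * (w x / ‖x‖))) := by
    intro n
    have h1 := h.smooth_mul (contDiff_cutoff_mul n hθ) hwl hpl g hg hs j
    rw [show (fun x => cutoff d n x * θ x * (pd j g x * w x))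
      = fun x => pd j g x * (cutoff d n x * θ x * w x) by ext x; ring, h1]
    congr 1
    refine integral_congr_ae ?_
    filter_upwards [hne] with x hx
    have hx' : ‖x‖ ≠ 0 := norm_ne_zero_iff.mpr hx
    rw [pd_mul ((contDiff_cutoff n).differentiable (by simp) x)
      ((hθ x hx).differentiableAt (by simp)), hθ' j x hx]
    field_simp
    ring
  have lim := tendsto_nhds_unique A.tendsto
    ((R.tendsto.neg).congr fun n => (step n).symm)
  calc ∫ x, pd j g x * (θ x * w x) = ∫ x, θ x * (pd j g x * w x) := by
        congr 1; ext x; ring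
    _ = _ := lim
    _ = _ := by
        congr 2
        ext x
        ring

end ProductRule

/-! ### The multiplier identity and the virial inequality -/

section Multiplier

variable {d : ℕ}

theorem ae_ne_zero (hd : 0 < d) : ∀ᵐ x : E d, x ≠ 0 := by
  have : Nonempty (Fin d) := ⟨⟨0, hd⟩⟩
  simp [ae_iff]

theorem contDiffAt_norm_of_ne {x : E d} (hx : x ≠ 0) : ContDiffAt ℝ ∞ (fun x : E d => ‖x‖) x :=
  contDiffAt_norm ℝ hx

theorem pd_comp_norm {g : ℝ → ℝ} {g' : ℝ} {x : E d} (hx : x ≠ 0) (hg : HasDerivAt g g' ‖x‖)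
    (j : Fin d) : pd j (fun x : E d => g ‖x‖) x = g' * (x j / ‖x‖) := by
  have hx' : ‖x‖ ≠ 0 := norm_ne_zero_iff.mpr hx
  have hN : pd j (fun x : E d => ‖x‖) x = x j / ‖x‖ := by
    have dN : DifferentiableAt ℝ (fun x : E d => ‖x‖) x :=
      (contDiffAt_norm_of_ne hx).differentiableAt (by simp)
    have h1 := pd_norm_sq j x
    have h2 : pd j (fun x : E d => ‖x‖ ^ 2) x = ‖x‖ * pd j (fun x : E d => ‖x‖) x
        + pd j (fun x : E d => ‖x‖) x * ‖x‖ := by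
      simp only [sq]
      exact pd_mul dN dN
    rw [h1] at h2
    field_simp
    linarith
  have dN : DifferentiableAt ℝ (fun x : E d => ‖x‖) x :=
    (contDiffAt_norm_of_ne hx).differentiableAt (by simp)
  have h := hg.comp_hasFDerivAt x dN.hasFDerivAt
  have h3 := h.fderiv
  simp only [Function.comp_def] at h3
  rw [← hN]
  unfold pd
  rw [h3]
  simp

theorem pd_norm {x : E d} (hx : x ≠ 0) (j : Fin d) :
    pd j (fun x : E d => ‖x‖) x = x j / ‖x‖ := by
  simpa using pd_comp_norm hx (hasDerivAt_id ‖x‖) j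

theorem contDiffAt_radial {x : E d} (hx : x ≠ 0) (j : Fin d) :
    ContDiffAt ℝ ∞ (fun x : E d => x j / ‖x‖) x :=
  (contDiff_coord j).contDiffAt.div (contDiffAt_norm_of_ne hx) (norm_ne_zero_iff.mpr hx)

theorem pd_radial {x : E d} (hx : x ≠ 0) (j : Fin d) :
    pd j (fun x : E d => x j / ‖x‖) x = ‖x‖⁻¹ - x j * x j * (‖x‖⁻¹) ^ 3 := by
  have hx' : ‖x‖ ≠ 0 := norm_ne_zero_iff.mpr hx
  have hinv := pd_comp_norm hx (hasDerivAt_inv hx') j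
  have dI : DifferentiableAt ℝ (fun x : E d => (‖x‖)⁻¹) x :=
    ((contDiffAt_norm_of_ne hx).inv hx').differentiableAt (by simp)
  simp only [div_eq_mul_inv]
  rw [pd_mul ((contDiff_coord j).differentiable (by simp) x) dI, hinv, pd_coord]
  simp only [if_true]
  field_simp
  ring

theorem sum_pd_radial {x : E d} (hx : x ≠ 0) :
    ∑ j, pd j (fun x : E d => x j / ‖x‖) x = (d - 1) / ‖x‖ := by
  have hx' : ‖x‖ ≠ 0 := norm_ne_zero_iff.mpr hx
  simp only [fun j => pd_radial hx j]
  rw [Finset.sum_sub_distrib, ← Finset.sum_mul, ← norm_sq_eq_sum]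
  simp
  field_simp

theorem euler_sq_le (p : Fin d → E d → ℝ) (x : E d) :
    euler p x ^ 2 ≤ ‖x‖ ^ 2 * ∑ j, p j x * p j x := by
  have h := Finset.sum_mul_sq_le_sq_mul_sq Finset.univ (fun j => x j) (fun j => p j x)
  rw [norm_sq_eq_sum]
  simpa [euler, sq] using h

/-- Away from the origin `w` has the gradient `p` and the square-integrable Laplacian `F`. -/
def HasLocalLaplacian (w : E d → ℝ) (p : Fin d → E d → ℝ) (F : E d → ℝ) : Prop :=
  ∀ n : ℕ, ∃ (u : E d → ℝ) (q : Fin d → E d → ℝ) (h : E d → ℝ), MemLp u 2 volume ∧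
    (∀ j, MemLp (q j) 2 volume) ∧ MemLp h 2 volume ∧ HasWeakGrad u q ∧ HasWeakDiv q h ∧
    ∀ x, 2 < (n + 1) * ‖x‖ → ‖x‖ < n + 1 → u x = w x ∧ (∀ j, q j x = p j x) ∧ h x = F x

/-- The contribution of the derivatives of the cutoff to the multiplier identity. -/
noncomputable def cutoffError (c : ℝ) (n : ℕ) (w : E d → ℝ) (p : Fin d → E d → ℝ) (x : E d) : ℝ :=
  -1 * (∑ k, ∑ j, x k * pd k (cutoff d n) x * (p j x * p j x))
    + 2 * (∑ j, ∑ k, x k * pd j (cutoff d n) x * (p j x * p k x))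
    + (d - 1) * (∑ j, ‖x‖ * pd j (cutoff d n) x * (w x / ‖x‖ * p j x))
    + c * (1 / 2 * (∑ k, x k * pd k (cutoff d n) x * (w x * (w x / ‖x‖)))
      + ∑ j, ‖x‖ * pd j (cutoff d n) x * (w x * p j x))

/-- Every term is `O(|x||∇χ_n|)` times a fixed product of two functions among `w`, `p_j` and
`w/|x|`, all in `L²`. Even the terms from the growing weight `c|x|` need no decay of `w`. -/
theorem intLim_cutoffError (hd : 0 < d) (c : ℝ) {w : E d → ℝ} {p : Fin d → E d → ℝ}
    (hw : MemLp w 2 volume) (hp : ∀ j, MemLp (p j) 2 volume)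
    (hwr : MemLp (fun x => w x / ‖x‖) 2 volume) :
    IntLim (fun n => cutoffError c n w p) (fun _ => 0) := by
  obtain ⟨K, hK0, hK⟩ := exists_bound_pd_cutoff d
  have A : ∀ (k j : Fin d) (h : E d → ℝ), Integrable h volume →
      IntLim (fun n x => x k * pd j (cutoff d n) x * h x) (fun x => 0 * h x) := fun k j h hh =>
    IntLim.of_bounded (C := K) hh (fun n => ((contDiff_coord k).continuous.mul
      (continuous_pd (contDiff_cutoff n))).aestronglyMeasurable) (fun n x => by
        rw [abs_mul]
        refine le_trans ?_ (hK n j x)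
        gcongr
        exact abs_coord_le x k)
      (fun x hx => tendsto_pd_cutoff hx j _) hd
  have B : ∀ (j : Fin d) (h : E d → ℝ), Integrable h volume →
      IntLim (fun n x => ‖x‖ * pd j (cutoff d n) x * h x) (fun x => 0 * h x) := fun j h hh =>
    IntLim.of_bounded (C := K) hh (fun n => (continuous_norm.mul
      (continuous_pd (contDiff_cutoff n))).aestronglyMeasurable) (fun n x => by
        rw [abs_mul, abs_norm]
        exact hK n j x)
      (fun x hx => tendsto_pd_cutoff hx j _) hd
  have key := ((((IntLim.sum (s := Finset.univ) fun k _ => IntLim.sum (s := Finset.univ) fun j _ =>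
      A k k _ (integrable_mul_of_memLp (hp j) (hp j))).const_mul (-1)).add
    ((IntLim.sum (s := Finset.univ) fun j _ => IntLim.sum (s := Finset.univ) fun k _ =>
      A k j _ (integrable_mul_of_memLp (hp j) (hp k))).const_mul 2)).add
    ((IntLim.sum (s := Finset.univ) fun j _ =>
      B j _ (integrable_mul_of_memLp hwr (hp j))).const_mul ((d : ℝ) - 1))).add
    ((((IntLim.sum (s := Finset.univ) fun k _ =>
      A k k _ (integrable_mul_of_memLp hw hwr)).const_mul (1 / 2)).add
    (IntLim.sum (s := Finset.univ) fun j _ =>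
      B j _ (integrable_mul_of_memLp hw (hp j)))).const_mul c)
  simp only [zero_mul, Finset.sum_const_zero, mul_zero, add_zero] at key
  exact key

/-- `G` is the full integrand of the Rellich identity with `a = χ_n`, `m = (d-1+c|x|)χ_n`, plus
`c/2` times that of the radial identity. The difference of the two sides is `cχ_n|x|⁻¹(|x|²|p|² + 2w
x·p + (d-1)w²/2)`, which is nonnegative. Discarding this term before passing to the limit avoids any
claim that `|x||p|²` is integrable. -/
theorem exists_multiplier_bound (hd : 3 ≤ d) {c : ℝ} (hc : 0 ≤ c) {w F : E d → ℝ}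
    {p : Fin d → E d → ℝ} (hF : HasLocalLaplacian w p F) (n : ℕ) :
    ∃ G : E d → ℝ, Integrable G volume ∧ ∫ x, G x = 0 ∧ ∀ x, x ≠ 0 →
      F x * (cutoff d n x * (2 * euler p x + (d - 1 + c * ‖x‖) * w x))
        + cutoff d n x * (∑ j, p j x * p j x) + cutoffError c n w p x ≤ G x := by
  -- The annulus of index `4n+4` contains the region `1/(n+1) ≤ |x| ≤ 2(n+1)` outside of which the
  -- cutoff vanishes.
  obtain ⟨u, q, h, hu, hq, hh, huq, hqh, heq⟩ := hF (4 * n + 4)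
  set a : E d → ℝ := cutoff d n with ha
  have ca : ContDiff ℝ ∞ a := contDiff_cutoff n
  have sa : HasCompactSupport a := hasCompactSupport_cutoff n
  set ar : E d → ℝ := fun x => a x * ‖x‖ with har
  have car : ContDiff ℝ ∞ ar := contDiff_cutoff_mul n fun x hx => contDiffAt_norm_of_ne hx
  set m : E d → ℝ := fun x => (d - 1 : ℝ) * a x + c * ar x with hm
  have cm : ContDiff ℝ ∞ m := (contDiff_const.mul ca).add (contDiff_const.mul car)
  have sm : HasCompactSupport m := (sa.mul_left).add (sa.mul_right.mul_left)
  -- The radial identity for this field supplies the `w²` term needed to complete the square in the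
  -- contribution of `c`.
  set Y : Fin d → E d → ℝ := fun j x => a x * (x j / ‖x‖) with hY
  have cY : ∀ j, ContDiff ℝ ∞ (Y j) := fun j =>
    contDiff_cutoff_mul n fun x hx => contDiffAt_radial hx j
  have sY : ∀ j, HasCompactSupport (Y j) := fun j => sa.mul_right
  obtain ⟨iT, eT⟩ := integral_rellich ca cm sa sm hu hq hh huq hqh
  obtain ⟨iR, eR⟩ := integral_radial cY sY hu hq huq
  refine ⟨_, iT.add (iR.const_mul (c / 2)), ?_, ?_⟩
  · simp only [Pi.add_apply]
    rw [integral_add iT (iR.const_mul (c / 2)), integral_const_mul, eT, eR]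
    simp
  intro x hx
  have hr : 0 < ‖x‖ := norm_pos_iff.mpr hx
  have D : ∀ {f : E d → ℝ}, ContDiff ℝ ∞ f → DifferentiableAt ℝ f x :=
    fun hf => hf.differentiable (by simp) x
  have dN : DifferentiableAt ℝ (fun x : E d => ‖x‖) x :=
    (contDiffAt_norm_of_ne hx).differentiableAt (by simp)
  have pm : ∀ j, pd j m x
      = (d - 1) * pd j a x + c * (a x * (x j / ‖x‖) + pd j a x * ‖x‖) := by
    intro j
    rw [hm, pd_add (D (contDiff_const.mul ca)) (D (contDiff_const.mul car)),
      pd_const_mul _ (D ca), pd_const_mul _ (D car), har, pd_mul (D ca) dN, pd_norm hx]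
  have pY : ∀ j, pd j (Y j) x
      = a x * pd j (fun x : E d => x j / ‖x‖) x + pd j a x * (x j / ‖x‖) := by
    intro j
    rw [hY, pd_mul (D ca) ((contDiffAt_radial hx j).differentiableAt (by simp))]
  simp only [Pi.add_apply]
  by_cases hin : 1 ≤ (n + 1) * ‖x‖ ∧ ‖x‖ ≤ 2 * (n + 1)
  · obtain ⟨e1, e2, e3⟩ := heq x (by push_cast; nlinarith) (by push_cast; linarith)
    simp only [e1, e2, e3, pm, pY]
    have hRle := euler_sq_le p x
    set R := euler p x with hR
    set N := ∑ j, p j x * p j x with hN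
    set A := euler (fun i => pd i a) x with hA
    set B := ∑ j, pd j a x * p j x with hB
    have f1 : ∑ k, 2 * a x * x k * (F x * p k x) = 2 * a x * F x * R := by
      rw [hR, euler, Finset.mul_sum]
      exact Finset.sum_congr rfl fun k _ => by ring
    have f2 : ∑ j, ∑ k, 2 * pd j a x * x k * (p j x * p k x) = 2 * (B * R) := by
      rw [hR, hB, euler, Finset.sum_mul_sum, Finset.mul_sum]
      refine Finset.sum_congr rfl fun j _ => ?_
      rw [Finset.mul_sum]
      exact Finset.sum_congr rfl fun k _ => by ring
    have f3 : ∑ j, ((d - 1) * pd j a x + c * (a x * (x j / ‖x‖) + pd j a x * ‖x‖)) * (w x * p j x)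
        = (d - 1) * w x * B + c * (a x * w x * (R / ‖x‖) + ‖x‖ * w x * B) := by
      rw [hR, hB, euler, Finset.mul_sum, Finset.mul_sum, Finset.sum_div, Finset.mul_sum,
        ← Finset.sum_add_distrib, Finset.mul_sum, ← Finset.sum_add_distrib]
      exact Finset.sum_congr rfl fun j _ => by ring
    have f4 : ∑ j, 2 * (a x * (x j / ‖x‖)) * (w x * p j x) = 2 * a x * w x * (R / ‖x‖) := by
      rw [hR, euler, Finset.sum_div, Finset.mul_sum]
      exact Finset.sum_congr rfl fun j _ => by ring
    have f5 : ∑ j, (a x * pd j (fun x : E d => x j / ‖x‖) x + pd j a x * (x j / ‖x‖))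
          * (w x * w x)
        = (a x * ((d - 1) / ‖x‖) + A / ‖x‖) * (w x * w x) := by
      rw [← Finset.sum_mul, Finset.sum_add_distrib, ← Finset.mul_sum, sum_pd_radial hx, hA, euler,
        Finset.sum_div]
      congr 2
      exact Finset.sum_congr rfl fun j _ => by ring
    have g1 : ∑ k, ∑ j, x k * pd k a x * (p j x * p j x) = A * N := by
      rw [hA, hN, euler, Finset.sum_mul_sum]
    have g2 : ∑ j, ∑ k, x k * pd j a x * (p j x * p k x) = B * R := by
      rw [hR, hB, euler, Finset.sum_mul_sum]
      exact Finset.sum_congr rfl fun j _ => Finset.sum_congr rfl fun k _ => by ring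
    have g3 : ∑ j, ‖x‖ * pd j a x * (w x / ‖x‖ * p j x) = w x * B := by
      rw [hB, Finset.mul_sum]
      exact Finset.sum_congr rfl fun j _ => by field_simp
    have g4 : ∑ k, x k * pd k a x * (w x * (w x / ‖x‖)) = A / ‖x‖ * (w x * w x) := by
      rw [hA, euler, Finset.sum_div, Finset.sum_mul]
      exact Finset.sum_congr rfl fun j _ => by ring
    have g5 : ∑ j, ‖x‖ * pd j a x * (w x * p j x) = ‖x‖ * w x * B := by
      rw [hB, Finset.mul_sum]
      exact Finset.sum_congr rfl fun j _ => by ring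
    rw [← Finset.mul_sum, ← hN, f1, f2, f3, f4, f5, cutoffError, g1, g2, g3, g4, g5]
    have ha0 : 0 ≤ a x := cutoff_nonneg n x
    have hd3 : (3 : ℝ) ≤ d := by exact_mod_cast hd
    -- With `R = x·p`, Cauchy–Schwarz gives `|x|²|p|² ≥ R²`. The numerator is then at least `(R +
    -- w)² + (d-3)w²/2`, which is where `d ≥ 3` enters.
    have q1 : 0 ≤ (‖x‖ ^ 2 * N + 2 * R * w x + (d - 1) / 2 * (w x * w x)) / ‖x‖ := by
      refine div_nonneg ?_ hr.le
      nlinarith [sq_nonneg (R + w x), mul_self_nonneg (w x)]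
    have q2 := mul_nonneg (mul_nonneg hc ha0) q1
    have q3 : c * a x * ((‖x‖ ^ 2 * N + 2 * R * w x + (d - 1) / 2 * (w x * w x)) / ‖x‖)
        = c * a x * (‖x‖ * N + 2 * w x * (R / ‖x‖) + (d - 1) / ‖x‖ / 2 * (w x * w x)) := by
      field_simp
    rw [q3] at q2
    rw [← sub_nonneg]
    refine le_of_le_of_eq q2 ?_
    simp only [hm, har]
    ring
  -- Off the annulus the cutoff vanishes in a neighbourhood of `x`, so all weights and their
  -- derivatives are zero and both sides are `0`.
  · have h0 : a =ᶠ[𝓝 x] fun _ => 0 := by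
      by_cases h1 : (n + 1) * ‖x‖ < 1
      · exact cutoff_eventuallyEq_zero_of_lt h1
      · refine cutoff_eventuallyEq_zero_of_gt ?_
        by_contra h2
        exact hin ⟨not_lt.mp h1, not_lt.mp h2⟩
    have a0 : a x = 0 := h0.eq_of_nhds
    have p0 : ∀ j, pd j a x = 0 := fun j => by rw [pd_congr h0, pd_const]
    have m0 : m x = 0 := by simp [hm, har, a0]
    have Y0 : ∀ j, Y j x = 0 := fun j => by simp [hY, a0]
    refine le_of_eq ?_
    simp only [cutoffError, pm, pY, Y0, euler, ← ha, a0, p0, m0]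
    simp

/-- The two equations are coupled antisymmetrically. With `M_i = 2x·p_i + (d-1+c|x|)w_i`, the
first-order parts of the Laplacians are `κM₂/|x|` and `-κM₁/|x|`. Multiplying by `M₁` and `M₂` and
adding cancels them, and likewise the terms `W w₁w₂`. -/
theorem virial_inequality (hd : 3 ≤ d) {c κ : ℝ} (hc : 0 ≤ c) {w₁ w₂ W : E d → ℝ}
    {p₁ p₂ : Fin d → E d → ℝ}
    (hw₁ : MemLp w₁ 2 volume) (hw₂ : MemLp w₂ 2 volume)
    (hp₁ : ∀ j, MemLp (p₁ j) 2 volume) (hp₂ : ∀ j, MemLp (p₂ j) 2 volume)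
    (hg₁ : HasWeakGrad w₁ p₁) (hg₂ : HasWeakGrad w₂ p₂)
    (hW₁ : MemLp (fun x => ‖x‖ * (W x * w₁ x)) 2 volume)
    (hW₂ : MemLp (fun x => ‖x‖ * (W x * w₂ x)) 2 volume)
    (hL₁ : HasLocalLaplacian w₁ p₁ fun x =>
      κ * (2 * (euler p₂ x / ‖x‖) + (d - 1) / ‖x‖ * w₂ x + c * w₂ x) - W x * w₂ x)
    (hL₂ : HasLocalLaplacian w₂ p₂ fun x =>
      -κ * (2 * (euler p₁ x / ‖x‖) + (d - 1) / ‖x‖ * w₁ x + c * w₁ x) + W x * w₁ x) :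
    Integrable (fun x => 2 * (W x * w₁ x * euler p₂ x - W x * w₂ x * euler p₁ x)
      + ∑ j, p₁ j x * p₁ j x + ∑ j, p₂ j x * p₂ j x) volume ∧
    ∫ x, (2 * (W x * w₁ x * euler p₂ x - W x * w₂ x * euler p₁ x)
      + ∑ j, p₁ j x * p₁ j x + ∑ j, p₂ j x * p₂ j x) ≤ 0 := by
  have hd0 : 0 < d := by omega
  -- The product is regrouped as `(|x|Wu)` times `(x/|x|)·p`, since only the weighted function
  -- `|x|Wu` is known to be in `L²`.
  have hI : ∀ {u : E d → ℝ} {p : Fin d → E d → ℝ}, MemLp (fun x => ‖x‖ * (W x * u x)) 2 volume →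
      (∀ j, MemLp (p j) 2 volume) → Integrable (fun x => W x * u x * euler p x) volume := by
    intro u p hu hp
    have : ∀ x, x ≠ 0 → ∑ k, x k / ‖x‖ * ((‖x‖ * (W x * u x)) * p k x)
        = W x * u x * euler p x := by
      intro x hx
      have hr : ‖x‖ ≠ 0 := norm_ne_zero_iff.mpr hx
      rw [euler, Finset.mul_sum]
      refine Finset.sum_congr rfl fun k _ => ?_
      field_simp
    have hi : Integrable (fun x => ∑ k, x k / ‖x‖ * ((‖x‖ * (W x * u x)) * p k x)) volume := by
      refine integrable_finsetSum _ fun k _ => (integrable_mul_of_memLp hu (hp k)).bdd_mul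
        (c := 1) ?_ (Eventually.of_forall fun x => ?_)
      · exact ((contDiff_coord k).continuous.measurable.div measurable_norm).aestronglyMeasurable
      · rw [norm_div, norm_norm]
        exact div_le_one_of_le₀ (abs_coord_le x k) (norm_nonneg x)
    refine hi.congr ?_
    filter_upwards [ae_ne_zero hd0] with x hx using this x hx
  have hN : ∀ {p : Fin d → E d → ℝ}, (∀ j, MemLp (p j) 2 volume) →
      Integrable (fun x => ∑ j, p j x * p j x) volume := fun hp =>
    integrable_finsetSum _ fun j _ => integrable_mul_of_memLp (hp j) (hp j)
  have hi : Integrable (fun x => 2 * (W x * w₁ x * euler p₂ x - W x * w₂ x * euler p₁ x)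
      + ∑ j, p₁ j x * p₁ j x + ∑ j, p₂ j x * p₂ j x) volume :=
    ((((hI hW₁ hp₂).sub (hI hW₂ hp₁)).const_mul 2).add (hN hp₁)).add (hN hp₂)
  refine ⟨hi, ?_⟩
  have L0 : IntLim (fun n x => cutoff d n x * (2 * (W x * w₁ x * euler p₂ x
        - W x * w₂ x * euler p₁ x) + ∑ j, p₁ j x * p₁ j x + ∑ j, p₂ j x * p₂ j x))
      (fun x => 1 * (2 * (W x * w₁ x * euler p₂ x - W x * w₂ x * euler p₁ x)
      + ∑ j, p₁ j x * p₁ j x + ∑ j, p₂ j x * p₂ j x)) :=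
    IntLim.of_bounded hi (fun n => (contDiff_cutoff n).continuous.aestronglyMeasurable)
      abs_cutoff_le_one (fun x hx => tendsto_cutoff hx) hd0
  have L := (L0.add (intLim_cutoffError hd0 c hw₁ hp₁ (memLp_div_norm hd hw₁ hp₁ hg₁))).add
    (intLim_cutoffError hd0 c hw₂ hp₂ (memLp_div_norm hd hw₂ hp₂ hg₂))
  have T := L.tendsto
  simp only [one_mul, add_zero] at T
  refine le_of_tendsto T (Eventually.of_forall fun n => ?_)
  obtain ⟨G₁, iG₁, eG₁, hG₁⟩ := exists_multiplier_bound hd hc hL₁ n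
  obtain ⟨G₂, iG₂, eG₂, hG₂⟩ := exists_multiplier_bound hd hc hL₂ n
  have e0 : ∫ x, (G₁ x + G₂ x) = 0 := by
    rw [integral_add iG₁ iG₂, eG₁, eG₂, add_zero]
  rw [← e0]
  refine integral_mono_ae (L.integrable n) (iG₁.add iG₂) ?_
  filter_upwards [ae_ne_zero hd0] with x hx
  have hr : ‖x‖ ≠ 0 := norm_ne_zero_iff.mpr hx
  have h1 := hG₁ x hx
  have h2 := hG₂ x hx
  -- This equality is the cancellation of the `κ`-terms and of the zeroth-order potential terms
  -- between the two multiplied equations.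
  refine le_trans (le_of_eq ?_) (add_le_add h1 h2)
  field_simp
  ring

end Multiplier

/-! ### The radial gauge change `e^{-iκ|x|}` -/

section Rotation

variable {d : ℕ}

/-- The real part of `e^{-iκ|x|}(w₁ + i w₂)`. -/
noncomputable def rot (κ : ℝ) (w₁ w₂ : E d → ℝ) (x : E d) : ℝ :=
  Real.cos (κ * ‖x‖) * w₁ x + Real.sin (κ * ‖x‖) * w₂ x

/-- The gradient of `rot κ w₁ w₂`, given the gradients of `w₁` and `w₂`. -/
noncomputable def rotGrad (κ : ℝ) (w₁ w₂ : E d → ℝ) (p₁ p₂ : Fin d → E d → ℝ) (j : Fin d)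
    (x : E d) : ℝ :=
  rot κ (p₁ j) (p₂ j) x
    + κ * (x j / ‖x‖) * (Real.cos (κ * ‖x‖) * w₂ x - Real.sin (κ * ‖x‖) * w₁ x)

theorem hasDerivAt_cos_mul (κ t : ℝ) :
    HasDerivAt (fun t => Real.cos (κ * t)) (-κ * Real.sin (κ * t)) t := by
  have := ((hasDerivAt_id t).const_mul κ).cos
  simp only [id, mul_one] at this
  convert! this using 1
  ring

theorem hasDerivAt_sin_mul (κ t : ℝ) :
    HasDerivAt (fun t => Real.sin (κ * t)) (κ * Real.cos (κ * t)) t := by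
  have := ((hasDerivAt_id t).const_mul κ).sin
  simp only [id, mul_one] at this
  convert! this using 1
  ring

theorem contDiffAt_comp_norm {g : ℝ → ℝ} (hg : ContDiff ℝ ∞ g) {x : E d} (hx : x ≠ 0) :
    ContDiffAt ℝ ∞ (fun x : E d => g ‖x‖) x :=
  hg.contDiffAt.comp x (contDiffAt_norm_of_ne hx)

theorem contDiff_cos_mul (κ : ℝ) : ContDiff ℝ ∞ fun t => Real.cos (κ * t) :=
  Real.contDiff_cos.comp (contDiff_const.mul contDiff_id)

theorem contDiff_sin_mul (κ : ℝ) : ContDiff ℝ ∞ fun t => Real.sin (κ * t) :=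
  Real.contDiff_sin.comp (contDiff_const.mul contDiff_id)

theorem abs_coord_div_norm_le (x : E d) (j : Fin d) : |x j / ‖x‖| ≤ 1 := by
  rw [abs_div, abs_norm]
  exact div_le_one_of_le₀ (abs_coord_le x j) (norm_nonneg x)

theorem measurable_coord_div_norm (j : Fin d) : Measurable fun x : E d => x j / ‖x‖ :=
  (contDiff_coord j).continuous.measurable.div measurable_norm

theorem measurable_cos_norm (κ : ℝ) : Measurable fun x : E d => Real.cos (κ * ‖x‖) := by
  fun_prop

theorem measurable_sin_norm (κ : ℝ) : Measurable fun x : E d => Real.sin (κ * ‖x‖) := by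
  fun_prop

theorem memLp_rot (κ : ℝ) {w₁ w₂ : E d → ℝ} (hw₁ : MemLp w₁ 2 volume) (hw₂ : MemLp w₂ 2 volume) :
    MemLp (rot κ w₁ w₂) 2 volume :=
  (memLp_bounded_mul hw₁ (measurable_cos_norm κ).aestronglyMeasurable
    fun _ => Real.abs_cos_le_one _).add
  (memLp_bounded_mul hw₂ (measurable_sin_norm κ).aestronglyMeasurable
    fun _ => Real.abs_sin_le_one _)

theorem rotGrad_eq (κ : ℝ) (w₁ w₂ : E d → ℝ) (p₁ p₂ : Fin d → E d → ℝ) (j : Fin d) (x : E d) :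
    rotGrad κ w₁ w₂ p₁ p₂ j x = rot κ (p₁ j) (p₂ j) x
      + κ * (x j / ‖x‖) * rot κ w₂ (fun x => -w₁ x) x := by
  simp only [rotGrad, rot]
  ring

theorem memLp_rotGrad (κ : ℝ) {w₁ w₂ : E d → ℝ} {p₁ p₂ : Fin d → E d → ℝ}
    (hw₁ : MemLp w₁ 2 volume) (hw₂ : MemLp w₂ 2 volume)
    (hp₁ : ∀ j, MemLp (p₁ j) 2 volume) (hp₂ : ∀ j, MemLp (p₂ j) 2 volume) (j : Fin d) :
    MemLp (rotGrad κ w₁ w₂ p₁ p₂ j) 2 volume := by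
  have e : rotGrad κ w₁ w₂ p₁ p₂ j = fun x => rot κ (p₁ j) (p₂ j) x
      + κ * (x j / ‖x‖) * rot κ w₂ (fun x => -w₁ x) x := funext (rotGrad_eq κ w₁ w₂ p₁ p₂ j)
  rw [e]
  refine (memLp_rot κ (hp₁ j) (hp₂ j)).add (memLp_bounded_mul (C := |κ|)
    (memLp_rot κ hw₂ hw₁.neg) ((measurable_coord_div_norm j).const_mul κ).aestronglyMeasurable
    fun x => ?_)
  rw [abs_mul]
  exact mul_le_of_le_one_right (abs_nonneg κ) (abs_coord_div_norm_le x j)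

/-- The phase is not smooth at the origin, since `sin(κ|x|)` has a cone there. Its gradient is
bounded by `|κ|`, so `HasWeakGrad.singular_mul` applies. -/
theorem hasWeakGrad_rot (hd : 3 ≤ d) (κ : ℝ) {w₁ w₂ : E d → ℝ} {p₁ p₂ : Fin d → E d → ℝ}
    (hw₁ : MemLp w₁ 2 volume) (hw₂ : MemLp w₂ 2 volume)
    (hp₁ : ∀ j, MemLp (p₁ j) 2 volume) (hp₂ : ∀ j, MemLp (p₂ j) 2 volume)
    (hg₁ : HasWeakGrad w₁ p₁) (hg₂ : HasWeakGrad w₂ p₂) :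
    HasWeakGrad (rot κ w₁ w₂) (rotGrad κ w₁ w₂ p₁ p₂) := by
  have bnd : ∀ (s : ℝ) (y : ℝ), |s| = |κ| → |y| ≤ 1 → ∀ (j : Fin d) (x : E d),
      |s * y * (x j / ‖x‖)| ≤ |κ| := by
    intro s y hs hy j x
    rw [abs_mul, abs_mul, hs, mul_assoc]
    exact mul_le_of_le_one_right (abs_nonneg κ)
      (mul_le_one₀ hy (abs_nonneg _) (abs_coord_div_norm_le x j))
  have m1 : ∀ j : Fin d, Measurable fun x : E d => -κ * Real.sin (κ * ‖x‖) * (x j / ‖x‖) :=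
    fun j => ((measurable_sin_norm κ).const_mul _).mul (measurable_coord_div_norm j)
  have m2 : ∀ j : Fin d, Measurable fun x : E d => κ * Real.cos (κ * ‖x‖) * (x j / ‖x‖) :=
    fun j => ((measurable_cos_norm κ).const_mul _).mul (measurable_coord_div_norm j)
  have b1 : ∀ (j : Fin d) (x : E d), |-κ * Real.sin (κ * ‖x‖) * (x j / ‖x‖)| ≤ |κ| := fun j x =>
    bnd _ _ (abs_neg κ) (Real.abs_sin_le_one _) j x
  have b2 : ∀ (j : Fin d) (x : E d), |κ * Real.cos (κ * ‖x‖) * (x j / ‖x‖)| ≤ |κ| := fun j x =>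
    bnd _ _ rfl (Real.abs_cos_le_one _) j x
  have h1 := hg₁.singular_mul hd hw₁ hp₁ (fun x hx => contDiffAt_comp_norm (contDiff_cos_mul κ) hx)
    (measurable_cos_norm κ) (fun x => Real.abs_cos_le_one _)
    (fun j x hx => pd_comp_norm hx (hasDerivAt_cos_mul κ ‖x‖) j) m1 b1
  have h2 := hg₂.singular_mul hd hw₂ hp₂ (fun x hx => contDiffAt_comp_norm (contDiff_sin_mul κ) hx)
    (measurable_sin_norm κ) (fun x => Real.abs_sin_le_one _)
    (fun j x hx => pd_comp_norm hx (hasDerivAt_sin_mul κ ‖x‖) j) m2 b2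
  have L : ∀ {u : E d → ℝ}, MemLp u 2 volume → LocallyIntegrable u volume :=
    fun hu => hu.locallyIntegrable (by norm_num)
  have c1 : ∀ {u : E d → ℝ}, MemLp u 2 volume →
      MemLp (fun x => Real.cos (κ * ‖x‖) * u x) 2 volume := fun hu =>
    memLp_bounded_mul hu (measurable_cos_norm κ).aestronglyMeasurable
      fun x => Real.abs_cos_le_one _
  have c2 : ∀ {u : E d → ℝ}, MemLp u 2 volume →
      MemLp (fun x => Real.sin (κ * ‖x‖) * u x) 2 volume := fun hu =>
    memLp_bounded_mul hu (measurable_sin_norm κ).aestronglyMeasurable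
      fun x => Real.abs_sin_le_one _
  have h := h1.add h2 (L (c1 hw₁)) (L (c2 hw₂))
    (fun j => L ((c1 (hp₁ j)).add
      (memLp_bounded_mul hw₁ (m1 j).aestronglyMeasurable (b1 j))))
    (fun j => L ((c2 (hp₂ j)).add
      (memLp_bounded_mul hw₂ (m2 j).aestronglyMeasurable (b2 j))))
  have e : rotGrad κ w₁ w₂ p₁ p₂ = fun j x =>
      Real.cos (κ * ‖x‖) * p₁ j x + -κ * Real.sin (κ * ‖x‖) * (x j / ‖x‖) * w₁ x
      + (Real.sin (κ * ‖x‖) * p₂ j x + κ * Real.cos (κ * ‖x‖) * (x j / ‖x‖) * w₂ x) := by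
    ext j x
    simp only [rotGrad, rot]
    ring
  rw [e]
  exact h

theorem pd_cutoff_mul {n : ℕ} {x : E d} (hx : x ≠ 0) (hn : cutoff d n =ᶠ[𝓝 x] fun _ => 1)
    {g g' : ℝ → ℝ} (hg : ∀ t, HasDerivAt g (g' t) t) (j : Fin d) :
    pd j (fun x => cutoff d n x * g ‖x‖) x = g' ‖x‖ * (x j / ‖x‖) := by
  rw [← pd_comp_norm hx (hg ‖x‖) j]
  refine pd_congr ?_
  filter_upwards [hn] with y hy
  rw [hy, one_mul]

theorem sum_pd_pd_cutoff_mul {n : ℕ} {x : E d} (hx : x ≠ 0)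
    (hn : cutoff d n =ᶠ[𝓝 x] fun _ => 1)
    {g g' g'' : ℝ → ℝ} (hg : ∀ t, HasDerivAt g (g' t) t) (hg' : ∀ t, HasDerivAt g' (g'' t) t) :
    ∑ j, pd j (pd j (fun x => cutoff d n x * g ‖x‖)) x
      = g'' ‖x‖ + g' ‖x‖ * ((d - 1) / ‖x‖) := by
  have hr : ‖x‖ ≠ 0 := norm_ne_zero_iff.mpr hx
  have h : ∀ j, pd j (pd j (fun x => cutoff d n x * g ‖x‖)) x
      = g' ‖x‖ * pd j (fun x : E d => x j / ‖x‖) x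
        + g'' ‖x‖ * (x j / ‖x‖) * (x j / ‖x‖) := by
    intro j
    rw [← pd_comp_norm hx (hg' ‖x‖) j, ← pd_mul (f := fun x : E d => g' ‖x‖)
      ((hg' ‖x‖).differentiableAt.comp x ((contDiffAt_norm_of_ne hx).differentiableAt (by simp)))
      ((contDiffAt_radial hx j).differentiableAt (by simp))]
    refine pd_congr ?_
    filter_upwards [hn.eventually_nhds, isOpen_ne.mem_nhds hx] with y hy hy0
    exact pd_cutoff_mul hy0 hy hg j
  simp only [h]
  rw [Finset.sum_add_distrib, ← Finset.mul_sum, sum_pd_radial hx]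
  have : ∑ j, g'' ‖x‖ * (x j / ‖x‖) * (x j / ‖x‖) = g'' ‖x‖ := by
    have e : ∀ j, g'' ‖x‖ * (x j / ‖x‖) * (x j / ‖x‖) = g'' ‖x‖ / ‖x‖ ^ 2 * (x j * x j) :=
      fun j => by field_simp
    simp only [e]
    rw [← Finset.mul_sum, ← norm_sq_eq_sum]
    field_simp
  rw [this]
  ring

theorem memLp_test_mul {b u : E d → ℝ} (hb : Continuous b) (hs : HasCompactSupport b)
    (hu : MemLp u 2 volume) : MemLp (fun x => b x * u x) 2 volume := by
  obtain ⟨C, hC⟩ := hs.exists_bound_of_continuous hb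
  exact memLp_bounded_mul hu hb.aestronglyMeasurable hC

theorem euler_rotGrad {κ : ℝ} {w₁ w₂ : E d → ℝ} {p₁ p₂ : Fin d → E d → ℝ} {x : E d}
    (hx : x ≠ 0) :
    euler (rotGrad κ w₁ w₂ p₁ p₂) x = rot κ (euler p₁) (euler p₂) x
      + κ * ‖x‖ * (Real.cos (κ * ‖x‖) * w₂ x - Real.sin (κ * ‖x‖) * w₁ x) := by
  have hr : ‖x‖ ≠ 0 := norm_ne_zero_iff.mpr hx
  have e : ∀ k, x k * rotGrad κ w₁ w₂ p₁ p₂ k x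
      = Real.cos (κ * ‖x‖) * (x k * p₁ k x) + Real.sin (κ * ‖x‖) * (x k * p₂ k x)
        + κ * (Real.cos (κ * ‖x‖) * w₂ x - Real.sin (κ * ‖x‖) * w₁ x) / ‖x‖ * (x k * x k) := by
    intro k
    simp only [rotGrad, rot]
    ring
  rw [euler]
  simp only [e]
  rw [Finset.sum_add_distrib, Finset.sum_add_distrib, ← Finset.mul_sum, ← Finset.mul_sum,
    ← Finset.mul_sum, ← norm_sq_eq_sum]
  simp only [rot, euler]
  field_simp

/-- For `ψ = w₁ + iw₂` and `v = e^{-iκ|x|}ψ`, the term `κ²ψ` of the equation cancels against the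
second radial derivative of the phase and the phase part of `∂_rψ`. This is the real part of the
resulting equation for `v`. On each annulus the local representative is obtained by multiplying the
phase by a cutoff. -/
theorem hasLocalLaplacian_rot {κ c : ℝ} {w₁ w₂ W : E d → ℝ} {p₁ p₂ : Fin d → E d → ℝ}
    (hw₁ : MemLp w₁ 2 volume) (hw₂ : MemLp w₂ 2 volume)
    (hp₁ : ∀ j, MemLp (p₁ j) 2 volume) (hp₂ : ∀ j, MemLp (p₂ j) 2 volume)
    (hg₁ : HasWeakGrad w₁ p₁) (hg₂ : HasWeakGrad w₂ p₂)
    (hW₁ : MemLp (fun x => ‖x‖ * (W x * w₁ x)) 2 volume)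
    (hW₂ : MemLp (fun x => ‖x‖ * (W x * w₂ x)) 2 volume)
    (hi₁ : ∀ g : E d → ℝ, ContDiff ℝ ∞ g → HasCompactSupport g →
      Integrable (fun x => g x * (W x * w₁ x)) volume)
    (hi₂ : ∀ g : E d → ℝ, ContDiff ℝ ∞ g → HasCompactSupport g →
      Integrable (fun x => g x * (W x * w₂ x)) volume)
    (hf₁ : HasWeakDiv p₁ fun x => -(W x * w₂ x) - κ ^ 2 * w₁ x + c * κ * w₂ x)
    (hf₂ : HasWeakDiv p₂ fun x => W x * w₁ x - κ ^ 2 * w₂ x - c * κ * w₁ x) :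
    HasLocalLaplacian (rot κ w₁ w₂) (rotGrad κ w₁ w₂ p₁ p₂) fun x =>
      κ * (2 * (euler (rotGrad κ w₂ (fun x => -w₁ x) p₂ fun j x => -p₁ j x) x / ‖x‖)
        + (d - 1) / ‖x‖ * rot κ w₂ (fun x => -w₁ x) x + c * rot κ w₂ (fun x => -w₁ x) x)
      - W x * rot κ w₂ (fun x => -w₁ x) x := by
  intro n
  set f₁ : E d → ℝ := fun x => -(W x * w₂ x) - κ ^ 2 * w₁ x + c * κ * w₂ x with hf₁d
  set f₂ : E d → ℝ := fun x => W x * w₁ x - κ ^ 2 * w₂ x - c * κ * w₁ x with hf₂d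
  set C : E d → ℝ := fun x => cutoff d n x * Real.cos (κ * ‖x‖) with hC
  set S : E d → ℝ := fun x => cutoff d n x * Real.sin (κ * ‖x‖) with hS
  have cC : ContDiff ℝ ∞ C := contDiff_cutoff_mul n fun x hx =>
    contDiffAt_comp_norm (contDiff_cos_mul κ) hx
  have cS : ContDiff ℝ ∞ S := contDiff_cutoff_mul n fun x hx =>
    contDiffAt_comp_norm (contDiff_sin_mul κ) hx
  have sC : HasCompactSupport C := (hasCompactSupport_cutoff n).mul_right
  have sS : HasCompactSupport S := (hasCompactSupport_cutoff n).mul_right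
  have L : ∀ {u : E d → ℝ}, MemLp u 2 volume → LocallyIntegrable u volume :=
    fun hu => hu.locallyIntegrable (by norm_num)
  have tf₁ : ∀ g : E d → ℝ, ContDiff ℝ ∞ g → HasCompactSupport g →
      Integrable (fun x => g x * f₁ x) volume := fun g hg hs => by
    refine ((((hi₂ g hg hs).neg.sub ((integrable_test_mul (L hw₁) hg.continuous hs).const_mul
      (κ ^ 2))).add ((integrable_test_mul (L hw₂) hg.continuous hs).const_mul (c * κ)))).congr
      (Eventually.of_forall fun x => ?_)
    simp only [hf₁d, Pi.add_apply, Pi.sub_apply, Pi.neg_apply]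
    ring
  have tf₂ : ∀ g : E d → ℝ, ContDiff ℝ ∞ g → HasCompactSupport g →
      Integrable (fun x => g x * f₂ x) volume := fun g hg hs => by
    refine ((((hi₁ g hg hs).sub ((integrable_test_mul (L hw₂) hg.continuous hs).const_mul
      (κ ^ 2))).sub ((integrable_test_mul (L hw₁) hg.continuous hs).const_mul (c * κ)))).congr
      (Eventually.of_forall fun x => ?_)
    simp only [hf₂d, Pi.sub_apply]
    ring
  -- The factor `1/|x|` needed to recover `Wu` from `|x|Wu` is smooth on the support of the cutoff.
  have mW : ∀ {g : ℝ → ℝ} {u : E d → ℝ}, ContDiff ℝ ∞ g →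
      MemLp (fun x => ‖x‖ * (W x * u x)) 2 volume →
      MemLp (fun x => cutoff d n x * g ‖x‖ * (W x * u x)) 2 volume := by
    intro g u hg hu
    have h1 : ContDiff ℝ ∞ fun x : E d => cutoff d n x * (g ‖x‖ / ‖x‖) :=
      contDiff_cutoff_mul n fun x hx => (contDiffAt_comp_norm hg hx).div
        (contDiffAt_norm_of_ne hx) (norm_ne_zero_iff.mpr hx)
    have h2 := memLp_test_mul h1.continuous (hasCompactSupport_cutoff n).mul_right hu
    convert! h2 using 1
    ext x
    by_cases hx : x = 0
    · have := (cutoff_eventuallyEq_zero_of_lt (n := n) (x := x) (by simp [hx])).eq_of_nhds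
      simp [this]
    · have hr : ‖x‖ ≠ 0 := norm_ne_zero_iff.mpr hx
      field_simp
  have mf₁ : MemLp (fun x => C x * f₁ x) 2 volume := by
    have := ((mW (contDiff_cos_mul κ) hW₂).neg.sub
      ((memLp_test_mul cC.continuous sC hw₁).const_mul (κ ^ 2))).add
      ((memLp_test_mul cC.continuous sC hw₂).const_mul (c * κ))
    convert! this using 1
    ext x
    simp only [hf₁d, hC, Pi.add_apply, Pi.sub_apply, Pi.neg_apply]
    ring
  have mf₂ : MemLp (fun x => S x * f₂ x) 2 volume := by
    have := ((mW (contDiff_sin_mul κ) hW₁).sub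
      ((memLp_test_mul cS.continuous sS hw₂).const_mul (κ ^ 2))).sub
      ((memLp_test_mul cS.continuous sS hw₁).const_mul (c * κ))
    convert! this using 1
    ext x
    simp only [hf₂d, hS, Pi.sub_apply]
    ring
  have mq : ∀ {b u : E d → ℝ} {p : Fin d → E d → ℝ}, ContDiff ℝ ∞ b → HasCompactSupport b →
      MemLp u 2 volume → (∀ j, MemLp (p j) 2 volume) → ∀ j,
      MemLp (fun x => b x * p j x + pd j b x * u x) 2 volume := fun hb hs hu hp j =>
    (memLp_test_mul hb.continuous hs (hp j)).add
      (memLp_test_mul (continuous_pd hb) (hasCompactSupport_pd hs) hu)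
  have ml : ∀ {b u : E d → ℝ} {p : Fin d → E d → ℝ}, ContDiff ℝ ∞ b → HasCompactSupport b →
      MemLp u 2 volume → (∀ j, MemLp (p j) 2 volume) →
      MemLp (fun x => ∑ j, (2 * pd j b x * p j x + pd j (pd j b) x * u x)) 2 volume :=
    fun hb hs hu hp => memLp_finsetSum _ fun j _ =>
      (memLp_test_mul (b := fun x => 2 * pd j _ x) (continuous_const.mul (continuous_pd hb))
        (hasCompactSupport_pd hs).mul_left (hp j)).add
      (memLp_test_mul (continuous_pd (contDiff_pd hb))
        (hasCompactSupport_pd (hasCompactSupport_pd hs)) hu)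
  have ti : ∀ {h : E d → ℝ}, MemLp h 2 volume → ∀ g : E d → ℝ, ContDiff ℝ ∞ g →
      HasCompactSupport g → Integrable (fun x => g x * h x) volume := fun hh g hg hs =>
    integrable_test_mul (L hh) hg.continuous hs
  refine ⟨fun x => C x * w₁ x + S x * w₂ x,
    fun j x => (C x * p₁ j x + pd j C x * w₁ x) + (S x * p₂ j x + pd j S x * w₂ x),
    fun x => (C x * f₁ x + ∑ j, (2 * pd j C x * p₁ j x + pd j (pd j C) x * w₁ x))
      + (S x * f₂ x + ∑ j, (2 * pd j S x * p₂ j x + pd j (pd j S) x * w₂ x)),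
    (memLp_test_mul cC.continuous sC hw₁).add (memLp_test_mul cS.continuous sS hw₂),
    fun j => (mq cC sC hw₁ hp₁ j).add (mq cS sS hw₂ hp₂ j),
    (mf₁.add (ml cC sC hw₁ hp₁)).add (mf₂.add (ml cS sS hw₂ hp₂)),
    (hg₁.smooth_mul cC (L hw₁) fun j => L (hp₁ j)).add
      (hg₂.smooth_mul cS (L hw₂) fun j => L (hp₂ j))
      (L (memLp_test_mul cC.continuous sC hw₁)) (L (memLp_test_mul cS.continuous sS hw₂))
      (fun j => L (mq cC sC hw₁ hp₁ j)) (fun j => L (mq cS sS hw₂ hp₂ j)),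
    (hf₁.smooth_mul hg₁ cC (L hw₁) (fun j => L (hp₁ j)) tf₁).add
      (hf₂.smooth_mul hg₂ cS (L hw₂) (fun j => L (hp₂ j)) tf₂)
      (fun j => L (mq cC sC hw₁ hp₁ j)) (fun j => L (mq cS sS hw₂ hp₂ j))
      (ti (mf₁.add (ml cC sC hw₁ hp₁))) (ti (mf₂.add (ml cS sS hw₂ hp₂))), ?_⟩
  intro x h1 h2
  have hr0 : 0 < ‖x‖ := by
    by_contra h
    have : ‖x‖ = 0 := le_antisymm (not_lt.mp h) (norm_nonneg x)
    rw [this] at h1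
    linarith
  have hr : ‖x‖ ≠ 0 := hr0.ne'
  have hx : x ≠ 0 := norm_ne_zero_iff.mp hr
  have hn := cutoff_eventuallyEq_one h1 h2
  have C1 : C x = Real.cos (κ * ‖x‖) := by simp only [hC, hn.eq_of_nhds, one_mul]
  have S1 : S x = Real.sin (κ * ‖x‖) := by simp only [hS, hn.eq_of_nhds, one_mul]
  have pC : ∀ j, pd j C x = -κ * Real.sin (κ * ‖x‖) * (x j / ‖x‖) := fun j =>
    pd_cutoff_mul hx hn (g := fun t => Real.cos (κ * t)) (hasDerivAt_cos_mul κ) j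
  have pS : ∀ j, pd j S x = κ * Real.cos (κ * ‖x‖) * (x j / ‖x‖) := fun j =>
    pd_cutoff_mul hx hn (g := fun t => Real.sin (κ * t)) (hasDerivAt_sin_mul κ) j
  have lC : ∑ j, pd j (pd j C) x = -κ * (κ * Real.cos (κ * ‖x‖))
      + -κ * Real.sin (κ * ‖x‖) * ((d - 1) / ‖x‖) :=
    sum_pd_pd_cutoff_mul hx hn (g := fun t => Real.cos (κ * t)) (hasDerivAt_cos_mul κ)
      (g'' := fun t => -κ * (κ * Real.cos (κ * t)))
      fun t => (hasDerivAt_sin_mul κ t).const_mul (-κ)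
  have lS : ∑ j, pd j (pd j S) x = κ * (-κ * Real.sin (κ * ‖x‖))
      + κ * Real.cos (κ * ‖x‖) * ((d - 1) / ‖x‖) :=
    sum_pd_pd_cutoff_mul hx hn (g := fun t => Real.sin (κ * t)) (hasDerivAt_sin_mul κ)
      (g'' := fun t => κ * (-κ * Real.sin (κ * t)))
      fun t => (hasDerivAt_cos_mul κ t).const_mul κ
  refine ⟨by simp only [C1, S1, rot], fun j => ?_, ?_⟩
  · simp only [C1, S1, pC, pS, rotGrad, rot]
    ring
  · have s1 : ∑ j, (2 * pd j C x * p₁ j x + pd j (pd j C) x * w₁ x)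
        = -2 * κ * Real.sin (κ * ‖x‖) * (euler p₁ x / ‖x‖)
          + (∑ j, pd j (pd j C) x) * w₁ x := by
      rw [Finset.sum_add_distrib, Finset.sum_mul, euler, Finset.sum_div, Finset.mul_sum]
      congr 1
      exact Finset.sum_congr rfl fun j _ => by rw [pC]; ring
    have s2 : ∑ j, (2 * pd j S x * p₂ j x + pd j (pd j S) x * w₂ x)
        = 2 * κ * Real.cos (κ * ‖x‖) * (euler p₂ x / ‖x‖)
          + (∑ j, pd j (pd j S) x) * w₂ x := by
      rw [Finset.sum_add_distrib, Finset.sum_mul, euler, Finset.sum_div, Finset.mul_sum]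
      congr 1
      exact Finset.sum_congr rfl fun j _ => by rw [pS]; ring
    have s3 : euler (fun j x => -p₁ j x) x = -euler p₁ x := by simp [euler]
    simp only [s1, s2, lC, lS, euler_rotGrad hx, C1, S1, hf₁d, hf₂d]
    simp only [rot, s3]
    field_simp
    ring

end Rotation

/-! ### Vanishing of solutions in real and imaginary parts -/

section Eigenvalues

variable {d : ℕ}

theorem hasWeakGrad_re (φ : W12 d) :
    HasWeakGrad (fun x => ((φ : L2 d) x).re) (fun j x => (grad d φ x j).re) := by
  have h := (mem_graph_grad_iff _ _).mp ((grad d).mem_graph φ)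
  intro g hg hs j
  have i1 : Integrable (fun x => pd j g x • (φ : L2 d) x) volume :=
    (locallyIntegrable_L2 _).integrable_smul_left_of_hasCompactSupport
      (continuous_pd hg) (hasCompactSupport_pd hs)
  have i2 : Integrable (fun x => g x • grad d φ x j) volume :=
    (locallyIntegrable_coord _ j).integrable_smul_left_of_hasCompactSupport hg.continuous hs
  have e1 := Complex.reCLM.integral_comp_comm i1
  have e2 := Complex.reCLM.integral_comp_comm i2
  have e3 := congrArg Complex.re (h g hg hs j)
  simp only [Complex.reCLM_apply, Complex.real_smul, Complex.re_ofReal_mul] at e1 e2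
  rw [e1, e2, ← Complex.neg_re]
  simpa [pd, Complex.real_smul] using e3

theorem hasWeakGrad_im (φ : W12 d) :
    HasWeakGrad (fun x => ((φ : L2 d) x).im) (fun j x => (grad d φ x j).im) := by
  have h := (mem_graph_grad_iff _ _).mp ((grad d).mem_graph φ)
  intro g hg hs j
  have i1 : Integrable (fun x => pd j g x • (φ : L2 d) x) volume :=
    (locallyIntegrable_L2 _).integrable_smul_left_of_hasCompactSupport
      (continuous_pd hg) (hasCompactSupport_pd hs)
  have i2 : Integrable (fun x => g x • grad d φ x j) volume :=
    (locallyIntegrable_coord _ j).integrable_smul_left_of_hasCompactSupport hg.continuous hs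
  have e1 := Complex.imCLM.integral_comp_comm i1
  have e2 := Complex.imCLM.integral_comp_comm i2
  have e3 := congrArg Complex.im (h g hg hs j)
  simp only [Complex.imCLM_apply, Complex.real_smul, Complex.im_ofReal_mul] at e1 e2
  rw [e1, e2, ← Complex.neg_im]
  simpa [pd, Complex.real_smul] using e3

theorem memLp_add_mul_I {w₁ w₂ : E d → ℝ} (hw₁ : MemLp w₁ 2 volume) (hw₂ : MemLp w₂ 2 volume) :
    MemLp (fun x => (w₁ x : ℂ) + w₂ x * Complex.I) 2 (volume : Measure (E d)) :=
  (Complex.ofRealCLM.comp_memLp' hw₁).add ((Complex.ofRealCLM.comp_memLp' hw₂).mul_const _)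

theorem integral_smul_add_mul_I {g w₁ w₂ : E d → ℝ} (h₁ : Integrable (fun x => g x * w₁ x) volume)
    (h₂ : Integrable (fun x => g x * w₂ x) volume) :
    ∫ x, g x • ((w₁ x : ℂ) + w₂ x * Complex.I)
      = ((∫ x, g x * w₁ x : ℝ) : ℂ) + ((∫ x, g x * w₂ x : ℝ) : ℂ) * Complex.I := by
  rw [← integral_complex_ofReal, ← integral_complex_ofReal, ← integral_mul_const,
    ← integral_add h₁.ofReal (h₂.ofReal.mul_const _)]
  congr 1
  ext x
  simp only [Complex.real_smul, Complex.ofReal_mul]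
  ring

/-- The hypotheses on `V` quantify over `W12`. This lets them be applied to the rotated function
and, through `exists_W12_test`, lets the form be evaluated on real test functions. -/
theorem exists_W12_of_hasWeakGrad {w₁ w₂ : E d → ℝ} {p₁ p₂ : Fin d → E d → ℝ}
    (hw₁ : MemLp w₁ 2 volume) (hw₂ : MemLp w₂ 2 volume)
    (hp₁ : ∀ j, MemLp (p₁ j) 2 volume) (hp₂ : ∀ j, MemLp (p₂ j) 2 volume)
    (hg₁ : HasWeakGrad w₁ p₁) (hg₂ : HasWeakGrad w₂ p₂) :
    ∃ φ : W12 d, (∀ᵐ x, (φ : L2 d) x = (w₁ x : ℂ) + w₂ x * Complex.I) ∧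
      ∀ᵐ x, ∀ j, grad d φ x j = (p₁ j x : ℂ) + p₂ j x * Complex.I := by
  have m0 := memLp_add_mul_I hw₁ hw₂
  have m1 : MemLp (fun x => WithLp.toLp 2 fun j : Fin d => (p₁ j x : ℂ) + p₂ j x * Complex.I) 2
      (volume : Measure (E d)) := by
    rw [memLp_piLp_iff]
    exact fun j => memLp_add_mul_I (hp₁ j) (hp₂ j)
  have L : ∀ {u : E d → ℝ}, MemLp u 2 volume → LocallyIntegrable u volume :=
    fun hu => hu.locallyIntegrable (by norm_num)
  have hw : IsWeakGradient (m0.toLp _) (m1.toLp _) := by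
    intro g hg hs j
    have a1 : ∫ x, fderiv ℝ g x (EuclideanSpace.single j 1) • (m0.toLp _ : L2 d) x
        = ∫ x, pd j g x • ((w₁ x : ℂ) + w₂ x * Complex.I) := by
      apply integral_congr_ae
      filter_upwards [m0.coeFn_toLp] with x hx
      rw [hx]
      rfl
    have a2 : ∫ x, g x • (m1.toLp _ : L2Vec d) x j
        = ∫ x, g x • ((p₁ j x : ℂ) + p₂ j x * Complex.I) := by
      apply integral_congr_ae
      filter_upwards [m1.coeFn_toLp] with x hx
      rw [hx]
    have cg := continuous_pd (j := j) hg
    have sg := hasCompactSupport_pd (j := j) hs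
    rw [a1, a2, integral_smul_add_mul_I (integrable_test_mul (L hw₁) cg sg)
      (integrable_test_mul (L hw₂) cg sg), integral_smul_add_mul_I
      (integrable_test_mul (L (hp₁ j)) hg.continuous hs)
      (integrable_test_mul (L (hp₂ j)) hg.continuous hs), hg₁ g hg hs j, hg₂ g hg hs j]
    push_cast
    ring
  have hmem := (mem_graph_grad_iff _ _).mpr hw
  rw [LinearPMap.mem_graph_iff] at hmem
  obtain ⟨φ, h1, h2⟩ := hmem
  refine ⟨φ, ?_, ?_⟩
  · rw [h1]
    exact m0.coeFn_toLp
  · rw [h2]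
    filter_upwards [m1.coeFn_toLp] with x hx j
    rw [hx]

theorem hasWeakGrad_test {g : E d → ℝ} (hg : ContDiff ℝ ∞ g) :
    HasWeakGrad g fun j => pd j g := by
  intro f hf hfs j
  have h := integral_mul_fderiv_eq_neg_fderiv_mul_of_integrable (μ := (volume : Measure (E d)))
    (f := f) (g := g) (v := EuclideanSpace.single j 1)
    (((continuous_pd (j := j) hf).mul hg.continuous).integrable_of_hasCompactSupport
      (hasCompactSupport_pd hfs).mul_right)
    ((hf.continuous.mul (continuous_pd (j := j) hg)).integrable_of_hasCompactSupport hfs.mul_right)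
    ((hf.continuous.mul hg.continuous).integrable_of_hasCompactSupport hfs.mul_right)
    (fun x _ => hf.differentiable (by simp) x) (fun x _ => hg.differentiable (by simp) x)
  exact (neg_eq_iff_eq_neg.mpr h).symm

theorem exists_W12_test {g : E d → ℝ} (hg : ContDiff ℝ ∞ g) (hs : HasCompactSupport g) :
    ∃ φ : W12 d, (∀ᵐ x, (φ : L2 d) x = (g x : ℂ)) ∧
      ∀ᵐ x, ∀ j, grad d φ x j = (pd j g x : ℂ) := by
  have h0 : HasWeakGrad (fun _ : E d => (0 : ℝ)) fun _ _ => 0 := by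
    intro f _ _ j
    simp
  obtain ⟨φ, h1, h2⟩ := exists_W12_of_hasWeakGrad
    (hg.continuous.memLp_of_hasCompactSupport hs) (MemLp.zero (ε := ℝ))
    (fun j => (continuous_pd (j := j) hg).memLp_of_hasCompactSupport (hasCompactSupport_pd hs))
    (fun _ => MemLp.zero (ε := ℝ)) (hasWeakGrad_test hg) h0
  refine ⟨φ, ?_, ?_⟩
  · filter_upwards [h1] with x hx
    simpa using hx
  · filter_upwards [h2] with x hx j
    simpa using hx j

theorem enorm_sq_add_mul_I (a b : ℝ) :
    ‖(a : ℂ) + b * Complex.I‖ₑ ^ 2 = ENNReal.ofReal (a ^ 2 + b ^ 2) := by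
  rw [← ofReal_norm, ← ENNReal.ofReal_pow (norm_nonneg _), Complex.sq_norm,
    Complex.normSq_add_mul_I]

/-- The smallness condition on the imaginary part, for real and imaginary parts separately. -/
theorem weighted_bound {V : E d → ℂ} (hV : AEStronglyMeasurable V volume) {b : ℝ≥0}
    (hb : ∀ ψ : W12 d, ∫⁻ x, ‖x‖ₑ ^ 2 * ‖(V x).im‖ₑ ^ 2 * ‖(ψ : L2 d) x‖ₑ ^ 2
      ≤ (b : ℝ≥0∞) ^ 2 * ∫⁻ x, ‖grad d ψ x‖ₑ ^ 2)
    {w₁ w₂ : E d → ℝ} {p₁ p₂ : Fin d → E d → ℝ}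
    (hw₁ : MemLp w₁ 2 volume) (hw₂ : MemLp w₂ 2 volume)
    (hp₁ : ∀ j, MemLp (p₁ j) 2 volume) (hp₂ : ∀ j, MemLp (p₂ j) 2 volume)
    (hg₁ : HasWeakGrad w₁ p₁) (hg₂ : HasWeakGrad w₂ p₂) :
    MemLp (fun x => ‖x‖ * ((V x).im * w₁ x)) 2 volume ∧
    MemLp (fun x => ‖x‖ * ((V x).im * w₂ x)) 2 volume ∧
    ∫ x, ((‖x‖ * ((V x).im * w₁ x)) ^ 2 + (‖x‖ * ((V x).im * w₂ x)) ^ 2)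
      ≤ (b : ℝ) ^ 2 * ∫ x, (∑ j, p₁ j x * p₁ j x + ∑ j, p₂ j x * p₂ j x) := by
  obtain ⟨φ, h1, h2⟩ := exists_W12_of_hasWeakGrad hw₁ hw₂ hp₁ hp₂ hg₁ hg₂
  have hle := hb φ
  have e1 : ∫⁻ x, ‖x‖ₑ ^ 2 * ‖(V x).im‖ₑ ^ 2 * ‖(φ : L2 d) x‖ₑ ^ 2
      = ∫⁻ x, ENNReal.ofReal ((‖x‖ * ((V x).im * w₁ x)) ^ 2
        + (‖x‖ * ((V x).im * w₂ x)) ^ 2) := by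
    refine lintegral_congr_ae ?_
    filter_upwards [h1] with x hx
    rw [hx, enorm_sq_add_mul_I, ← ofReal_norm, ← ofReal_norm,
      ← ENNReal.ofReal_pow (norm_nonneg _), ← ENNReal.ofReal_pow (norm_nonneg _),
      ← ENNReal.ofReal_mul (by positivity), ← ENNReal.ofReal_mul (by positivity)]
    congr 1
    rw [Real.norm_eq_abs, sq_abs]
    ring
  have hN : ∀ {p : Fin d → E d → ℝ}, (∀ j, MemLp (p j) 2 volume) →
      Integrable (fun x => ∑ j, p j x * p j x) volume := fun hp =>
    integrable_finsetSum _ fun j _ => integrable_mul_of_memLp (hp j) (hp j)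
  have iN : Integrable (fun x => ∑ j, p₁ j x * p₁ j x + ∑ j, p₂ j x * p₂ j x) volume :=
    (hN hp₁).add (hN hp₂)
  have N0 : ∀ x, 0 ≤ ∑ j, p₁ j x * p₁ j x + ∑ j, p₂ j x * p₂ j x := fun x =>
    add_nonneg (Finset.sum_nonneg fun j _ => mul_self_nonneg _)
      (Finset.sum_nonneg fun j _ => mul_self_nonneg _)
  have e2 : ∫⁻ x, ‖grad d φ x‖ₑ ^ 2
      = ENNReal.ofReal (∫ x, (∑ j, p₁ j x * p₁ j x + ∑ j, p₂ j x * p₂ j x)) := by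
    rw [ofReal_integral_eq_lintegral_ofReal iN (Eventually.of_forall N0)]
    refine lintegral_congr_ae ?_
    filter_upwards [h2] with x hx
    rw [← ofReal_norm, ← ENNReal.ofReal_pow (norm_nonneg _), EuclideanSpace.norm_sq_eq,
      ← Finset.sum_add_distrib]
    congr 1
    refine Finset.sum_congr rfl fun j _ => ?_
    rw [hx j, Complex.sq_norm, Complex.normSq_add_mul_I]
    ring
  have hm : ∀ {w : E d → ℝ}, MemLp w 2 volume →
      AEStronglyMeasurable (fun x => ‖x‖ * ((V x).im * w x)) volume := fun hw =>
    continuous_norm.aestronglyMeasurable.mul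
      ((Complex.continuous_im.comp_aestronglyMeasurable hV).mul hw.1)
  have eR : (b : ℝ≥0∞) ^ 2 * ENNReal.ofReal (∫ x, (∑ j, p₁ j x * p₁ j x + ∑ j, p₂ j x * p₂ j x))
      = ENNReal.ofReal ((b : ℝ) ^ 2
        * ∫ x, (∑ j, p₁ j x * p₁ j x + ∑ j, p₂ j x * p₂ j x)) := by
    rw [ENNReal.ofReal_mul (by positivity), ENNReal.ofReal_pow b.coe_nonneg,
      ENNReal.ofReal_coe_nnreal]
  rw [e1, e2, eR] at hle
  have isum : Integrable (fun x => (‖x‖ * ((V x).im * w₁ x)) ^ 2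
      + (‖x‖ * ((V x).im * w₂ x)) ^ 2) volume := by
    refine ⟨((hm hw₁).pow 2).add ((hm hw₂).pow 2), ?_⟩
    rw [hasFiniteIntegral_iff_ofReal (Eventually.of_forall fun x => by positivity)]
    exact hle.trans_lt ENNReal.ofReal_lt_top
  refine ⟨?_, ?_, ?_⟩
  · rw [memLp_two_iff_integrable_sq (hm hw₁)]
    refine isum.mono ((hm hw₁).pow 2) (Eventually.of_forall fun x => ?_)
    rw [Real.norm_of_nonneg (by positivity), Real.norm_of_nonneg (by positivity)]
    nlinarith [sq_nonneg (‖x‖ * ((V x).im * w₂ x))]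
  · rw [memLp_two_iff_integrable_sq (hm hw₂)]
    refine isum.mono ((hm hw₂).pow 2) (Eventually.of_forall fun x => ?_)
    rw [Real.norm_of_nonneg (by positivity), Real.norm_of_nonneg (by positivity)]
    nlinarith [sq_nonneg (‖x‖ * ((V x).im * w₁ x))]
  · rw [← ofReal_integral_eq_lintegral_ofReal isum
      (Eventually.of_forall fun x => by positivity)] at hle
    refine (ENNReal.ofReal_le_ofReal_iff ?_).mp hle
    exact mul_nonneg (by positivity) (integral_nonneg N0)

theorem euler_neg (p : Fin d → E d → ℝ) (x : E d) : euler (fun j x => -p j x) x = -euler p x := by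
  simp [euler]

/-- A solution of the eigenvalue equation, split into real and imaginary parts, vanishes. -/
theorem ae_eq_zero_of_eigenfunction (hd : 3 ≤ d) {V : E d → ℂ}
    (hV : AEStronglyMeasurable V volume) {b : ℝ≥0} (hb1 : b < 1 / 2)
    (hb : ∀ ψ : W12 d, ∫⁻ x, ‖x‖ₑ ^ 2 * ‖(V x).im‖ₑ ^ 2 * ‖(ψ : L2 d) x‖ₑ ^ 2
      ≤ (b : ℝ≥0∞) ^ 2 * ∫⁻ x, ‖grad d ψ x‖ₑ ^ 2)
    {κ c : ℝ} (hc : 0 ≤ c) {w₁ w₂ : E d → ℝ} {p₁ p₂ : Fin d → E d → ℝ}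
    (hw₁ : MemLp w₁ 2 volume) (hw₂ : MemLp w₂ 2 volume)
    (hp₁ : ∀ j, MemLp (p₁ j) 2 volume) (hp₂ : ∀ j, MemLp (p₂ j) 2 volume)
    (hg₁ : HasWeakGrad w₁ p₁) (hg₂ : HasWeakGrad w₂ p₂)
    (hi₁ : ∀ g : E d → ℝ, ContDiff ℝ ∞ g → HasCompactSupport g →
      Integrable (fun x => g x * ((V x).im * w₁ x)) volume)
    (hi₂ : ∀ g : E d → ℝ, ContDiff ℝ ∞ g → HasCompactSupport g →
      Integrable (fun x => g x * ((V x).im * w₂ x)) volume)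
    (hf₁ : HasWeakDiv p₁ fun x => -((V x).im * w₂ x) - κ ^ 2 * w₁ x + c * κ * w₂ x)
    (hf₂ : HasWeakDiv p₂ fun x => (V x).im * w₁ x - κ ^ 2 * w₂ x - c * κ * w₁ x) :
    (∀ᵐ x, w₁ x = 0) ∧ ∀ᵐ x, w₂ x = 0 := by
  set W : E d → ℝ := fun x => (V x).im with hW
  -- For the unrotated function only the integrability of `|x|Wψ` matters; the quantitative bound is
  -- used for `v`.
  obtain ⟨hW₁, hW₂, -⟩ := weighted_bound hV hb hw₁ hw₂ hp₁ hp₂ hg₁ hg₂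
  have nw : MemLp (fun x => -w₁ x) 2 volume := hw₁.neg
  have np : ∀ j, MemLp (fun x => -p₁ j x) 2 volume := fun j => (hp₁ j).neg
  have nW : MemLp (fun x => ‖x‖ * (W x * -w₁ x)) 2 volume := by
    simpa only [mul_neg] using! hW₁.neg
  have ni : ∀ g : E d → ℝ, ContDiff ℝ ∞ g → HasCompactSupport g →
      Integrable (fun x => g x * (W x * -w₁ x)) volume := fun g hg hs => by
    simpa only [mul_neg] using! (hi₁ g hg hs).neg
  -- `v₁ + iv₂ = e^{-iκ|x|}(w₁ + iw₂)`: the imaginary part of a function is the real part of its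
  -- product with `-i`, which turns `(w₁, w₂)` into `(w₂, -w₁)`.
  set v₁ := rot κ w₁ w₂ with hv₁
  set v₂ := rot κ w₂ (fun x => -w₁ x) with hv₂
  set P₁ := rotGrad κ w₁ w₂ p₁ p₂ with hP₁
  set P₂ := rotGrad κ w₂ (fun x => -w₁ x) p₂ (fun j x => -p₁ j x) with hP₂
  have mv₁ : MemLp v₁ 2 volume := memLp_rot κ hw₁ hw₂
  have mv₂ : MemLp v₂ 2 volume := memLp_rot κ hw₂ nw
  have mP₁ : ∀ j, MemLp (P₁ j) 2 volume := memLp_rotGrad κ hw₁ hw₂ hp₁ hp₂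
  have mP₂ : ∀ j, MemLp (P₂ j) 2 volume := memLp_rotGrad κ hw₂ nw hp₂ np
  have g₁ : HasWeakGrad v₁ P₁ := hasWeakGrad_rot hd κ hw₁ hw₂ hp₁ hp₂ hg₁ hg₂
  have g₂ : HasWeakGrad v₂ P₂ := hasWeakGrad_rot hd κ hw₂ nw hp₂ np hg₂ hg₁.neg
  obtain ⟨mW₁, mW₂, hle⟩ := weighted_bound hV hb mv₁ mv₂ mP₁ mP₂ g₁ g₂
  have L₁ := hasLocalLaplacian_rot hw₁ hw₂ hp₁ hp₂ hg₁ hg₂ hW₁ hW₂ hi₁ hi₂ hf₁ hf₂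
  -- The equation is complex linear, so the equation for `v₂` is that for the real part with `ψ`
  -- replaced by `-iψ`; its companion function is then `-v₁`.
  have L₂ := hasLocalLaplacian_rot (κ := κ) (c := c) (W := W) hw₂ nw hp₂ np hg₂ hg₁.neg hW₂ nW
    hi₂ ni (by
      convert! hf₂ using 2
      ring) (by
      convert! hf₁.neg using 2
      ring)
  have r₁ : (rot κ (fun x => -w₁ x) fun x => -w₂ x) = fun x => -v₁ x := by
    ext x
    simp only [hv₁, rot]
    ring
  have r₂ : (rotGrad κ (fun x => -w₁ x) (fun x => -w₂ x) (fun j x => -p₁ j x)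
      fun j x => -p₂ j x) = fun j x => -P₁ j x := by
    ext j x
    simp only [hP₁, rotGrad, rot]
    ring
  rw [r₁, r₂] at L₂
  obtain ⟨iv, hv⟩ := virial_inequality hd hc (κ := κ) (W := W) mv₁ mv₂ mP₁ mP₂ g₁ g₂ mW₁ mW₂ L₁ (by
    convert! L₂ using 2
    rw [euler_neg]
    ring)
  have hN : ∀ {p : Fin d → E d → ℝ}, (∀ j, MemLp (p j) 2 volume) →
      Integrable (fun x => ∑ j, p j x * p j x) volume := fun hp =>
    integrable_finsetSum _ fun j _ => integrable_mul_of_memLp (hp j) (hp j)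
  have iN : Integrable (fun x => ∑ j, P₁ j x * P₁ j x + ∑ j, P₂ j x * P₂ j x) volume :=
    (hN mP₁).add (hN mP₂)
  have iX : Integrable (fun x => (‖x‖ * (W x * v₁ x)) ^ 2 + (‖x‖ * (W x * v₂ x)) ^ 2) volume :=
    mW₁.integrable_sq.add mW₂.integrable_sq
  have hmono : ∫ x, ((1 / 2) * (∑ j, P₁ j x * P₁ j x + ∑ j, P₂ j x * P₂ j x)
        - 2 * ((‖x‖ * (W x * v₁ x)) ^ 2 + (‖x‖ * (W x * v₂ x)) ^ 2))
      ≤ ∫ x, (2 * (W x * v₁ x * euler P₂ x - W x * v₂ x * euler P₁ x)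
        + ∑ j, P₁ j x * P₁ j x + ∑ j, P₂ j x * P₂ j x) := by
    refine integral_mono_ae ((iN.const_mul _).sub (iX.const_mul _)) iv ?_
    filter_upwards [ae_ne_zero (by omega : 0 < d)] with x hx
    have hr : 0 < ‖x‖ := norm_pos_iff.mpr hx
    -- Expand `(2|x|s + (x·P)/|x|)² ≥ 0` and use `(x·P)² ≤ |x|²|P|²`. The weights `2` and `1/2` are
    -- those that turn `b < 1/2` into a strictly positive constant below.
    have key : ∀ (P : Fin d → E d → ℝ) (s : ℝ), -(2 * (‖x‖ * s) ^ 2)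
        - 1 / 2 * (∑ j, P j x * P j x) ≤ 2 * (s * euler P x) := by
      intro P s
      have h1 : (euler P x / ‖x‖) ^ 2 ≤ ∑ j, P j x * P j x := by
        rw [div_pow, div_le_iff₀ (by positivity), mul_comm]
        exact euler_sq_le P x
      have h2 : (‖x‖ * s) * (euler P x / ‖x‖) = s * euler P x := by
        field_simp
      nlinarith [sq_nonneg (2 * (‖x‖ * s) + euler P x / ‖x‖)]
    have k1 := key P₂ (W x * v₁ x)
    have k2 := key P₁ (-(W x * v₂ x))
    simp only [mul_neg, neg_sq] at k2
    nlinarith [k1, k2]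
  rw [integral_sub (iN.const_mul _) (iX.const_mul _), integral_const_mul, integral_const_mul]
    at hmono
  have hb2 : (b : ℝ) < 1 / 2 := by exact_mod_cast hb1
  have hb3 : (b : ℝ) ^ 2 < 1 / 4 := by nlinarith [b.coe_nonneg]
  -- The virial inequality and the smallness bound combine to `(1/2 - 2b²)∫|∇v|² ≤ 0`, and `b² <
  -- 1/4`.
  have I0 : ∫ x, (∑ j, P₁ j x * P₁ j x + ∑ j, P₂ j x * P₂ j x) ≤ 0 := by
    by_contra hcon
    push Not at hcon
    nlinarith [hmono.trans hv, hle, hcon]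
  rw [integral_add (hN mP₁) (hN mP₂)] at I0
  have n1 : 0 ≤ ∫ x, ∑ j, P₁ j x * P₁ j x :=
    integral_nonneg fun x => Finset.sum_nonneg fun j _ => mul_self_nonneg _
  have n2 : 0 ≤ ∫ x, ∑ j, P₂ j x * P₂ j x :=
    integral_nonneg fun x => Finset.sum_nonneg fun j _ => mul_self_nonneg _
  have z₁ := ae_eq_zero_of_grad_eq_zero hd mv₁ mP₁ g₁ (by linarith)
  have z₂ := ae_eq_zero_of_grad_eq_zero hd mv₂ mP₂ g₂ (by linarith)
  have both : ∀ᵐ x, w₁ x = 0 ∧ w₂ x = 0 := by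
    filter_upwards [z₁, z₂] with x h1 h2
    -- The rotation is inverted pointwise.
    simp only [hv₁, hv₂, rot] at h1 h2
    have cs := Real.cos_sq_add_sin_sq (κ * ‖x‖)
    constructor
    · linear_combination Real.cos (κ * ‖x‖) * h1 - Real.sin (κ * ‖x‖) * h2 - w₁ x * cs
    · linear_combination Real.sin (κ * ‖x‖) * h1 + Real.cos (κ * ‖x‖) * h2 - w₂ x * cs
  exact ⟨both.mono fun x h => h.1, both.mono fun x h => h.2⟩

end Eigenvalues

/-! ### From the form equation to the real system -/

section Eigenfunction

variable {d : ℕ}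

theorem memLp_re (φ : L2 d) : MemLp (fun x => (φ x).re) 2 (volume : Measure (E d)) :=
  Complex.reCLM.comp_memLp' (Lp.memLp φ)

theorem memLp_im (φ : L2 d) : MemLp (fun x => (φ x).im) 2 (volume : Measure (E d)) :=
  Complex.imCLM.comp_memLp' (Lp.memLp φ)

theorem memLp_coord_re (G : L2Vec d) (j : Fin d) :
    MemLp (fun x => (G x j).re) 2 (volume : Measure (E d)) :=
  Complex.reCLM.comp_memLp' (memLp_coord G j)

theorem memLp_coord_im (G : L2Vec d) (j : Fin d) :
    MemLp (fun x => (G x j).im) 2 (volume : Measure (E d)) :=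
  Complex.imCLM.comp_memLp' (memLp_coord G j)

variable {V : E d → ℂ} {ψ : W12 d} {μ : ℂ}

theorem integrable_test_mul_potential
    (hψ : ∀ φ : W12 d, Integrable (fun x => conj ((φ : L2 d) x) * (V x * (ψ : L2 d) x)))
    {g : E d → ℝ} (hg : ContDiff ℝ ∞ g) (hs : HasCompactSupport g) :
    Integrable (fun x => (g x : ℂ) * (V x * (ψ : L2 d) x)) := by
  obtain ⟨φ, h1, -⟩ := exists_W12_test hg hs
  refine (hψ φ).congr ?_
  filter_upwards [h1] with x hx
  rw [hx, Complex.conj_ofReal]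

theorem weak_equation
    (hψ : ∀ φ : W12 d, Integrable (fun x => conj ((φ : L2 d) x) * (V x * (ψ : L2 d) x)) ∧
      inner ℂ (grad d φ) (grad d ψ) + ∫ x, conj ((φ : L2 d) x) * (V x * (ψ : L2 d) x)
        = inner ℂ (φ : L2 d) (μ • (ψ : L2 d)))
    {g : E d → ℝ} (hg : ContDiff ℝ ∞ g) (hs : HasCompactSupport g) :
    Integrable (fun x => ∑ j, (pd j g x : ℂ) * grad d ψ x j
      + ((g x : ℂ) * (V x * (ψ : L2 d) x) - (g x : ℂ) * (μ * (ψ : L2 d) x))) ∧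
    ∫ x, (∑ j, (pd j g x : ℂ) * grad d ψ x j
      + ((g x : ℂ) * (V x * (ψ : L2 d) x) - (g x : ℂ) * (μ * (ψ : L2 d) x))) = 0 := by
  have i1 : Integrable (fun x => ∑ j, (pd j g x : ℂ) * grad d ψ x j) := by
    refine integrable_finsetSum _ fun j _ => ?_
    simpa only [Complex.real_smul] using
      (locallyIntegrable_coord (grad d ψ) j).integrable_smul_left_of_hasCompactSupport
        (continuous_pd (j := j) hg) (hasCompactSupport_pd hs)
  have i2 := integrable_test_mul_potential (fun φ => (hψ φ).1) hg hs
  have i3 : Integrable (fun x => (g x : ℂ) * (μ * (ψ : L2 d) x)) := by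
    have h := ((locallyIntegrable_L2 (ψ : L2 d)).integrable_smul_left_of_hasCompactSupport
      hg.continuous hs).const_mul μ
    refine h.congr (Eventually.of_forall fun x => ?_)
    simp only [Complex.real_smul]
    ring
  refine ⟨i1.add (i2.sub i3), ?_⟩
  have i23 : Integrable (fun x => (g x : ℂ) * (V x * (ψ : L2 d) x)
    - (g x : ℂ) * (μ * (ψ : L2 d) x)) := i2.sub i3
  rw [integral_add i1 i23, integral_sub i2 i3]
  obtain ⟨φ, h1, h2⟩ := exists_W12_test hg hs
  have e := (hψ φ).2
  have e1 : inner ℂ (grad d φ) (grad d ψ) = ∫ x, ∑ j, (pd j g x : ℂ) * grad d ψ x j := by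
    rw [MeasureTheory.L2.inner_def]
    refine integral_congr_ae ?_
    filter_upwards [h2] with x hx
    rw [PiLp.inner_apply]
    refine Finset.sum_congr rfl fun j _ => ?_
    rw [hx j, RCLike.inner_apply, Complex.conj_ofReal, mul_comm]
  have e2 : ∫ x, conj ((φ : L2 d) x) * (V x * (ψ : L2 d) x)
      = ∫ x, (g x : ℂ) * (V x * (ψ : L2 d) x) := by
    refine integral_congr_ae ?_
    filter_upwards [h1] with x hx
    rw [hx, Complex.conj_ofReal]
  have e3 : inner ℂ (φ : L2 d) (μ • (ψ : L2 d)) = ∫ x, (g x : ℂ) * (μ * (ψ : L2 d) x) := by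
    rw [MeasureTheory.L2.inner_def]
    refine integral_congr_ae ?_
    filter_upwards [h1, Lp.coeFn_smul μ (ψ : L2 d)] with x hx hx2
    rw [hx, hx2, RCLike.inner_apply, Complex.conj_ofReal, mul_comm]
    rfl
  rw [e1, e2, e3] at e
  rw [← e]
  ring

theorem hasWeakDiv_re (hRe : ∀ᵐ x, (V x).re = 0)
    (hψ : ∀ φ : W12 d, Integrable (fun x => conj ((φ : L2 d) x) * (V x * (ψ : L2 d) x)) ∧
      inner ℂ (grad d φ) (grad d ψ) + ∫ x, conj ((φ : L2 d) x) * (V x * (ψ : L2 d) x)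
        = inner ℂ (φ : L2 d) (μ • (ψ : L2 d))) :
    HasWeakDiv (fun j x => (grad d ψ x j).re) (fun x => -((V x).im * ((ψ : L2 d) x).im)
      - μ.re * ((ψ : L2 d) x).re + μ.im * ((ψ : L2 d) x).im) := by
  intro g hg hs
  obtain ⟨i, e⟩ := weak_equation hψ hg hs
  have e1 := Complex.reCLM.integral_comp_comm i
  rw [e, map_zero] at e1
  have i1 : ∀ j, Integrable (fun x => pd j g x * (grad d ψ x j).re) volume := fun j =>
    integrable_test_mul ((memLp_coord_re _ j).locallyIntegrable (by norm_num))
      (continuous_pd hg) (hasCompactSupport_pd hs)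
  have ip : Integrable (fun x => ∑ j, pd j g x * (grad d ψ x j).re) volume :=
    integrable_finsetSum _ fun j _ => i1 j
  have er : (fun x => Complex.reCLM (∑ j, (pd j g x : ℂ) * grad d ψ x j
      + ((g x : ℂ) * (V x * (ψ : L2 d) x) - (g x : ℂ) * (μ * (ψ : L2 d) x))))
      =ᵐ[volume] fun x => ∑ j, pd j g x * (grad d ψ x j).re
        + g x * (-((V x).im * ((ψ : L2 d) x).im)
          - μ.re * ((ψ : L2 d) x).re + μ.im * ((ψ : L2 d) x).im) := by
    filter_upwards [hRe] with x hx
    simp only [Complex.reCLM_apply, Complex.add_re, Complex.re_sum, Complex.sub_re,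
      Complex.mul_re, Complex.mul_im, Complex.ofReal_re, Complex.ofReal_im, hx, zero_mul, sub_zero]
    ring
  have it := (Complex.reCLM.integrable_comp i).congr er
  have iq : Integrable (fun x => g x * (-((V x).im * ((ψ : L2 d) x).im)
      - μ.re * ((ψ : L2 d) x).re + μ.im * ((ψ : L2 d) x).im)) volume := by
    refine (it.sub ip).congr (Eventually.of_forall fun x => ?_)
    simp only [Pi.sub_apply]
    ring
  rw [integral_congr_ae er, integral_add ip iq, integral_finsetSum _ fun j _ => i1 j] at e1
  linarith

theorem hasWeakDiv_im (hRe : ∀ᵐ x, (V x).re = 0)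
    (hψ : ∀ φ : W12 d, Integrable (fun x => conj ((φ : L2 d) x) * (V x * (ψ : L2 d) x)) ∧
      inner ℂ (grad d φ) (grad d ψ) + ∫ x, conj ((φ : L2 d) x) * (V x * (ψ : L2 d) x)
        = inner ℂ (φ : L2 d) (μ • (ψ : L2 d))) :
    HasWeakDiv (fun j x => (grad d ψ x j).im) (fun x => (V x).im * ((ψ : L2 d) x).re
      - μ.re * ((ψ : L2 d) x).im - μ.im * ((ψ : L2 d) x).re) := by
  intro g hg hs
  obtain ⟨i, e⟩ := weak_equation hψ hg hs
  have e1 := Complex.imCLM.integral_comp_comm i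
  rw [e, map_zero] at e1
  have i1 : ∀ j, Integrable (fun x => pd j g x * (grad d ψ x j).im) volume := fun j =>
    integrable_test_mul ((memLp_coord_im _ j).locallyIntegrable (by norm_num))
      (continuous_pd hg) (hasCompactSupport_pd hs)
  have ip : Integrable (fun x => ∑ j, pd j g x * (grad d ψ x j).im) volume :=
    integrable_finsetSum _ fun j _ => i1 j
  have er : (fun x => Complex.imCLM (∑ j, (pd j g x : ℂ) * grad d ψ x j
      + ((g x : ℂ) * (V x * (ψ : L2 d) x) - (g x : ℂ) * (μ * (ψ : L2 d) x))))
      =ᵐ[volume] fun x => ∑ j, pd j g x * (grad d ψ x j).im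
        + g x * ((V x).im * ((ψ : L2 d) x).re
          - μ.re * ((ψ : L2 d) x).im - μ.im * ((ψ : L2 d) x).re) := by
    filter_upwards [hRe] with x hx
    simp only [Complex.imCLM_apply, Complex.add_im, Complex.im_sum, Complex.sub_im,
      Complex.mul_re, Complex.mul_im, Complex.ofReal_re, Complex.ofReal_im, hx, zero_mul,
      add_zero]
    ring
  have it := (Complex.imCLM.integrable_comp i).congr er
  have iq : Integrable (fun x => g x * ((V x).im * ((ψ : L2 d) x).re
      - μ.re * ((ψ : L2 d) x).im - μ.im * ((ψ : L2 d) x).re)) volume := by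
    refine (it.sub ip).congr (Eventually.of_forall fun x => ?_)
    simp only [Pi.sub_apply]
    ring
  rw [integral_congr_ae er, integral_add ip iq, integral_finsetSum _ fun j _ => i1 j] at e1
  linarith

/-- Test the equation with `ψ`: the potential contributes `i∫W|ψ|²`, which is purely imaginary. -/
theorem norm_grad_sq_eq (hRe : ∀ᵐ x, (V x).re = 0)
    (hψ : ∀ φ : W12 d, Integrable (fun x => conj ((φ : L2 d) x) * (V x * (ψ : L2 d) x)) ∧
      inner ℂ (grad d φ) (grad d ψ) + ∫ x, conj ((φ : L2 d) x) * (V x * (ψ : L2 d) x)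
        = inner ℂ (φ : L2 d) (μ • (ψ : L2 d))) :
    ‖grad d ψ‖ ^ 2 = μ.re * ‖(ψ : L2 d)‖ ^ 2 := by
  obtain ⟨i, e⟩ := hψ ψ
  have e1 := Complex.reCLM.integral_comp_comm i
  have e2 : ∫ x, Complex.reCLM (conj ((ψ : L2 d) x) * (V x * (ψ : L2 d) x)) = 0 := by
    refine integral_eq_zero_of_ae ?_
    filter_upwards [hRe] with x hx
    simp only [Complex.reCLM_apply, Complex.mul_re, Complex.mul_im, Complex.conj_re,
      Complex.conj_im, hx, Pi.zero_apply]
    ring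
  rw [e2] at e1
  rw [inner_smul_right, inner_self_eq_norm_sq_to_K, inner_self_eq_norm_sq_to_K] at e
  have e3 := congrArg Complex.re e
  rw [Complex.add_re, ← Complex.reCLM_apply (∫ x, _), ← e1, add_zero, Complex.mul_re] at e3
  simpa [← Complex.ofReal_pow] using e3

theorem eq_zero_of_eigenfunction (hd : 3 ≤ d) (hV : AEStronglyMeasurable V volume)
    (hRe : ∀ᵐ x, (V x).re = 0) (hsmall : IsSmallImaginary V)
    (hψ : ∀ φ : W12 d, Integrable (fun x => conj ((φ : L2 d) x) * (V x * (ψ : L2 d) x)) ∧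
      inner ℂ (grad d φ) (grad d ψ) + ∫ x, conj ((φ : L2 d) x) * (V x * (ψ : L2 d) x)
        = inner ℂ (φ : L2 d) (μ • (ψ : L2 d))) :
    (ψ : L2 d) = 0 := by
  obtain ⟨b, hb1, hb⟩ := hsmall
  have finish : (∀ᵐ x, ((ψ : L2 d) x).re = 0) → (∀ᵐ x, ((ψ : L2 d) x).im = 0) →
      (ψ : L2 d) = 0 := by
    intro h1 h2
    refine Lp.ext ?_
    filter_upwards [h1, h2, Lp.coeFn_zero ℂ 2 (volume : Measure (E d))] with x h1 h2 h3
    rw [h3]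
    exact Complex.ext h1 h2
  have g₁ := hasWeakGrad_re ψ
  have g₂ := hasWeakGrad_im ψ
  have mw₁ := memLp_re (ψ : L2 d)
  have mw₂ := memLp_im (ψ : L2 d)
  have mp₁ := memLp_coord_re (grad d ψ)
  have mp₂ := memLp_coord_im (grad d ψ)
  have en := norm_grad_sq_eq hRe hψ
  by_cases hG : grad d ψ = 0
  · have hz : ∀ᵐ x, ∀ j, grad d ψ x j = 0 := by
      filter_upwards [Lp.coeFn_zero (EuclideanSpace ℂ (Fin d)) 2 (volume : Measure (E d))]
        with x hx j
      rw [hG, hx]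
      rfl
    refine finish (ae_eq_zero_of_grad_eq_zero hd mw₁ mp₁ g₁ (le_of_eq ?_))
      (ae_eq_zero_of_grad_eq_zero hd mw₂ mp₂ g₂ (le_of_eq ?_))
    · refine integral_eq_zero_of_ae ?_
      filter_upwards [hz] with x hx
      simp [hx]
    · refine integral_eq_zero_of_ae ?_
      filter_upwards [hz] with x hx
      simp [hx]
  have hpos : 0 < μ.re := by
    have h1 : 0 < ‖grad d ψ‖ ^ 2 := by
      have := norm_pos_iff.mpr hG
      positivity
    rw [en] at h1
    exact pos_of_mul_pos_left h1 (sq_nonneg _)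
  -- The sign of `κ = ±√(Re μ)` is taken to be that of `Im μ`, so that `c = |Im μ|/√(Re μ)` is
  -- nonnegative, as the multiplier bound requires.
  obtain ⟨κ, c, hc, hκ, hcκ⟩ : ∃ κ c : ℝ, 0 ≤ c ∧ κ ^ 2 = μ.re ∧ c * κ = μ.im := by
    have hs : 0 < √μ.re := Real.sqrt_pos.mpr hpos
    have hsq : √μ.re ^ 2 = μ.re := Real.sq_sqrt hpos.le
    rcases le_total 0 μ.im with h | h
    · exact ⟨√μ.re, μ.im / √μ.re, div_nonneg h hs.le, hsq, div_mul_cancel₀ _ hs.ne'⟩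
    · refine ⟨-√μ.re, -μ.im / √μ.re, div_nonneg (neg_nonneg.mpr h) hs.le, by rw [neg_sq, hsq], ?_⟩
      field_simp
  have f₁ := hasWeakDiv_re hRe hψ
  have f₂ := hasWeakDiv_im hRe hψ
  rw [← hκ, ← hcκ] at f₁ f₂
  have ig : ∀ g : E d → ℝ, ContDiff ℝ ∞ g → HasCompactSupport g →
      Integrable (fun x => (g x : ℂ) * (V x * (ψ : L2 d) x)) := fun g hg hs =>
    integrable_test_mul_potential (fun φ => (hψ φ).1) hg hs
  -- As `V = iW`, the products `W Re ψ` and `W Im ψ` are the imaginary part and minus the real part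
  -- of `Vψ`, which gives their integrability against test functions.
  obtain ⟨z₁, z₂⟩ := ae_eq_zero_of_eigenfunction hd hV hb1 hb hc mw₁ mw₂ mp₁ mp₂ g₁ g₂
    (fun g hg hs => by
      refine (Complex.imCLM.integrable_comp (ig g hg hs)).congr ?_
      filter_upwards [hRe] with x hx
      simp only [Complex.imCLM_apply, Complex.mul_re, Complex.mul_im, Complex.ofReal_re, Complex.ofReal_im, hx]
      ring)
    (fun g hg hs => by
      refine (Complex.reCLM.integrable_comp (ig g hg hs)).neg.congr ?_
      filter_upwards [hRe] with x hx
      simp only [Pi.neg_apply, Complex.reCLM_apply, Complex.mul_re, Complex.mul_im, Complex.ofReal_re, Complex.ofReal_im, hx]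
      ring) f₁ f₂
  exact finish z₁ z₂

end Eigenfunction

end Schrodinger

theorem mainTheorem2 (d : ℕ) (hd : 3 ≤ d) (V : Schrodinger.E d → ℂ)
    (hV : MeasureTheory.LocallyIntegrable V MeasureTheory.volume)
    (hRe : ∀ᵐ x, (V x).re = 0)
    (hsmall : Schrodinger.IsSmallImaginary V)
    (hsub : Schrodinger.IsFormSubordinate V) :
    Schrodinger.pointSpectrum (Schrodinger.schrodinger V) = ∅ := by
  rw [Set.eq_empty_iff_forall_notMem]
  rintro μ ⟨ψ, hne, hT⟩
  have hmem := (Schrodinger.schrodinger V).mem_graph ψ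
  rw [Schrodinger.graph_schrodinger, hT] at hmem
  obtain ⟨ψ', h1, h2⟩ := hmem
  dsimp only at h1 h2
  rw [← h1] at h2
  have h0 := Schrodinger.eq_zero_of_eigenfunction hd hV.aestronglyMeasurable hRe hsmall h2
  rw [h0] at h1
  exact hne (Subtype.ext h1.symm)
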